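/- Consider the infinite spin-$\tfrac12$ chain with sites $\mathbb Z$. Let $\mathcal T_M$ be the space of traceless translationally invariant operators $\mathcal Q=\sum_{j\in\mathbb Z} q_j$ of maximum range $M$, where $q_j$ is the translate by $j$ of $q_0$ and $q_0$ is a linear combination of Pauli strings on the sites $0,\dots,M-1$ whose letter at site $0$ is not the identity. Put $\langle \mathcal Q,\mathcal Q'\rangle=\mathrm{Tr}[q_0^\dagger q_0']/\mathrm{Tr}[I^{\otimes M}]$, $\|\mathcal Q\|_F=\langle \mathcal Q,\mathcal Q\rangle^{1/2}$ and $\mathrm{ad}_A(B)=[A,B]$. Let $\Gamma>0$, and let $H_0\in\mathcal T_1$, $T\in\mathcal T_2$ be Hermitian with $\|H_0\|_F=\|T\|_F=\Gamma$ and $\langle H_0,T\rangle=0$. For $O\in\bigcup_M\mathcal T_M$ let $O^{\mathrm{diag}}$ be its orthogonal projection to $\ker \mathrm{ad}_{H_0}$, and $O^{\text{off-diag}}=O-O^{\mathrm{diag}}$. Assume $T^{\mathrm{diag}}\neq0$ and put $\alpha=\|T^{\mathrm{diag}}\|_F^2/\Gamma^2$. Let $H=H_0+\epsilon T$ with $\epsilon>0$.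 For $n\ge1$ the order-$n$ Schrieffer–Wolff construction is as follows. Write $[k_1,\dots,k_p]=m$ for summation over integers $1\le k_i\le n$ with $k_1+\dots+k_p=m$. Let $\mathfrak f(k_1,\dots,k_p)=1/\prod_{l=1}^n c_l!$ if $1\le k_1\le\dots\le k_p\le n$, where $c_l=\#\{i:k_i=l\}$, and $\mathfrak f=0$ otherwise. Set $V_1=T$ and, for $m\ge2$, $$V_m=\sum_{p=2}^m\sum_{[k_1,\dots,k_p]=m}\mathfrak f(k_1,\dots,k_p)\,i\,\mathrm{ad}_{S_{k_p}}\cdots i\,\mathrm{ad}_{S_{k_1}}(H_0)+\sum_{p=1}^{m-1}\sum_{[k_1,\dots,k_p]=m-1}\mathfrak f(k_1,\dots,k_p)\,i\,\mathrm{ad}_{S_{k_p}}\cdots i\,\mathrm{ad}_{S_{k_1}}(T),$$ where $iS_m=[\mathrm{ad}_{H_0}]^{-1}V_m^{\text{off-diag}}$ and $[\mathrm{ad}_{H_0}]^{-1}$ is the (Moore–Penrose) pseudoinverse. Further let $$I_m=\sum_{p=1}^m\sum_{[k_1,\dots,k_p]=m}(-1)^p\,\mathfrak f(k_1,\dots,k_p)\,i\,\mathrm{ad}_{S_{k_1}}\cdots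 i\,\mathrm{ad}_{S_{k_p}}(H_0),\qquad I^{(n)}=H_0+\sum_{m=1}^n\epsilon^mI_m,$$ $$I^{(n)\perp}=I^{(n)}-\frac{\langle H,I^{(n)}\rangle}{\|H\|_F^2}H,\qquad \tilde I^{(n)}=\frac{I^{(n)\perp}}{\|I^{(n)\perp}\|_F},\qquad \rho_n=\frac1{263\,n^2}.$$ Then there are constants $C(\alpha)$ and $c(\alpha)>0$ that depend only on $\alpha$, and not on $n$, $\epsilon$, $\Gamma$, $H_0$, $T$ otherwise, such that for all $n\ge1$ and all $\epsilon>0$ with $\epsilon/\rho_n\le\frac12$: (i) $I^{(n)\perp}\ne0$ whenever $\epsilon\le c(\alpha)$; (ii) whenever $I^{(n)\perp}\neq0$ (so that $\tilde I^{(n)}$ is defined), $$\|\mathrm{ad}_H(\tilde I^{(n)})\|_F^2=\frac{\|\mathrm{ad}_H(I^{(n)\perp})\|_F^2}{\|I^{(n)\perp}\|_F^2}\le C(\alpha)\,\Gamma^2\,n^{4n+6}\,\epsilon^{2n}.$$ -/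

import Mathlib

open scoped Nat BigOperators

noncomputable section

namespace SpinChain

/-! ### Pauli strings on the infinite chain -/

/-- Labels of the one-site Pauli operators: `(0,0)` is `I`, `(1,0)` is `X`, `(1,1)` is `Y` and
`(0,1)` is `Z`.  Addition of labels is multiplication of Pauli operators up to a phase. -/
abbrev PauliLabel : Type := ZMod 2 × ZMod 2

/-- The Pauli matrix with a given label. -/
def pauliMatrix (a : PauliLabel) : Matrix (Fin 2) (Fin 2) ℂ :=
  if a = (0, 0) then 1
  else if a = (1, 0) then !![0, 1; 1, 0]
  else if a = (1, 1) then !![0, -Complex.I; Complex.I, 0]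
  else !![1, 0; 0, -1]

/-- The phase in the product of two Pauli matrices, read off with the trace;
see `pauliMatrix_mul`. -/
def pauliPhase (a b : PauliLabel) : ℂ :=
  (pauliMatrix (a + b) * (pauliMatrix a * pauliMatrix b)).trace / 2

theorem pauliMatrix_mul (a b : PauliLabel) :
    pauliMatrix a * pauliMatrix b = pauliPhase a b • pauliMatrix (a + b) := by
  have key : ∀ x : PauliLabel, x = (0, 0) ∨ x = (1, 0) ∨ x = (1, 1) ∨ x = (0, 1) := by decide
  have h2 : (1 : ZMod 2) + 1 = 0 := by decide
  rcases key a with rfl | rfl | rfl | rfl <;> rcases key b with rfl | rfl | rfl | rfl <;>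
    · ext i j
      fin_cases i <;> fin_cases j <;>
        simp [pauliPhase, pauliMatrix, h2, Matrix.trace, Matrix.mul_apply, Fin.sum_univ_two,
          Matrix.one_apply]

/-- Pauli strings: a Pauli label at every site of the chain `ℤ`, all but finitely many being the
identity. -/
abbrev PauliString : Type := ℤ →₀ PauliLabel

/-- The phase in the product of two Pauli strings:
the product of `s` and `t` is `stringPhase s t` times the string `s + t`. -/
def stringPhase (s t : PauliString) : ℂ :=
  ∏ j ∈ s.support ∪ t.support, pauliPhase (s j) (t j)

/-- The string `s` translated by `j` sites. -/
def translate (j : ℤ) (s : PauliString) : PauliString :=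
  Finsupp.equivMapDomain (Equiv.addRight j) s

/-! ### Translationally invariant operators -/

/-- Formal operators on the infinite chain, `A = ∑ s, A s • s` over all Pauli strings `s`. -/
abbrev Op : Type := PauliString → ℂ

/-- `𝒯 M`: the traceless translationally invariant operators of maximum range `M`, that is, the
sums `∑ j, q_j` where `q_j` is the translate by `j` of one operator `q_0` supported on `M`
consecutive sites. -/
def 𝒯 (M : ℕ) : Submodule ℂ Op where
  carrier := {A | (∀ j s, A (translate j s) = A s) ∧ A 0 = 0 ∧
    ∀ s, A s ≠ 0 → ∃ j : ℤ, ∀ i, s i ≠ 0 → j ≤ i ∧ i < j + M}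
  zero_mem' := ⟨fun _ _ => rfl, rfl, fun _ h => absurd rfl h⟩
  add_mem' := by
    rintro A B ⟨hA, hA0, hA'⟩ ⟨hB, hB0, hB'⟩
    refine ⟨fun j s => by simp [hA, hB], by simp [hA0, hB0], fun s hs => ?_⟩
    by_cases h : A s = 0
    · exact hB' s (fun h' => hs (by simp [h, h']))
    · exact hA' s h
  smul_mem' := by
    rintro c A ⟨hA, hA0, hA'⟩
    refine ⟨fun j s => by simp [hA], by simp [hA0], fun s hs => hA' s (fun h => hs (by simp [h]))⟩

/-- Traceless translationally invariant operators of some finite range. -/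
def IsLocal (A : Op) : Prop := ∃ M, A ∈ 𝒯 M

/-- Hermiticity: real coefficients in the Pauli-string basis. -/
def IsHermitianOp (A : Op) : Prop := ∀ s, star (A s) = A s

/-- The commutator `[A, B]`, computed by multiplying the formal sums of strings. -/
def ad (A B : Op) : Op := fun s =>
  ∑ᶠ t : PauliString, A t * B (s - t) * (stringPhase t (s - t) - stringPhase (s - t) t)

/-- The strings whose leftmost non-identity letter sits at site `0`.  A translationally invariant
operator is `∑ j, q_j` where `q_0` is the part of its expansion on these strings. -/
def anchored : Set PauliString := {s | s 0 ≠ 0 ∧ ∀ i < 0, s i = 0}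

/-- The intensive Frobenius inner product `Tr[q_0† q'_0] / Tr[1]` of `∑ j, q_j` and `∑ j, q'_j`;
the Pauli strings are orthonormal for the normalized trace. -/
def frobInner (A B : Op) : ℂ := ∑ᶠ (s : PauliString) (_ : s ∈ anchored), star (A s) * B s

/-- The intensive Frobenius norm. -/
def frobNorm (A : Op) : ℝ := √(frobInner A A).re

/-! ### Diagonal part and pseudoinverse -/

/-- `X` is orthogonal to the kernel of `ad H₀`. -/
def OrthKer (H₀ X : Op) : Prop := ∀ K, IsLocal K → ad H₀ K = 0 → frobInner K X = 0

open Classical in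
/-- The diagonal part of `A`: its component in the kernel of `ad H₀`. -/
def diagPart (H₀ A : Op) : Op :=
  if h : ∃ D, IsLocal D ∧ ad H₀ D = 0 ∧ OrthKer H₀ (A - D) then h.choose else 0

/-- The off-diagonal part of `A`. -/
def offDiagPart (H₀ A : Op) : Op := A - diagPart H₀ A

open Classical in
/-- The pseudoinverse of `ad H₀`, applied to `A`: the `X` orthogonal to the kernel of `ad H₀` for
which `ad H₀ X` is the orthogonal projection of `A` to the range of `ad H₀`. -/
def adPinv (H₀ A : Op) : Op :=
  if h : ∃ X, IsLocal X ∧ OrthKer H₀ X ∧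
      ∀ Y, IsLocal Y → frobInner (ad H₀ Y) (A - ad H₀ X) = 0 then h.choose else 0

/-! ### The local Schrieffer-Wolff construction -/

/-- The combinatorial factor `𝔣(k₁, …, k_p)` of the order-`n` construction. -/
def swFactor (n : ℕ) (k : List ℕ) : ℂ :=
  if k.Pairwise (· ≤ ·) ∧ ∀ x ∈ k, 1 ≤ x ∧ x ≤ n then
    (∏ l ∈ Finset.Icc 1 n, ((k.count l)! : ℂ))⁻¹
  else 0

/-- The potential `V_m` in terms of the generators `G k = i S_k`, so that `i ad_{S_k} = ad (G k)`.
The sums run over `k₁ + ⋯ + k_p = m` with `p ≥ 2`, and `k₁ + ⋯ + k_p = m - 1` with `p ≥ 1`;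
the generator of `k₁` acts first. -/
def potentialOf (n : ℕ) (H₀ T : Op) (G : ℕ → Op) (m : ℕ) : Op :=
  if m = 1 then T
  else
    (∑ k : Composition m with 2 ≤ k.length,
      swFactor n k.blocks • k.blocks.foldl (fun X l => ad (G l) X) H₀) +
    ∑ k : Composition (m - 1) with 1 ≤ k.length,
      swFactor n k.blocks • k.blocks.foldl (fun X l => ad (G l) X) T

/-- The generators `i S_m`, solved order by order: `i S_m` is the pseudoinverse of `ad H₀` applied
to the off-diagonal part of `V_m`, and `V_m` only involves the `S_k` with `k < m`. -/
def swGen (n : ℕ) (H₀ T : Op) (m : ℕ) : Op :=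
  adPinv H₀ (offDiagPart H₀
    (potentialOf n H₀ T (fun k => if _h : k < m then swGen n H₀ T k else 0) m))
termination_by m
decreasing_by exact _h

/-- The coefficient `I_m` of `ε ^ m` in `U H₀ U†`; the generator of `k_p` acts first. -/
def swI (n : ℕ) (H₀ T : Op) (m : ℕ) : Op :=
  ∑ k : Composition m with 1 ≤ k.length,
    ((-1) ^ k.length * swFactor n k.blocks) •
      k.blocks.foldr (fun l X => ad (swGen n H₀ T l) X) H₀

/-- The Hamiltonian `H = H₀ + ε T`. -/
def hamiltonian (H₀ T : Op) (ε : ℝ) : Op := H₀ + (ε : ℂ) • T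

/-- The truncated quasi-conserved operator `I⁽ⁿ⁾ = H₀ + ∑_{m=1}^n ε^m I_m`. -/
def quasiI (n : ℕ) (H₀ T : Op) (ε : ℝ) : Op :=
  H₀ + ∑ m ∈ Finset.Icc 1 n, ((ε : ℂ) ^ m) • swI n H₀ T m

/-- `I⁽ⁿ⁾` with its component parallel to `H` removed. -/
def quasiIPerp (n : ℕ) (H₀ T : Op) (ε : ℝ) : Op :=
  quasiI n H₀ T ε -
    (frobInner (hamiltonian H₀ T ε) (quasiI n H₀ T ε) /
      ((frobNorm (hamiltonian H₀ T ε) ^ 2 : ℝ) : ℂ)) • hamiltonian H₀ T ε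

/-- The normalized quasi-conserved operator `Ĩ⁽ⁿ⁾`. -/
def quasiITilde (n : ℕ) (H₀ T : Op) (ε : ℝ) : Op :=
  (((frobNorm (quasiIPerp n H₀ T ε))⁻¹ : ℝ) : ℂ) • quasiIPerp n H₀ T ε

/-- `ρ_n = 1 / (263 n²)`. -/
def rho (n : ℕ) : ℝ := 1 / (263 * (n : ℝ) ^ 2)

end SpinChain

end

/-!
# Approximate conservation of the truncated Schrieffer-Wolff operator

The dressed operator `I⁽ⁿ⁾` is an exponential conjugate of `H₀`, expanded to order `n`. The
generators are chosen so that the conjugate of `H₀ + ε T` commutes with `H₀` up to order `n`;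
conjugating back, `H = H₀ + ε T` commutes with the dressed `H₀` up to order `n`, and what is left
is the single commutator `[H, I⁽ⁿ⁾] = ε ^ (n + 1) [T, I_n]` (`ad_hamiltonian_quasiI`). The algebra
behind it takes place in power series over the endomorphisms of the Lie algebra of local operators:
the weights `swFactor` are the coefficients of a product of exponentials (`sum_swFactor_succ`), and
`lie_bwdSeries_eq_zero` moves the conservation law through the conjugation.

The size of `[T, I_n]` is controlled in a weighted norm, the sum over all supports containing the
origin of the Frobenius norms of the parts with that support, weighted by `4` per site. It has two
properties. First, a commutator of operators of ranges `a` and `b` costs only `2 (a + b)`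
(`opNorm_ad_le`): the weight pays for the failure of the Frobenius norm to be submultiplicative and
for the number of supports of a product. Second, `ad H₀` is symmetric and preserves supports, so
that removing the diagonal part is a contraction (`opNorm_offDiagPart_le`); and on each support it
is a sum of commuting one-site rotations with spectrum `{-2 Γ, 0, 2 Γ}`, so that its eigenvalues are
multiples of `2 Γ` and the pseudoinverse costs `1 / (2 Γ)` (`opNorm_adPinv_le`). Up to order `n` all ranges are at
most `n + 1`, so the potentials, rescaled by the cost of a commutator, satisfy a recursion of
Catalan type with step proportional to `n` (`le_pow_of_quadratic_recursion`). Hence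
`‖I_n‖ ≤ Γ (C n) ^ n` (`opNormR_swI_le`), which is at most a constant times `Γ n ^ (2 n)`.

For the lower bound, `I⁽ⁿ⁾ = H - ε T^diag + R` with `‖R‖` of order `Γ ε ^ 2`, uniformly in `n` as
`ε n ^ 2` is bounded. Since `T^diag` is nearly orthogonal to `H`, the part of `I⁽ⁿ⁾` orthogonal to
`H` has norm at least `ε √α Γ / 4` for small `ε` (`le_frobNorm_quasiIPerp`), and the quotient is the
claimed rate. If `ε` is not small in terms of `α`, then the condition on `ε n ^ 2` leaves finitely
many `n`, for which any bound on `‖[H, Ĩ⁽ⁿ⁾]‖ / Γ` will do.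
-/

noncomputable section

namespace SpinChain

/-! ### Phases -/

theorem pauliLabel_cases (x : PauliLabel) :
    x = (0, 0) ∨ x = (1, 0) ∨ x = (1, 1) ∨ x = (0, 1) := by
  revert x; decide

theorem PauliLabel.neg_eq (x : PauliLabel) : -x = x := by revert x; decide

theorem PauliString.neg_eq (s : PauliString) : -s = s := by
  ext j : 1
  exact PauliLabel.neg_eq _

theorem PauliString.sub_eq_add (s t : PauliString) : s - t = s + t := by
  rw [sub_eq_add_neg, PauliString.neg_eq]

@[simp] theorem pauliPhase_zero_left (a : PauliLabel) : pauliPhase 0 a = 1 := by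
  change pauliPhase (0, 0) a = 1
  rcases pauliLabel_cases a with rfl | rfl | rfl | rfl <;>
    simp [pauliPhase, pauliMatrix, Matrix.trace, Fin.sum_univ_two]

@[simp] theorem pauliPhase_zero_right (a : PauliLabel) : pauliPhase a 0 = 1 := by
  change pauliPhase a (0, 0) = 1
  rcases pauliLabel_cases a with rfl | rfl | rfl | rfl <;>
    simp [pauliPhase, pauliMatrix, Matrix.trace, Fin.sum_univ_two]

theorem pauliMatrix_ne_zero (a : PauliLabel) : pauliMatrix a ≠ 0 := by
  intro h
  have h0 := congrFun (congrFun h 0) 0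
  have h1 := congrFun (congrFun h 0) 1
  rcases pauliLabel_cases a with rfl | rfl | rfl | rfl <;> simp [pauliMatrix] at h0 h1

/-- Associativity of the product of Pauli matrices. -/
theorem pauliPhase_cocycle (a b c : PauliLabel) :
    pauliPhase a b * pauliPhase (a + b) c = pauliPhase b c * pauliPhase a (b + c) := by
  have h := Matrix.mul_assoc (pauliMatrix a) (pauliMatrix b) (pauliMatrix c)
  simp only [pauliMatrix_mul, Matrix.smul_mul, Matrix.mul_smul, smul_smul, add_assoc] at h
  have h' := sub_eq_zero.2 h
  rw [← sub_smul, smul_eq_zero, or_iff_left (pauliMatrix_ne_zero _)] at h'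
  linear_combination h'

theorem norm_pauliPhase (a b : PauliLabel) : ‖pauliPhase a b‖ = 1 := by
  have h2 : (1 : ZMod 2) + 1 = 0 := by decide
  rcases pauliLabel_cases a with rfl | rfl | rfl | rfl <;>
    rcases pauliLabel_cases b with rfl | rfl | rfl | rfl <;>
    simp [pauliPhase, pauliMatrix, h2, Matrix.trace, Fin.sum_univ_two]

theorem stringPhase_eq_prod {s t : PauliString} {F : Finset ℤ}
    (hs : s.support ⊆ F) (ht : t.support ⊆ F) :
    stringPhase s t = ∏ j ∈ F, pauliPhase (s j) (t j) := by
  refine Finset.prod_subset (Finset.union_subset hs ht) fun j _ hj => ?_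
  simp only [Finset.mem_union, Finsupp.mem_support_iff, not_or, not_not] at hj
  simp [hj.1]

theorem stringPhase_cocycle (s t u : PauliString) :
    stringPhase s t * stringPhase (s + t) u = stringPhase t u * stringPhase s (t + u) := by
  classical
  set F := s.support ∪ t.support ∪ u.support
  have hs : s.support ⊆ F := fun j hj => by simp [F]; simp at hj; tauto
  have ht : t.support ⊆ F := fun j hj => by simp [F]; simp at hj; tauto
  have hu : u.support ⊆ F := fun j hj => by simp [F]; simp at hj; tauto
  have hst : (s + t).support ⊆ F := Finsupp.support_add.trans (Finset.union_subset hs ht)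
  have htu : (t + u).support ⊆ F := Finsupp.support_add.trans (Finset.union_subset ht hu)
  rw [stringPhase_eq_prod hs ht, stringPhase_eq_prod hst hu, stringPhase_eq_prod ht hu,
    stringPhase_eq_prod hs htu, ← Finset.prod_mul_distrib, ← Finset.prod_mul_distrib]
  exact Finset.prod_congr rfl fun j _ => pauliPhase_cocycle _ _ _

theorem norm_stringPhase (s t : PauliString) : ‖stringPhase s t‖ = 1 := by
  rw [stringPhase, norm_prod]
  exact Finset.prod_eq_one fun j _ => norm_pauliPhase _ _

theorem stringPhase_of_disjoint {s t : PauliString} (h : Disjoint s.support t.support) :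
    stringPhase s t = 1 := by
  refine Finset.prod_eq_one fun j _ => ?_
  by_cases hs : s j = 0
  · simp [hs]
  · have : t j = 0 := by
      by_contra ht
      exact Finset.disjoint_left.1 h (Finsupp.mem_support_iff.2 hs) (Finsupp.mem_support_iff.2 ht)
    simp [this]

/-- The structure constants of the commutator: `[s, t] = commPhase s t • (s + t)`. -/
def commPhase (s t : PauliString) : ℂ := stringPhase s t - stringPhase t s

theorem commPhase_swap (s t : PauliString) : commPhase s t = -commPhase t s := by
  simp [commPhase]

theorem commPhase_self (s : PauliString) : commPhase s s = 0 := by simp [commPhase]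

theorem commPhase_of_disjoint {s t : PauliString} (h : Disjoint s.support t.support) :
    commPhase s t = 0 := by
  rw [commPhase, stringPhase_of_disjoint h, stringPhase_of_disjoint h.symm, sub_self]

theorem norm_commPhase_le (s t : PauliString) : ‖commPhase s t‖ ≤ 2 := by
  refine (norm_sub_le _ _).trans ?_
  rw [norm_stringPhase, norm_stringPhase]; norm_num

theorem exists_mem_of_commPhase_ne_zero {s t : PauliString} (h : commPhase s t ≠ 0) :
    ∃ j, s j ≠ 0 ∧ t j ≠ 0 := by
  by_contra! H
  refine h (commPhase_of_disjoint (Finset.disjoint_left.2 fun j hs ht => ?_))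
  exact (Finsupp.mem_support_iff.1 ht) (H j (Finsupp.mem_support_iff.1 hs))

/-- The Jacobi identity on Pauli strings. -/
theorem commPhase_jacobi (s t u : PauliString) :
    commPhase s (t + u) * commPhase t u =
      commPhase (s + t) u * commPhase s t + commPhase t (s + u) * commPhase s u := by
  have h1 := stringPhase_cocycle s t u
  have h2 := stringPhase_cocycle s u t
  have h3 := stringPhase_cocycle t s u
  have h4 := stringPhase_cocycle t u s
  have h5 := stringPhase_cocycle u s t
  have h6 := stringPhase_cocycle u t s
  rw [add_comm t s] at h3
  rw [add_comm u t] at h2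
  rw [add_comm u s] at h4 h5
  rw [add_comm t s] at h6
  simp only [commPhase]
  rw [add_comm u t] at *
  linear_combination -h1 + h2 + h3 - h4 - h5 + h6

/-! ### Translates of strings -/

@[simp] theorem translate_apply (j : ℤ) (s : PauliString) (i : ℤ) :
    translate j s i = s (i - j) := by
  simp [translate, Finsupp.equivMapDomain_apply, sub_eq_add_neg]

theorem translate_sub (j : ℤ) (s t : PauliString) :
    translate j (s - t) = translate j s - translate j t := by
  ext i : 1; simp

theorem translate_translate (i j : ℤ) (s : PauliString) :
    translate i (translate j s) = translate (i + j) s := by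
  ext k : 1; simp [sub_sub]

@[simp] theorem translate_by_zero (s : PauliString) : translate 0 s = s := by
  ext i : 1; simp

/-- Translation by `j` as a permutation of the Pauli strings. -/
def translateEquiv (j : ℤ) : PauliString ≃ PauliString where
  toFun := translate j
  invFun := translate (-j)
  left_inv s := by simp [translate_translate]
  right_inv s := by simp [translate_translate]

theorem support_translate (j : ℤ) (s : PauliString) :
    (translate j s).support = s.support.map (Equiv.addRight j).toEmbedding := by
  ext i
  simp only [Finsupp.mem_support_iff, translate_apply, Finset.mem_map, Equiv.coe_toEmbedding,
    Equiv.coe_addRight]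
  refine ⟨fun h => ⟨i - j, h, by simp⟩, ?_⟩
  rintro ⟨k, hk, rfl⟩
  simpa using hk

theorem stringPhase_translate (j : ℤ) (s t : PauliString) :
    stringPhase (translate j s) (translate j t) = stringPhase s t := by
  classical
  rw [stringPhase, stringPhase, support_translate, support_translate, ← Finset.map_union,
    Finset.prod_map]
  simp

theorem commPhase_translate (j : ℤ) (s t : PauliString) :
    commPhase (translate j s) (translate j t) = commPhase s t := by
  simp [commPhase, stringPhase_translate]

/-! ### The commutator of local operators -/

theorem ad_apply (A B : Op) (s : PauliString) :
    ad A B s = ∑ᶠ t : PauliString, A t * B (s - t) * commPhase t (s - t) := rfl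

theorem 𝒯_mono {M N : ℕ} (h : M ≤ N) : 𝒯 M ≤ 𝒯 N := by
  rintro A ⟨h1, h2, h3⟩
  refine ⟨h1, h2, fun s hs => ?_⟩
  obtain ⟨j, hj⟩ := h3 s hs
  exact ⟨j, fun i hi => ⟨(hj i hi).1, (hj i hi).2.trans_le (by gcongr)⟩⟩

/-- The Pauli strings supported in the finite set `F`. -/
def box (F : Finset ℤ) : Finset PauliString := F.finsupp fun _ => Finset.univ

@[simp] theorem mem_box {F : Finset ℤ} {s : PauliString} : s ∈ box F ↔ s.support ⊆ F := by
  simp [box, Finset.mem_finsupp_iff]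

/-- The sites within distance `R` of `F`. -/
def thicken (F : Finset ℤ) (R : ℕ) : Finset ℤ :=
  F.biUnion fun j => Finset.Icc (j - R) (j + R)

theorem mem_thicken {F : Finset ℤ} {R : ℕ} {i : ℤ} :
    i ∈ thicken F R ↔ ∃ j ∈ F, j - R ≤ i ∧ i ≤ j + R := by
  simp [thicken]

theorem subset_thicken (F : Finset ℤ) (R : ℕ) : F ⊆ thicken F R := fun j hj =>
  mem_thicken.2 ⟨j, hj, by simp, by simp⟩

theorem thicken_mono {F F' : Finset ℤ} {R R' : ℕ} (hF : F ⊆ F') (hR : R ≤ R') :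
    thicken F R ⊆ thicken F' R' := fun i hi => by
  obtain ⟨j, hj, h1, h2⟩ := mem_thicken.1 hi
  exact mem_thicken.2 ⟨j, hF hj, by omega, by omega⟩

/-- A string that contributes to the coefficient of `s` in a commutator of two local operators
lies close to `s`. -/
theorem support_subset_thicken {a b : ℕ} {A B : Op} (hA : A ∈ 𝒯 a) (hB : B ∈ 𝒯 b)
    {s t : PauliString} (h : A t * B (s - t) * commPhase t (s - t) ≠ 0) :
    t.support ⊆ thicken s.support (a + b) := by
  have hAt : A t ≠ 0 := fun h0 => h (by simp [h0])
  have hBt : B (s - t) ≠ 0 := fun h0 => h (by simp [h0])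
  have hc : commPhase t (s - t) ≠ 0 := fun h0 => h (by simp [h0])
  obtain ⟨j, hj⟩ := hA.2.2 t hAt
  obtain ⟨k, hk⟩ := hB.2.2 _ hBt
  obtain ⟨i, hi1, hi2⟩ := exists_mem_of_commPhase_ne_zero hc
  have hs : s ≠ 0 := by
    rintro rfl
    apply hc
    rw [zero_sub, PauliString.neg_eq, commPhase_self]
  obtain ⟨l, hl⟩ := Finsupp.support_nonempty_iff.2 hs
  have hl' : t l ≠ 0 ∨ (s - t) l ≠ 0 := by
    by_contra! H
    have h1 := H.2
    rw [Finsupp.sub_apply, H.1, sub_zero] at h1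
    exact (Finsupp.mem_support_iff.1 hl) h1
  have hjk1 := hj i hi1
  have hjk2 := hk i hi2
  intro m hm
  have h1 := hj m (Finsupp.mem_support_iff.1 hm)
  refine mem_thicken.2 ⟨l, hl, ?_⟩
  rcases hl' with h2 | h2
  · have := hj l h2
    push_cast
    omega
  · have := hk l h2
    push_cast
    omega

/-- For local operators the commutator is a finite sum. -/
theorem ad_eq_sum {a b : ℕ} {A B : Op} (hA : A ∈ 𝒯 a) (hB : B ∈ 𝒯 b) {s : PauliString}
    {W : Finset ℤ} (hW : thicken s.support (a + b) ⊆ W) :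
    ad A B s = ∑ t ∈ box W, A t * B (s - t) * commPhase t (s - t) := by
  rw [ad_apply]
  refine finsum_eq_sum_of_support_subset _ fun t ht => ?_
  simp only [Finset.mem_coe, mem_box]
  exact (support_subset_thicken hA hB ht).trans hW

theorem ad_translate {A B : Op} (hA : ∀ j s, A (translate j s) = A s)
    (hB : ∀ j s, B (translate j s) = B s) (j : ℤ) (s : PauliString) :
    ad A B (translate j s) = ad A B s := by
  rw [ad_apply, ad_apply, ← finsum_comp_equiv (translateEquiv j)]
  refine finsum_congr fun t => ?_
  change A (translate j t) * B (translate j s - translate j t) *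
    commPhase (translate j t) (translate j s - translate j t) = _
  rw [← translate_sub, hA, hB, commPhase_translate]

/-- Strings that do not commute overlap in at least one site, so a commutator has range at most
`a + b - 1`. -/
theorem ad_mem {a b c : ℕ} {A B : Op} (hA : A ∈ 𝒯 a) (hB : B ∈ 𝒯 b) (hc : a + b ≤ c + 1) :
    ad A B ∈ 𝒯 c := by
  refine ⟨ad_translate hA.1 hB.1, ?_, fun s hs => ?_⟩
  · rw [ad_apply]
    refine finsum_eq_zero_of_forall_eq_zero fun t => ?_
    rw [zero_sub, PauliString.neg_eq, commPhase_self, mul_zero]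
  · obtain ⟨t, ht⟩ : ∃ t, A t * B (s - t) * commPhase t (s - t) ≠ 0 := by
      by_contra! H
      exact hs (finsum_eq_zero_of_forall_eq_zero H)
    have hAt : A t ≠ 0 := fun h0 => ht (by simp [h0])
    have hBt : B (s - t) ≠ 0 := fun h0 => ht (by simp [h0])
    have hc : commPhase t (s - t) ≠ 0 := fun h0 => ht (by simp [h0])
    obtain ⟨j, hj⟩ := hA.2.2 t hAt
    obtain ⟨k, hk⟩ := hB.2.2 _ hBt
    obtain ⟨i, hi1, hi2⟩ := exists_mem_of_commPhase_ne_zero hc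
    have h1 := hj i hi1
    have h2 := hk i hi2
    refine ⟨min j k, fun l hl => ?_⟩
    have hl' : t l ≠ 0 ∨ (s - t) l ≠ 0 := by
      by_contra! H
      have h1 := H.2
      rw [Finsupp.sub_apply, H.1, sub_zero] at h1
      exact hl h1
    rcases hl' with h3 | h3
    · have := hj l h3
      omega
    · have := hk l h3
      omega

theorem ad_add_left {A A' B : Op} (hA : IsLocal A) (hA' : IsLocal A') (hB : IsLocal B) :
    ad (A + A') B = ad A B + ad A' B := by
  obtain ⟨a, ha⟩ := hA
  obtain ⟨a', ha'⟩ := hA'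
  obtain ⟨b, hb⟩ := hB
  have h1 := 𝒯_mono (le_max_left a a') ha
  have h2 := 𝒯_mono (le_max_right a a') ha'
  ext s
  rw [Pi.add_apply, ad_eq_sum h1 hb subset_rfl, ad_eq_sum h2 hb subset_rfl,
    ad_eq_sum (add_mem h1 h2) hb subset_rfl, ← Finset.sum_add_distrib]
  exact Finset.sum_congr rfl fun t _ => by rw [Pi.add_apply]; ring

theorem ad_add_right {A B B' : Op} (hA : IsLocal A) (hB : IsLocal B) (hB' : IsLocal B') :
    ad A (B + B') = ad A B + ad A B' := by
  obtain ⟨a, ha⟩ := hA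
  obtain ⟨b, hb⟩ := hB
  obtain ⟨b', hb'⟩ := hB'
  have h1 := 𝒯_mono (le_max_left b b') hb
  have h2 := 𝒯_mono (le_max_right b b') hb'
  ext s
  rw [Pi.add_apply, ad_eq_sum ha h1 subset_rfl, ad_eq_sum ha h2 subset_rfl,
    ad_eq_sum ha (add_mem h1 h2) subset_rfl, ← Finset.sum_add_distrib]
  exact Finset.sum_congr rfl fun t _ => by rw [Pi.add_apply]; ring

theorem ad_smul_left (c : ℂ) (A B : Op) : ad (c • A) B = c • ad A B := by
  ext s
  simp only [ad_apply, Pi.smul_apply, smul_eq_mul, mul_assoc]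
  exact smul_finsum c _ |>.symm

theorem ad_smul_right (c : ℂ) (A B : Op) : ad A (c • B) = c • ad A B := by
  ext s
  simp only [ad_apply, Pi.smul_apply, smul_eq_mul]
  rw [← smul_eq_mul, smul_finsum c]
  exact finsum_congr fun t => by rw [smul_eq_mul]; ring

/-- Antisymmetry; no locality is needed, as the sums over strings are merely reindexed. -/
theorem ad_swap (A B : Op) : ad A B = -ad B A := by
  ext s
  rw [Pi.neg_apply, ad_apply, ad_apply, ← finsum_comp_equiv (Equiv.subLeft s),
    ← finsum_neg_distrib]
  refine finsum_congr fun t => ?_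
  simp only [Equiv.subLeft_apply, sub_sub_cancel]
  rw [commPhase_swap]; ring

/-- The sum over all `t, u` of a double commutator, as a sum over a finite box. -/
theorem ad_ad_eq_sum {a b c : ℕ} {A B C : Op} (hA : A ∈ 𝒯 a) (hB : B ∈ 𝒯 b) (hC : C ∈ 𝒯 c)
    {s : PauliString} {W : Finset ℤ}
    (hW : thicken (thicken s.support (a + b + c)) (a + b + c) ⊆ W) :
    ad A (ad B C) s = ∑ t ∈ box W, ∑ u ∈ box W,
      A t * B u * C (s - t - u) * (commPhase t (s - t) * commPhase u (s - t - u)) := by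
  have hBC : ad B C ∈ 𝒯 (b + c) := ad_mem hB hC (by omega)
  have h1 : thicken s.support (a + (b + c)) ⊆ thicken s.support (a + b + c) :=
    thicken_mono subset_rfl (by omega)
  rw [ad_eq_sum hA hBC (h1.trans ((subset_thicken _ _).trans hW))]
  refine Finset.sum_congr rfl fun t ht => ?_
  by_cases h0 : A t * (ad B C) (s - t) * commPhase t (s - t) = 0
  · by_cases h00 : A t = 0
    · simp [h00]
    by_cases h01 : commPhase t (s - t) = 0
    · simp [h01]
    have h02 : ad B C (s - t) = 0 := by
      simpa [h00, h01] using h0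
    rw [h0]
    by_cases ht' : t.support ⊆ thicken s.support (a + b + c)
    · have hst : (s - t).support ⊆ thicken s.support (a + b + c) := by
        rw [PauliString.sub_eq_add]
        exact Finsupp.support_add.trans (Finset.union_subset (subset_thicken _ _) ht')
      rw [ad_eq_sum hB hC ((thicken_mono hst (by omega)).trans hW)] at h02
      rw [← mul_zero (A t * commPhase t (s - t)), ← h02, Finset.mul_sum]
      exact Finset.sum_congr rfl fun u _ => by ring
    -- a nonzero triple term would put `t` close to `s`: `t` overlaps `s - t`, which is covered by
    -- `u` and `s - t - u`, and these overlap each other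
    · refine (Finset.sum_eq_zero fun u _ => ?_).symm
      by_contra hne
      obtain ⟨j, hj⟩ := hA.2.2 t h00
      have hBu : B u ≠ 0 := fun h => hne (by simp [h])
      have hCu : C (s - t - u) ≠ 0 := fun h => hne (by simp [h])
      have hcu : commPhase u (s - t - u) ≠ 0 := fun h => hne (by simp [h])
      obtain ⟨k, hk⟩ := hB.2.2 u hBu
      obtain ⟨l, hl⟩ := hC.2.2 _ hCu
      obtain ⟨i, hi1, hi2⟩ := exists_mem_of_commPhase_ne_zero hcu
      obtain ⟨i', hi1', hi2'⟩ := exists_mem_of_commPhase_ne_zero h01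
      have hs : s ≠ 0 := by
        rintro rfl
        apply h01
        rw [zero_sub, PauliString.neg_eq, commPhase_self]
      obtain ⟨p, hp⟩ := Finsupp.support_nonempty_iff.2 hs
      have key : ∀ q, (s - t) q ≠ 0 → u q ≠ 0 ∨ (s - t - u) q ≠ 0 := fun q hq => by
        by_contra! H
        have h1 := H.2
        rw [Finsupp.sub_apply, H.1, sub_zero] at h1
        exact hq h1
      have hp' : t p ≠ 0 ∨ (s - t) p ≠ 0 := by
        by_contra! H
        have h1 := H.2
        rw [Finsupp.sub_apply, H.1, sub_zero] at h1
        exact (Finsupp.mem_support_iff.1 hp) h1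
      apply ht'
      intro m hm
      have e1 := hj m (Finsupp.mem_support_iff.1 hm)
      have e2 := hj i' hi1'
      have e3 := hk i hi1
      have e4 := hl i hi2
      have e5 : (k ≤ i' ∧ i' < k + b) ∨ (l ≤ i' ∧ i' < l + c) := (key i' hi2').imp (hk _) (hl _)
      have e6 : (j ≤ p ∧ p < j + a) ∨ (k ≤ p ∧ p < k + b) ∨ (l ≤ p ∧ p < l + c) :=
        hp'.imp (hj _) fun h => (key p h).imp (hk _) (hl _)
      refine mem_thicken.2 ⟨p, hp, ?_⟩
      push_cast
      omega
  · have ht' := (support_subset_thicken hA hBC h0).trans h1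
    have hst : (s - t).support ⊆ thicken s.support (a + b + c) := by
      rw [PauliString.sub_eq_add]
      exact Finsupp.support_add.trans (Finset.union_subset (subset_thicken _ _) ht')
    rw [ad_eq_sum hB hC ((thicken_mono hst (by omega)).trans hW), Finset.mul_sum, Finset.sum_mul]
    exact Finset.sum_congr rfl fun u _ => by ring

/-- The Jacobi identity. All three double commutators are written over one box, where it becomes
`commPhase_jacobi` term by term. -/
theorem ad_jacobi {A B C : Op} (hA : IsLocal A) (hB : IsLocal B) (hC : IsLocal C) :
    ad A (ad B C) = ad (ad A B) C + ad B (ad A C) := by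
  obtain ⟨a, ha⟩ := hA
  obtain ⟨b, hb⟩ := hB
  obtain ⟨c, hc⟩ := hC
  rw [ad_swap (ad A B) C]
  ext s
  set W := thicken (thicken s.support (a + b + c)) (a + b + c) with hW
  have hsW : s.support ⊆ W := (subset_thicken _ _).trans (subset_thicken _ _)
  rw [Pi.add_apply, Pi.neg_apply, ad_ad_eq_sum ha hb hc hW.ge,
    ad_ad_eq_sum hb ha hc (W := W) (by rw [hW, add_comm a b]),
    ad_ad_eq_sum hc ha hb (W := W) (by rw [hW, add_comm c a, add_right_comm]),
    Finset.sum_comm (s := box W) (t := box W) (f := fun t u => B t * A u * _ * _),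
    Finset.sum_comm (s := box W) (t := box W) (f := fun t u => C t * A u * _ * _),
    ← Finset.sum_neg_distrib, ← Finset.sum_add_distrib]
  refine Finset.sum_congr rfl fun t ht => ?_
  -- for fixed `s` and `t` the strings `u` and `s - t - u` exchange their roles
  have hre : ∑ w ∈ box W, C w * A t * B (s - w - t) *
      (commPhase w (s - w) * commPhase t (s - w - t)) =
      ∑ u ∈ box W, C (s - t - u) * A t * B u *
        (commPhase (s - t - u) (t + u) * commPhase t u) := by
    have hmem : ∀ w ∈ box W, s - t - w ∈ box W := fun w hw => by
      rw [mem_box] at *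
      rw [PauliString.sub_eq_add, PauliString.sub_eq_add]
      exact Finsupp.support_add.trans (Finset.union_subset
        (Finsupp.support_add.trans (Finset.union_subset hsW ht)) hw)
    refine Finset.sum_nbij' (fun w => s - t - w) (fun w => s - t - w) hmem hmem
      (fun _ _ => by simp) (fun _ _ => by simp) fun w _ => ?_
    have e1 : s - t - (s - t - w) = w := by abel
    have e2 : s - w - t = s - t - w := by abel
    have e3 : t + (s - t - w) = s - w := by abel
    rw [e1, e2, e3]
  rw [hre, ← Finset.sum_neg_distrib, ← Finset.sum_add_distrib]
  refine Finset.sum_congr rfl fun u _ => ?_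
  have e1 : s - u - t = s - t - u := by abel
  obtain ⟨w, hw⟩ : ∃ w, w = s - t - u := ⟨_, rfl⟩
  have e2 : s - t = u + w := by rw [hw]; abel
  have e3 : s - u = t + w := by rw [hw]; abel
  rw [e1, ← hw, e2, e3, commPhase_swap w (t + u)]
  linear_combination (A t * B u * C w) * commPhase_jacobi t u w

/-- The space of traceless translationally invariant operators of finite range. -/
def LocOp : Submodule ℂ Op where
  carrier := {A | IsLocal A}
  zero_mem' := ⟨0, zero_mem _⟩
  add_mem' := by
    rintro A B ⟨a, ha⟩ ⟨b, hb⟩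
    exact ⟨max a b, add_mem (𝒯_mono (le_max_left a b) ha) (𝒯_mono (le_max_right a b) hb)⟩
  smul_mem' := by
    rintro c A ⟨a, ha⟩
    exact ⟨a, Submodule.smul_mem _ _ ha⟩

theorem IsLocal.ad {A B : Op} (hA : IsLocal A) (hB : IsLocal B) : IsLocal (ad A B) := by
  obtain ⟨a, ha⟩ := hA
  obtain ⟨b, hb⟩ := hB
  exact ⟨a + b, ad_mem ha hb (by omega)⟩

theorem ad_self (A : Op) : ad A A = 0 := by
  have h := ad_swap A A
  ext s
  have := congrFun h s
  rw [Pi.neg_apply] at this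
  rw [Pi.zero_apply]
  linear_combination this / 2

instance : Bracket LocOp LocOp := ⟨fun A B => ⟨ad A B, A.2.ad B.2⟩⟩

@[simp] theorem LocOp.coe_bracket (A B : LocOp) : ((⁅A, B⁆ : LocOp) : Op) = ad A B := rfl

instance : LieRing LocOp where
  add_lie A B C := Subtype.ext (ad_add_left A.2 B.2 C.2)
  lie_add A B C := Subtype.ext (ad_add_right A.2 B.2 C.2)
  lie_self A := Subtype.ext (ad_self A)
  leibniz_lie A B C := Subtype.ext (ad_jacobi A.2 B.2 C.2)

instance : LieAlgebra ℂ LocOp where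
  lie_smul c A B := Subtype.ext (ad_smul_right c A B)

/-! ### The Frobenius inner product on local operators -/

/-- The anchored strings of range `M`. -/
def anchoredBox (M : ℕ) : Finset PauliString := (box (Finset.Ico 0 (M : ℤ))).filter fun s => s 0 ≠ 0

theorem mem_anchoredBox {M : ℕ} {s : PauliString} :
    s ∈ anchoredBox M ↔ s.support ⊆ Finset.Ico 0 (M : ℤ) ∧ s 0 ≠ 0 := by
  simp [anchoredBox]

theorem anchored_of_mem_anchoredBox {M : ℕ} {s : PauliString} (h : s ∈ anchoredBox M) :
    s ∈ anchored := by
  rw [mem_anchoredBox] at h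
  refine ⟨h.2, fun i hi => ?_⟩
  by_contra h0
  have := h.1 (Finsupp.mem_support_iff.2 h0)
  rw [Finset.mem_Ico] at this
  omega

/-- An anchored string in an operator of range `M` is supported in `{0, …, M - 1}`. -/
theorem mem_anchoredBox_of_ne_zero {M : ℕ} {A : Op} (hA : A ∈ 𝒯 M) {s : PauliString}
    (hs : s ∈ anchored) (h : A s ≠ 0) : s ∈ anchoredBox M := by
  obtain ⟨j, hj⟩ := hA.2.2 s h
  refine mem_anchoredBox.2 ⟨fun i hi => ?_, hs.1⟩
  have h1 := hj i (Finsupp.mem_support_iff.1 hi)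
  have h2 := hj 0 hs.1
  have h3 : 0 ≤ i := by
    by_contra h0
    exact Finsupp.mem_support_iff.1 hi (hs.2 i (not_le.1 h0))
  rw [Finset.mem_Ico]
  omega

theorem frobInner_eq_sum {M : ℕ} {A : Op} (hA : A ∈ 𝒯 M) (B : Op) :
    frobInner A B = ∑ s ∈ anchoredBox M, star (A s) * B s := by
  refine finsum_mem_eq_sum_of_subset _ ?_ fun s hs => anchored_of_mem_anchoredBox hs
  rintro s ⟨hs, h⟩
  refine mem_anchoredBox_of_ne_zero hA hs fun h0 => h ?_
  simp [h0]

/-- Every string other than the identity has an anchored translate. -/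
theorem exists_translate_anchored {s : PauliString} (hs : s ≠ 0) :
    ∃ j, translate j s ∈ anchored := by
  have hne := Finsupp.support_nonempty_iff.2 hs
  refine ⟨-(s.support.min' hne), ?_, fun i hi => ?_⟩
  · rw [translate_apply, zero_sub, neg_neg]
    exact Finsupp.mem_support_iff.1 (Finset.min'_mem _ _)
  · rw [translate_apply]
    by_contra h
    have := Finset.min'_le _ _ (Finsupp.mem_support_iff.2 h)
    omega

theorem frobInner_conj {A B : Op} (hA : IsLocal A) (hB : IsLocal B) :
    star (frobInner B A) = frobInner A B := by
  obtain ⟨a, ha⟩ := hA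
  obtain ⟨b, hb⟩ := hB
  rw [frobInner_eq_sum (𝒯_mono (le_max_left a b) ha),
    frobInner_eq_sum (𝒯_mono (le_max_right a b) hb)]
  simp [mul_comm]

/-- The local operators with the intensive Frobenius inner product. Definiteness uses translation
invariance and tracelessness: the anchored coefficients determine all others. -/
instance : InnerProductSpace.Core ℂ LocOp where
  inner A B := frobInner A B
  conj_inner_symm A B := frobInner_conj A.2 B.2
  re_inner_nonneg A := by
    obtain ⟨a, ha⟩ := A.2
    rw [frobInner_eq_sum ha, map_sum]
    refine Finset.sum_nonneg fun s _ => ?_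
    rw [Complex.star_def, ← Complex.normSq_eq_conj_mul_self]
    simpa using Complex.normSq_nonneg _
  add_left A B C := by
    obtain ⟨a, ha⟩ := A.2
    obtain ⟨b, hb⟩ := B.2
    have h1 := 𝒯_mono (le_max_left a b) ha
    have h2 := 𝒯_mono (le_max_right a b) hb
    change frobInner ((A : Op) + B) C = _
    rw [frobInner_eq_sum h1, frobInner_eq_sum h2, frobInner_eq_sum (add_mem h1 h2),
      ← Finset.sum_add_distrib]
    exact Finset.sum_congr rfl fun s _ => by simp [add_mul]
  smul_left A B c := by
    obtain ⟨a, ha⟩ := A.2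
    change frobInner (c • (A : Op)) B = _
    rw [frobInner_eq_sum ha, frobInner_eq_sum (Submodule.smul_mem _ c ha), Finset.mul_sum]
    exact Finset.sum_congr rfl fun s _ => by simp [mul_assoc]
  definite A h := by
    obtain ⟨a, ha⟩ := A.2
    change frobInner A A = 0 at h
    rw [frobInner_eq_sum ha] at h
    have h' : ∑ s ∈ anchoredBox a, ‖(A : Op) s‖ ^ 2 = 0 := by
      have : ((∑ s ∈ anchoredBox a, ‖(A : Op) s‖ ^ 2 : ℝ) : ℂ) = 0 := by
        rw [← h]
        push_cast
        refine Finset.sum_congr rfl fun s _ => ?_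
        rw [Complex.star_def, Complex.conj_mul']
      exact_mod_cast this
    refine Subtype.ext (funext fun s => ?_)
    change (A : Op) s = 0
    by_contra hs
    have hs0 : s ≠ 0 := by
      rintro rfl
      exact hs ha.2.1
    obtain ⟨j, hj⟩ := exists_translate_anchored hs0
    have hne : (A : Op) (translate j s) ≠ 0 := by rwa [ha.1]
    have := (Finset.sum_eq_zero_iff_of_nonneg fun s _ => by positivity).1 h' _
      (mem_anchoredBox_of_ne_zero ha hj hne)
    exact hne (by simpa using this)

instance : NormedAddCommGroup LocOp := InnerProductSpace.Core.toNormedAddCommGroup (𝕜 := ℂ)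

instance : InnerProductSpace ℂ LocOp := InnerProductSpace.ofCore inferInstance

theorem LocOp.norm_def (A : LocOp) : ‖A‖ = frobNorm A := norm_eq_sqrt_re_inner (𝕜 := ℂ) A

theorem frobNorm_sq_eq_sum {M : ℕ} {A : Op} (hA : A ∈ 𝒯 M) :
    frobNorm A ^ 2 = ∑ s ∈ anchoredBox M, ‖A s‖ ^ 2 := by
  have h : frobInner A A = ((∑ s ∈ anchoredBox M, ‖A s‖ ^ 2 : ℝ) : ℂ) := by
    rw [frobInner_eq_sum hA]
    push_cast
    refine Finset.sum_congr rfl fun s _ => ?_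
    rw [Complex.star_def, Complex.conj_mul']
  rw [frobNorm, h, Complex.ofReal_re, Real.sq_sqrt]
  positivity

/-- The local operators of maximum range `M`, as a subspace of all local operators. -/
def LocOp.range (M : ℕ) : Submodule ℂ LocOp := (𝒯 M).comap LocOp.subtype

@[simp] theorem LocOp.mem_range {M : ℕ} {A : LocOp} : A ∈ LocOp.range M ↔ (A : Op) ∈ 𝒯 M := Iff.rfl

instance (M : ℕ) : FiniteDimensional ℂ (LocOp.range M) := by
  let f : LocOp.range M →ₗ[ℂ] (anchoredBox M → ℂ) :=
    { toFun := fun A s => (A : LocOp).1 s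
      map_add' := fun _ _ => rfl
      map_smul' := fun _ _ => rfl }
  refine FiniteDimensional.of_injective f (LinearMap.ker_eq_bot.1 ?_)
  rw [LinearMap.ker_eq_bot']
  intro A hA
  have h0 : ‖(A : LocOp)‖ ^ 2 = 0 := by
    rw [LocOp.norm_def, frobNorm_sq_eq_sum (LocOp.mem_range.1 A.2)]
    refine Finset.sum_eq_zero fun s hs => ?_
    have := congrFun hA ⟨s, hs⟩
    change (A : LocOp).1 s = 0 at this
    simp [this]
  exact Subtype.ext (norm_eq_zero.1 (pow_eq_zero_iff two_ne_zero |>.1 h0))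

/-! ### Symmetric operators with integer spectrum -/

section Abstract

variable {V : Type*}

/-- On a finite-dimensional invariant subspace a symmetric operator is invertible off its kernel;
the off-kernel part is written as an element of the range of the square of the operator, which makes
its preimage orthogonal to the whole kernel, inside and outside the subspace. -/
theorem exists_kernel_decomposition [NormedAddCommGroup V] [InnerProductSpace ℂ V]
    {L : V →ₗ[ℂ] V} (hL : L.IsSymmetric) (U : Submodule ℂ V) [FiniteDimensional ℂ U]
    (hU : ∀ x ∈ U, L x ∈ U) {a : V} (ha : a ∈ U) :
    ∃ d ∈ U, ∃ y ∈ U, L d = 0 ∧ a = d + L (L y) := by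
  set R : U →ₗ[ℂ] U := L.restrict hU with hR
  have hRs : R.IsSymmetric := fun x y => hL x y
  have key : ∀ z : U, ∃ k : U, ∃ y : U, R k = 0 ∧ z = k + R y := by
    intro z
    have hz : z ∈ (LinearMap.ker R) ⊔ (LinearMap.ker R)ᗮ := by
      rw [Submodule.sup_orthogonal_of_hasOrthogonalProjection]; trivial
    obtain ⟨k, hk, x, hx, rfl⟩ := Submodule.mem_sup.1 hz
    rw [← hRs.orthogonal_range, Submodule.orthogonal_orthogonal] at hx
    obtain ⟨y, rfl⟩ := hx
    exact ⟨k, y, hk, rfl⟩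
  obtain ⟨k, y, hk, hy⟩ := key ⟨a, ha⟩
  obtain ⟨k', y', hk', rfl⟩ := key y
  -- the kernel component of `y` does not contribute to `R y`
  refine ⟨k, k.2, y', y'.2, congrArg Subtype.val hk, ?_⟩
  rw [map_add, hk', zero_add] at hy
  exact congrArg Subtype.val hy

/-- A lower bound on the nonzero eigenvalues, on a finite-dimensional invariant subspace, is a lower
bound for the operator off its kernel: expand in an eigenbasis. -/
theorem gap_of_eigenvalues [NormedAddCommGroup V] [InnerProductSpace ℂ V]
    {L : V →ₗ[ℂ] V} (hL : L.IsSymmetric) (U : Submodule ℂ V) [FiniteDimensional ℂ U]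
    (hU : ∀ x ∈ U, L x ∈ U) {g : ℝ} (hg : 0 ≤ g)
    (heig : ∀ (c : ℂ) (v : V), v ∈ U → v ≠ 0 → L v = c • v → c = 0 ∨ g ≤ ‖c‖)
    {x : V} (hx : x ∈ U) (hker : ∀ k, L k = 0 → inner ℂ k x = 0) :
    g * ‖x‖ ≤ ‖L x‖ := by
  set R : U →ₗ[ℂ] U := L.restrict hU with hR
  have hRs : R.IsSymmetric := fun x y => hL x y
  set b := hRs.eigenvectorBasis rfl with hb
  set e := hRs.eigenvalues rfl with he
  set z : U := ⟨x, hx⟩ with hz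
  have hRb : ∀ i, R (b i) = (e i : ℂ) • b i := fun i => hRs.apply_eigenvectorBasis rfl i
  have hLb : ∀ i, L (b i : V) = (e i : ℂ) • (b i : V) := fun i => congrArg Subtype.val (hRb i)
  have hbne : ∀ i, (b i : V) ≠ 0 := fun i h => by
    have h1 : ‖b i‖ = 1 := b.orthonormal.1 i
    have h2 : b i = 0 := Subtype.ext h
    rw [h2, norm_zero] at h1
    exact zero_ne_one h1
  have hterm : ∀ i, g ^ 2 * ‖b.repr z i‖ ^ 2 ≤ ‖b.repr (R z) i‖ ^ 2 := by
    intro i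
    have h1 : b.repr (R z) i = e i * b.repr z i := hRs.eigenvectorBasis_apply_self_apply rfl z i
    rw [h1, norm_mul, mul_pow]
    rcases heig (e i) (b i) (b i).2 (hbne i) (hLb i) with h0 | h0
    · have h2 : b.repr z i = 0 := by
        rw [b.repr_apply_apply]
        exact hker _ ((hLb i).trans (by rw [h0, zero_smul]))
      simp [h2]
    · gcongr
  have hsq : (g * ‖z‖) ^ 2 ≤ ‖R z‖ ^ 2 := by
    rw [mul_pow, ← b.repr.norm_map z, ← b.repr.norm_map (R z), EuclideanSpace.norm_sq_eq,
      EuclideanSpace.norm_sq_eq, Finset.mul_sum]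
    exact Finset.sum_le_sum fun i _ => hterm i
  have := abs_le_of_sq_le_sq' hsq (norm_nonneg _) |>.2
  exact this

/-- If commuting operators satisfy `L_j ^ 3 = g ^ 2 L_j`, so that each has spectrum in
`{-g, 0, g}`, then the eigenvalues of their sum are integer multiples of `g`. -/
theorem eigenvalue_sum_mem_zmultiples [AddCommGroup V] [Module ℂ V] {ι : Type*} [DecidableEq ι]
    (L : ι → V →ₗ[ℂ] V) {g : ℂ} (hg : g ≠ 0) (hcomm : ∀ i j, i ≠ j → ∀ v, L i (L j v) = L j (L i v))
    (hcube : ∀ i v, L i (L i (L i v)) = g ^ 2 • L i v) (F : Finset ι) :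
    ∀ (c : ℂ) (v : V), v ≠ 0 → ∑ j ∈ F, L j v = c • v → ∃ k : ℤ, c = k * g := by
  induction F using Finset.induction_on with
  | empty =>
    intro c v hv h
    rw [Finset.sum_empty] at h
    refine ⟨0, ?_⟩
    have := (smul_eq_zero.1 h.symm).resolve_right hv
    simp [this]
  | insert i F hi ih =>
    intro c v hv h
    rw [Finset.sum_insert hi] at h
    have hF : ∀ w, ∑ j ∈ F, L j (L i w) = L i (∑ j ∈ F, L j w) := fun w => by
      rw [map_sum]
      exact Finset.sum_congr rfl fun j hj => hcomm _ _ (ne_of_mem_of_not_mem hj hi) _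
    have h0 : ∑ j ∈ F, L j v = c • v - L i v := by rw [← h]; abel
    have h1 : ∑ j ∈ F, L j (L i v) = c • L i v - L i (L i v) := by rw [hF, h0]; simp
    have h2 : ∑ j ∈ F, L j (L i (L i v)) = c • L i (L i v) - g ^ 2 • L i v := by
      rw [hF, h1, map_sub, map_smul, hcube]
    have hg2 : g ^ 2 ≠ 0 := pow_ne_zero 2 hg
    -- by `hcube`, `L i ^ 2 ± g L i` maps into the eigenspace of `L i` with eigenvalue `± g`; one of
    -- these components of `v` is nonzero, or `v` lies in the kernel of `L i`
    by_cases hp : L i (L i v) + g • L i v = 0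
    · by_cases hm : L i (L i v) - g • L i v = 0
      · have hLi : L i v = 0 := by
          have : (2 * g) • L i v = 0 := by
            rw [mul_smul, two_smul]
            have e : g • L i v + g • L i v =
              (L i (L i v) + g • L i v) - (L i (L i v) - g • L i v) := by abel
            rw [e, hp, hm, sub_zero]
          exact (smul_eq_zero.1 this).resolve_left (mul_ne_zero two_ne_zero hg)
        exact ih c v hv (by rw [h0, hLi, sub_zero])
      · obtain ⟨k, hk⟩ := ih (c + g) _ hm (by
          simp only [map_sub, map_smul, Finset.sum_sub_distrib, ← Finset.smul_sum, h1, h2]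
          module)
        exact ⟨k - 1, by push_cast; linear_combination hk⟩
    · obtain ⟨k, hk⟩ := ih (c - g) _ hp (by
        simp only [map_add, map_smul, Finset.sum_add_distrib, ← Finset.smul_sum, h1, h2]
        module)
      exact ⟨k + 1, by push_cast; linear_combination hk⟩

end Abstract

/-! ### Operators acting at one site -/

/-- The matrix `K` acting on the label at site `j`. -/
def siteOp (K : Matrix PauliLabel PauliLabel ℂ) (j : ℤ) : Op →ₗ[ℂ] Op where
  toFun A s := ∑ y, K (s j) y * A (s.update j y)
  map_add' A B := by
    ext s
    simp [mul_add, Finset.sum_add_distrib]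
  map_smul' c A := by
    ext s
    simp [Finset.mul_sum, mul_left_comm]

theorem siteOp_apply (K : Matrix PauliLabel PauliLabel ℂ) (j : ℤ) (A : Op) (s : PauliString) :
    siteOp K j A s = ∑ y, K (s j) y * A (s.update j y) := rfl

theorem update_apply_self (s : PauliString) (j : ℤ) (y : PauliLabel) : s.update j y j = y := by
  simp [Finsupp.update]

theorem update_apply_of_ne (s : PauliString) {i j : ℤ} (h : i ≠ j) (y : PauliLabel) :
    s.update j y i = s i := by
  simp [Finsupp.update, h]

theorem update_update (s : PauliString) (j : ℤ) (y z : PauliLabel) :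
    (s.update j y).update j z = s.update j z := by
  ext i : 1
  by_cases h : i = j
  · subst h; simp [update_apply_self]
  · simp [update_apply_of_ne, h]

theorem update_comm (s : PauliString) {i j : ℤ} (h : i ≠ j) (y z : PauliLabel) :
    (s.update i y).update j z = (s.update j z).update i y := by
  ext k : 1
  by_cases h1 : k = i
  · subst h1; rw [update_apply_self, update_apply_of_ne _ h, update_apply_self]
  · by_cases h2 : k = j
    · subst h2; rw [update_apply_self, update_apply_of_ne _ h1, update_apply_self]
    · rw [update_apply_of_ne _ h2, update_apply_of_ne _ h1, update_apply_of_ne _ h1,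
        update_apply_of_ne _ h2]

theorem support_update_eq {s : PauliString} {j : ℤ} {y : PauliLabel} (hs : s j ≠ 0) (hy : y ≠ 0) :
    (s.update j y).support = s.support := by
  ext i
  simp only [Finsupp.mem_support_iff]
  by_cases h : i = j
  · subst h; simp [update_apply_self, hs, hy]
  · simp [update_apply_of_ne, h]

theorem siteOp_siteOp (K K' : Matrix PauliLabel PauliLabel ℂ) (j : ℤ) (A : Op) :
    siteOp K j (siteOp K' j A) = siteOp (K * K') j A := by
  ext s
  simp only [siteOp_apply, update_apply_self, update_update, Matrix.mul_apply, Finset.mul_sum,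
    Finset.sum_mul]
  rw [Finset.sum_comm]
  exact Finset.sum_congr rfl fun y _ => Finset.sum_congr rfl fun z _ => by ring

theorem siteOp_comm (K K' : Matrix PauliLabel PauliLabel ℂ) {i j : ℤ} (h : i ≠ j) (A : Op) :
    siteOp K i (siteOp K' j A) = siteOp K' j (siteOp K i A) := by
  ext s
  simp only [siteOp_apply, Finset.mul_sum]
  rw [Finset.sum_comm]
  refine Finset.sum_congr rfl fun y _ => Finset.sum_congr rfl fun z _ => ?_
  rw [update_apply_of_ne _ h.symm, update_apply_of_ne _ h, update_comm _ h]
  ring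

/-- The part of an operator on the strings whose support satisfies `p`. -/
def restr (p : Finset ℤ → Prop) [DecidablePred p] : Op →ₗ[ℂ] Op where
  toFun A s := if p s.support then A s else 0
  map_add' A B := by ext s; by_cases h : p s.support <;> simp [h]
  map_smul' c A := by ext s; by_cases h : p s.support <;> simp [h]

theorem restr_apply (p : Finset ℤ → Prop) [DecidablePred p] (A : Op) (s : PauliString) :
    restr p A s = if p s.support then A s else 0 := rfl

/-- If `K` neither creates nor annihilates the identity label, the operator preserves supports. -/
theorem siteOp_restr {K : Matrix PauliLabel PauliLabel ℂ} (hl : ∀ y, K 0 y = 0)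
    (hr : ∀ x, K x 0 = 0) (j : ℤ) (p : Finset ℤ → Prop) [DecidablePred p] (A : Op) :
    siteOp K j (restr p A) = restr p (siteOp K j A) := by
  ext s
  have h : restr p (siteOp K j A) s =
      ∑ y, if p s.support then K (s j) y * A (s.update j y) else 0 := by
    rw [restr_apply, siteOp_apply]
    by_cases hp : p s.support <;> simp [hp]
  rw [h, siteOp_apply]
  refine Finset.sum_congr rfl fun y _ => ?_
  by_cases hs : s j = 0
  · simp [hs, hl]
  by_cases hy : y = 0
  · simp [hy, hr]
  rw [restr_apply, support_update_eq hs hy, mul_ite, mul_zero]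

/-- If `K` is Hermitian and does not see the identity label, the operator is symmetric on the span
of any set of strings closed under changing the label at `j`: exchange old and new labels. -/
theorem sum_star_mul_siteOp {K : Matrix PauliLabel PauliLabel ℂ} (hl : ∀ y, K 0 y = 0)
    (hr : ∀ x, K x 0 = 0) (hK : ∀ x y, star (K x y) = K y x) {Q : Finset PauliString} {j : ℤ}
    (hQ : ∀ s ∈ Q, s j ≠ 0 → ∀ y, y ≠ 0 → s.update j y ∈ Q) (A B : Op) :
    ∑ s ∈ Q, star (A s) * siteOp K j B s = ∑ s ∈ Q, star (siteOp K j A s) * B s := by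
  classical
  simp only [siteOp_apply, star_sum, star_mul', hK, Finset.mul_sum, Finset.sum_mul]
  rw [← Finset.sum_product', ← Finset.sum_product',
    ← Finset.sum_filter_of_ne (p := fun q => q.1 j ≠ 0 ∧ q.2 ≠ 0),
    ← Finset.sum_filter_of_ne (s := Q ×ˢ Finset.univ) (p := fun q => q.1 j ≠ 0 ∧ q.2 ≠ 0)]
  · refine Finset.sum_nbij' (fun q => (q.1.update j q.2, q.1 j))
      (fun q => (q.1.update j q.2, q.1 j))
      ?_ ?_ ?_ ?_ ?_
    · rintro ⟨s, y⟩ h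
      simp only [Finset.mem_filter, Finset.mem_product, Finset.mem_univ, and_true,
        update_apply_self] at h ⊢
      exact ⟨hQ s h.1 h.2.1 y h.2.2, h.2.2, h.2.1⟩
    · rintro ⟨s, y⟩ h
      simp only [Finset.mem_filter, Finset.mem_product, Finset.mem_univ, and_true,
        update_apply_self] at h ⊢
      exact ⟨hQ s h.1 h.2.1 y h.2.2, h.2.2, h.2.1⟩
    · rintro ⟨s, y⟩ _
      simp only [update_apply_self, update_update, Prod.mk.injEq, and_true]
      ext i : 1
      by_cases hi : i = j
      · subst hi; rw [update_apply_self]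
      · rw [update_apply_of_ne _ hi]
    · rintro ⟨s, y⟩ _
      simp only [update_apply_self, update_update, Prod.mk.injEq, and_true]
      ext i : 1
      by_cases hi : i = j
      · subst hi; rw [update_apply_self]
      · rw [update_apply_of_ne _ hi]
    · rintro ⟨s, y⟩ _
      have e : (s.update j y).update j (s j) = s := by
        rw [update_update]
        ext i : 1
        by_cases hi : i = j
        · subst hi; rw [update_apply_self]
        · rw [update_apply_of_ne _ hi]
      simp only [update_apply_self, e]
      ring
  · rintro ⟨s, y⟩ _ h
    refine ⟨fun h0 => h ?_, fun h0 => h ?_⟩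
    · simp only at h0; simp [h0, hr]
    · simp only at h0; simp [h0, hl]
  · rintro ⟨s, y⟩ _ h
    refine ⟨fun h0 => h ?_, fun h0 => h ?_⟩
    · simp only at h0; simp [h0, hl]
    · simp only at h0; simp [h0, hr]

/-! ### The commutator with a one-site Hamiltonian -/

/-- The matrix, on the labels of one site, of the commutator with `∑ b, h b • b`. -/
def fieldMatrix (h : PauliLabel → ℂ) : Matrix PauliLabel PauliLabel ℂ := fun x y =>
  h (x - y) * (pauliPhase (x - y) y - pauliPhase y (x - y))

theorem fieldMatrix_zero_left (h : PauliLabel → ℂ) (y : PauliLabel) : fieldMatrix h 0 y = 0 := by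
  simp [fieldMatrix, PauliLabel.neg_eq]

theorem fieldMatrix_zero_right (h : PauliLabel → ℂ) (x : PauliLabel) : fieldMatrix h x 0 = 0 := by
  simp [fieldMatrix]

theorem fieldMatrix_self (h : PauliLabel → ℂ) (x : PauliLabel) : fieldMatrix h x x = 0 := by
  simp [fieldMatrix]

theorem sum_pauliLabel {M : Type*} [AddCommMonoid M] (f : PauliLabel → M) :
    ∑ y, f y = f 0 + f (1, 0) + f (1, 1) + f (0, 1) := by
  have : (Finset.univ : Finset PauliLabel) = {0, (1, 0), (1, 1), (0, 1)} := by decide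
  rw [this, Finset.sum_insert (by decide), Finset.sum_insert (by decide),
    Finset.sum_insert (by decide), Finset.sum_singleton]
  simp only [add_assoc]

/-- The commutation relations of the Pauli matrices. -/
theorem fieldMatrix_table (h : PauliLabel → ℂ) :
    fieldMatrix h (1, 0) (1, 1) = -2 * Complex.I * h (0, 1) ∧
    fieldMatrix h (1, 1) (1, 0) = 2 * Complex.I * h (0, 1) ∧
    fieldMatrix h (1, 1) (0, 1) = -2 * Complex.I * h (1, 0) ∧
    fieldMatrix h (0, 1) (1, 1) = 2 * Complex.I * h (1, 0) ∧
    fieldMatrix h (0, 1) (1, 0) = -2 * Complex.I * h (1, 1) ∧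
    fieldMatrix h (1, 0) (0, 1) = 2 * Complex.I * h (1, 1) := by
  have h2 : (1 : ZMod 2) + 1 = 0 := by decide
  have h3 : (-1 : ZMod 2) = 1 := by decide
  refine ⟨?_, ?_, ?_, ?_, ?_, ?_⟩ <;>
    simp [fieldMatrix, pauliPhase, pauliMatrix, h2, h3, Matrix.trace, Fin.sum_univ_two] <;> ring

theorem star_fieldMatrix {h : PauliLabel → ℂ} (hh : ∀ a, star (h a) = h a) (x y : PauliLabel) :
    star (fieldMatrix h x y) = fieldMatrix h y x := by
  obtain ⟨h1, h2, h3, h4, h5, h6⟩ := fieldMatrix_table h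
  have hX := hh (1, 0)
  have hY := hh (1, 1)
  have hZ := hh (0, 1)
  have h0 : (starRingEnd ℂ) 2 = 2 := Complex.conj_ofNat 2
  simp only [Complex.star_def] at *
  have z : ((0, 0) : PauliLabel) = 0 := rfl
  rcases pauliLabel_cases x with rfl | rfl | rfl | rfl <;>
    rcases pauliLabel_cases y with rfl | rfl | rfl | rfl <;>
    simp [h1, h2, h3, h4, h5, h6, z, hX, hY, hZ, h0, fieldMatrix_zero_left,
      fieldMatrix_zero_right, fieldMatrix_self]

/-- The commutator with a spin in a field acts as a rotation generator: its spectrum at one site is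
`{-g, 0, g}`. -/
theorem fieldMatrix_cube (h : PauliLabel → ℂ) :
    fieldMatrix h * (fieldMatrix h * fieldMatrix h) =
      (4 * (h (1, 0) ^ 2 + h (1, 1) ^ 2 + h (0, 1) ^ 2)) • fieldMatrix h := by
  obtain ⟨h1, h2, h3, h4, h5, h6⟩ := fieldMatrix_table h
  have z : ((0, 0) : PauliLabel) = 0 := rfl
  have hI : Complex.I ^ 3 = -Complex.I := by rw [pow_succ, Complex.I_sq]; ring
  ext x y
  simp only [Matrix.mul_apply, sum_pauliLabel, Matrix.smul_apply, smul_eq_mul]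
  rcases pauliLabel_cases x with rfl | rfl | rfl | rfl <;>
    rcases pauliLabel_cases y with rfl | rfl | rfl | rfl <;>
    simp only [h1, h2, h3, h4, h5, h6, z, fieldMatrix_zero_left, fieldMatrix_zero_right,
      fieldMatrix_self] <;> ring_nf <;> simp only [hI] <;> ring

theorem stringPhase_single_left (j : ℤ) (b : PauliLabel) (u : PauliString) :
    stringPhase (Finsupp.single j b) u = pauliPhase b (u j) := by
  classical
  rw [stringPhase_eq_prod (F := insert j u.support)
    (Finsupp.support_single_subset.trans (by simp)) (by simp),
    Finset.prod_eq_single j]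
  · simp
  · intro i _ hi
    rw [Finsupp.single_eq_of_ne hi, pauliPhase_zero_left]
  · simp

theorem stringPhase_single_right (j : ℤ) (b : PauliLabel) (u : PauliString) :
    stringPhase u (Finsupp.single j b) = pauliPhase (u j) b := by
  classical
  rw [stringPhase_eq_prod (F := insert j u.support) (by simp)
    (Finsupp.support_single_subset.trans (by simp)),
    Finset.prod_eq_single j]
  · simp
  · intro i _ hi
    rw [Finsupp.single_eq_of_ne hi, pauliPhase_zero_right]
  · simp

theorem commPhase_single (j : ℤ) (b : PauliLabel) (u : PauliString) :
    commPhase (Finsupp.single j b) u = pauliPhase b (u j) - pauliPhase (u j) b := by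
  rw [commPhase, stringPhase_single_left, stringPhase_single_right]

theorem sub_single_eq_update (s : PauliString) (j : ℤ) (b : PauliLabel) :
    s - Finsupp.single j b = s.update j (s j - b) := by
  ext i : 1
  by_cases h : i = j
  · subst h; simp [update_apply_self]
  · simp [update_apply_of_ne, h]

/-- The field of a one-site Hamiltonian. -/
def field (H₀ : Op) (b : PauliLabel) : ℂ := H₀ (Finsupp.single 0 b)

theorem apply_single_eq_field {M : ℕ} {H₀ : Op} (hH : H₀ ∈ 𝒯 M) (j : ℤ) (b : PauliLabel) :
    H₀ (Finsupp.single j b) = field H₀ b := by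
  have : Finsupp.single j b = translate j (Finsupp.single 0 b) := by
    ext i : 1
    rw [translate_apply, Finsupp.single_apply, Finsupp.single_apply]
    congr 1
    exact propext ⟨fun h => by omega, fun h => by omega⟩
  rw [this, hH.1, field]

theorem eq_single_of_mem_𝒯_one {H₀ : Op} (hH : H₀ ∈ 𝒯 1) {t : PauliString} (ht : H₀ t ≠ 0) {j : ℤ}
    (hj : t j ≠ 0) : t = Finsupp.single j (t j) := by
  obtain ⟨k, hk⟩ := hH.2.2 t ht
  ext i : 1
  by_cases h : i = j
  · subst h; simp
  · rw [Finsupp.single_eq_of_ne h]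
    by_contra h0
    have h1 := hk i h0
    have h2 := hk j hj
    push_cast at h1 h2
    omega

/-- The commutator with a one-site Hamiltonian is a sum of operators acting at single sites. -/
theorem ad_eq_sum_siteOp {H₀ : Op} (hH : H₀ ∈ 𝒯 1) (A : Op) {s : PauliString} {F : Finset ℤ}
    (hF : s.support ⊆ F) :
    ad H₀ A s = ∑ j ∈ F, siteOp (fieldMatrix (field H₀)) j A s := by
  classical
  set S : Finset PauliString :=
    (F ×ˢ (Finset.univ.filter fun b : PauliLabel => b ≠ 0)).image fun q => Finsupp.single q.1 q.2
    with hS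
  have h1 : ad H₀ A s = ∑ t ∈ S, H₀ t * A (s - t) * commPhase t (s - t) := by
    rw [ad_apply]
    refine finsum_eq_sum_of_support_subset _ fun t ht => ?_
    have hHt : H₀ t ≠ 0 := fun h0 => ht (by simp [h0])
    have hc : commPhase t (s - t) ≠ 0 := fun h0 => ht (by simp [h0])
    obtain ⟨j, hj, hj'⟩ := exists_mem_of_commPhase_ne_zero hc
    have hts := eq_single_of_mem_𝒯_one hH hHt hj
    have hsj : s j ≠ 0 := by
      intro h0
      apply hc
      rw [hts, commPhase_single, Finsupp.sub_apply, h0]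
      simp [PauliLabel.neg_eq]
    rw [hS, Finset.coe_image]
    exact ⟨(j, t j), by simp [hj, hF (Finsupp.mem_support_iff.2 hsj)], hts.symm⟩
  rw [h1, hS, Finset.sum_image]
  · rw [Finset.sum_product]
    refine Finset.sum_congr rfl fun j _ => ?_
    rw [siteOp_apply, ← (Equiv.subLeft (s j)).sum_comp, Finset.sum_filter]
    refine Finset.sum_congr rfl fun b _ => ?_
    rw [commPhase_single, apply_single_eq_field hH, sub_single_eq_update, update_apply_self]
    simp only [Equiv.subLeft_apply, fieldMatrix, sub_sub_cancel]
    by_cases hb : b = 0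
    · simp [hb]
    · rw [if_pos hb]; ring
  · rintro ⟨j, b⟩ hq ⟨j', b'⟩ hq' h
    simp only [Finset.coe_product, Set.mem_prod, Finset.mem_coe, Finset.mem_filter,
      Finset.mem_univ, true_and] at hq hq'
    rcases (Finsupp.single_eq_single_iff _ _ _ _).1 h with h | h
    · exact Prod.ext h.1 h.2
    · exact absurd h.1 hq.2

/-- The commutator with a one-site Hamiltonian preserves supports. -/
theorem ad_restr {H₀ : Op} (hH : H₀ ∈ 𝒯 1) (p : Finset ℤ → Prop) [DecidablePred p] (A : Op) :
    ad H₀ (restr p A) = restr p (ad H₀ A) := by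
  ext s
  rw [ad_eq_sum_siteOp hH _ subset_rfl, restr_apply, ad_eq_sum_siteOp hH _ subset_rfl]
  simp only [siteOp_restr (fieldMatrix_zero_left _) (fieldMatrix_zero_right _), restr_apply]
  split_ifs <;> simp

/-- The commutator with a Hermitian one-site Hamiltonian is symmetric. -/
theorem frobInner_ad_left {H₀ : Op} (hH : H₀ ∈ 𝒯 1) (hher : IsHermitianOp H₀) {A B : Op}
    (hA : IsLocal A) : frobInner (ad H₀ A) B = frobInner A (ad H₀ B) := by
  obtain ⟨M, hM⟩ := hA
  rw [frobInner_eq_sum hM, frobInner_eq_sum (ad_mem hH hM (add_comm 1 M).le)]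
  have hF : ∀ s ∈ anchoredBox M, s.support ⊆ Finset.Ico 0 (M : ℤ) := fun s hs =>
    (mem_anchoredBox.1 hs).1
  rw [Finset.sum_congr rfl fun s hs => by rw [ad_eq_sum_siteOp hH A (hF s hs), star_sum,
    Finset.sum_mul], Finset.sum_comm]
  symm
  rw [Finset.sum_congr rfl fun s hs => by rw [ad_eq_sum_siteOp hH B (hF s hs), Finset.mul_sum],
    Finset.sum_comm]
  refine Finset.sum_congr rfl fun j _ => ?_
  refine sum_star_mul_siteOp (fieldMatrix_zero_left _) (fieldMatrix_zero_right _)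
    (star_fieldMatrix fun a => hher _) (fun s hs hsj y hy => ?_) A B
  rw [mem_anchoredBox, support_update_eq hsj hy, ← Finsupp.mem_support_iff,
    support_update_eq hsj hy, Finsupp.mem_support_iff, ← mem_anchoredBox]
  exact hs

/-- The norm of a one-site Hamiltonian is the length of its field. -/
theorem sum_field_sq {H₀ : Op} (hH : H₀ ∈ 𝒯 1) (hher : IsHermitianOp H₀) :
    (field H₀ (1, 0) ^ 2 + field H₀ (1, 1) ^ 2 + field H₀ (0, 1) ^ 2 : ℂ) =
      ((frobNorm H₀ ^ 2 : ℝ) : ℂ) := by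
  classical
  have hbox : anchoredBox 1 =
      (Finset.univ.filter fun b : PauliLabel => b ≠ 0).image (Finsupp.single (0 : ℤ)) := by
    ext s
    simp only [mem_anchoredBox, Finset.mem_image, Finset.mem_filter, Finset.mem_univ, true_and]
    constructor
    · rintro ⟨h1, h2⟩
      refine ⟨s 0, h2, ?_⟩
      ext i : 1
      by_cases h : i = 0
      · subst h; simp
      · rw [Finsupp.single_eq_of_ne h]
        by_contra h0
        have := h1 (Finsupp.mem_support_iff.2 (Ne.symm h0))
        rw [Finset.mem_Ico] at this
        push_cast at this
        omega
    · rintro ⟨b, hb, rfl⟩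
      refine ⟨Finsupp.support_single_subset.trans (by simp), by simpa using hb⟩
  have hsq : ∀ b, field H₀ b ^ 2 = ((‖field H₀ b‖ ^ 2 : ℝ) : ℂ) := fun b => by
    have h : star (field H₀ b) = field H₀ b := hher _
    push_cast
    rw [← Complex.conj_mul', ← Complex.star_def, h, sq]
  rw [frobNorm_sq_eq_sum hH, hbox, Finset.sum_image (fun _ _ _ _ h => Finsupp.single_injective 0 h),
    Finset.sum_filter, sum_pauliLabel, hsq, hsq, hsq]
  have e1 : ((1, 0) : PauliLabel) ≠ 0 := by decide
  have e2 : ((1, 1) : PauliLabel) ≠ 0 := by decide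
  have e3 : ((0, 1) : PauliLabel) ≠ 0 := by decide
  simp [e1, e2, e3, field]

/-- The eigenvalues of the commutator with a one-site Hamiltonian are integer multiples of twice its
norm. -/
theorem eigenvalue_ad {H₀ : Op} (hH : H₀ ∈ 𝒯 1) (hher : IsHermitianOp H₀) (hpos : 0 < frobNorm H₀)
    {A : Op} (hA : A ≠ 0) {c : ℂ} (h : ad H₀ A = c • A) :
    ∃ k : ℤ, c = k * ((2 * frobNorm H₀ : ℝ) : ℂ) := by
  -- the part of `A` on a single support is again an eigenvector, and there the commutator is a
  -- finite sum of commuting operators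
  obtain ⟨s₀, hs₀⟩ := Function.ne_iff.1 hA
  set K := fieldMatrix (field H₀)
  refine eigenvalue_sum_mem_zmultiples (fun j => siteOp K j) (by
    have : (2 * frobNorm H₀ : ℝ) ≠ 0 := by positivity
    exact_mod_cast this) (fun i j hij v => siteOp_comm K K hij v) (fun i v => ?_) s₀.support c
    (restr (fun S => S = s₀.support) A) (fun h0 => hs₀ ?_) ?_
  · rw [siteOp_siteOp, siteOp_siteOp, Matrix.mul_assoc, fieldMatrix_cube, sum_field_sq hH hher]
    ext s
    simp only [siteOp_apply, Matrix.smul_apply, Pi.smul_apply, smul_eq_mul, Finset.mul_sum]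
    refine Finset.sum_congr rfl fun y _ => ?_
    push_cast
    ring
  · simpa [restr_apply] using congrFun h0 s₀
  · rw [← map_smul, ← h]
    ext s
    rw [Finset.sum_apply]
    simp only [siteOp_restr (fieldMatrix_zero_left (field H₀)) (fieldMatrix_zero_right _), K,
      restr_apply]
    by_cases hs : s.support = s₀.support
    · simp only [hs, if_true]
      rw [ad_eq_sum_siteOp hH A hs.le]
    · simp [hs]

/-! ### Diagonal part and pseudoinverse -/

theorem ad_isSymmetric {H₀ : Op} (hH : H₀ ∈ 𝒯 1) (hher : IsHermitianOp H₀) :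
    (LieAlgebra.ad ℂ LocOp ⟨H₀, 1, hH⟩).IsSymmetric := fun A _ =>
  frobInner_ad_left hH hher A.2

theorem ad_mem_of_one {H₀ : Op} (hH : H₀ ∈ 𝒯 1) {M : ℕ} {A : Op} (hA : A ∈ 𝒯 M) : ad H₀ A ∈ 𝒯 M :=
  ad_mem hH hA (add_comm 1 M).le

/-- The spectral gap of the commutator with a one-site Hamiltonian. -/
theorem gap_ad {H₀ : Op} (hH : H₀ ∈ 𝒯 1) (hher : IsHermitianOp H₀) (hpos : 0 < frobNorm H₀)
    {X : Op} (hX : IsLocal X) (hker : OrthKer H₀ X) :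
    2 * frobNorm H₀ * frobNorm X ≤ frobNorm (ad H₀ X) := by
  obtain ⟨M, hM⟩ := hX
  have := gap_of_eigenvalues (ad_isSymmetric hH hher) (LocOp.range M)
    (fun A hA => ad_mem_of_one hH hA) (g := 2 * frobNorm H₀) (by positivity)
    (fun c v _ hv hc => ?_) (x := ⟨X, M, hM⟩) hM (fun k hk => hker k k.2 (congrArg Subtype.val hk))
  · rwa [LocOp.norm_def, LocOp.norm_def] at this
  · obtain ⟨k, hk⟩ := eigenvalue_ad hH hher hpos (A := v) (fun h => hv (Subtype.ext h))
      (congrArg Subtype.val hc)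
    rcases eq_or_ne k 0 with rfl | h0
    · left; simpa using hk
    · right
      rw [hk, norm_mul, Complex.norm_real, Real.norm_of_nonneg (by positivity)]
      have : (1 : ℝ) ≤ ‖(k : ℂ)‖ := by
        rw [Complex.norm_intCast]
        exact_mod_cast Int.one_le_abs h0
      nlinarith

theorem eq_zero_of_frobInner_self {A : Op} (hA : IsLocal A) (h : frobInner A A = 0) : A = 0 := by
  have : (⟨A, hA⟩ : LocOp) = 0 := inner_self_eq_zero (𝕜 := ℂ).1 h
  exact congrArg Subtype.val this

theorem frobInner_sub_right {A B C : Op} (hA : IsLocal A) (hB : IsLocal B) (hC : IsLocal C) :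
    frobInner A (B - C) = frobInner A B - frobInner A C :=
  inner_sub_right (𝕜 := ℂ) (⟨A, hA⟩ : LocOp) ⟨B, hB⟩ ⟨C, hC⟩

theorem IsLocal.sub {A B : Op} (hA : IsLocal A) (hB : IsLocal B) : IsLocal (A - B) :=
  LocOp.sub_mem hA hB

theorem ad_sub_right {A B C : Op} (hA : IsLocal A) (hB : IsLocal B) (hC : IsLocal C) :
    ad A (B - C) = ad A B - ad A C :=
  congrArg Subtype.val (lie_sub (⟨A, hA⟩ : LocOp) (⟨B, hB⟩ : LocOp) (⟨C, hC⟩ : LocOp))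

theorem orthKer_ad {H₀ : Op} (hH : H₀ ∈ 𝒯 1) (hher : IsHermitianOp H₀) {X : Op} (hX : IsLocal X) :
    OrthKer H₀ (ad H₀ X) := fun K hK h => by
  rw [← frobInner_ad_left hH hher hK, h]
  exact inner_zero_left (𝕜 := ℂ) (⟨X, hX⟩ : LocOp)

theorem OrthKer.sub {H₀ A B : Op} (hA : IsLocal A) (hB : IsLocal B) (h : OrthKer H₀ A)
    (h' : OrthKer H₀ B) : OrthKer H₀ (A - B) := fun K hK hk => by
  rw [frobInner_sub_right hK hA hB, h K hK hk, h' K hK hk, sub_zero]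

/-- The diagonal part and the pseudoinverse, for operators of range `M`: both exist, so that the
choices in their definitions are not the default ones, and both stay in range `M`. -/
theorem diagPart_adPinv_spec {H₀ : Op} (hH : H₀ ∈ 𝒯 1) (hher : IsHermitianOp H₀) {M : ℕ} {A : Op}
    (hA : A ∈ 𝒯 M) :
    (diagPart H₀ A ∈ 𝒯 M ∧ ad H₀ (diagPart H₀ A) = 0 ∧ OrthKer H₀ (offDiagPart H₀ A)) ∧
    (adPinv H₀ (offDiagPart H₀ A) ∈ 𝒯 M ∧ OrthKer H₀ (adPinv H₀ (offDiagPart H₀ A)) ∧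
      ad H₀ (adPinv H₀ (offDiagPart H₀ A)) = offDiagPart H₀ A) := by
  obtain ⟨D, hD, Y, hY, hD0, hDY⟩ := exists_kernel_decomposition (ad_isSymmetric hH hher)
    (LocOp.range M) (fun A hA => ad_mem_of_one hH hA) (a := ⟨A, M, hA⟩) hA
  replace hDY : A = D + ad H₀ (ad H₀ Y) := congrArg Subtype.val hDY
  replace hD0 : ad H₀ (D : Op) = 0 := congrArg Subtype.val hD0
  rw [LocOp.mem_range] at hD hY
  have hloc : IsLocal H₀ := ⟨1, hH⟩
  have hAD : A - D = ad H₀ (ad H₀ Y) := by rw [hDY]; abel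
  have hX : ad H₀ Y ∈ 𝒯 M := ad_mem_of_one hH hY
  have hex : ∃ D, IsLocal D ∧ ad H₀ D = 0 ∧ OrthKer H₀ (A - D) :=
    ⟨D, D.2, hD0, hAD ▸ orthKer_ad hH hher ⟨M, hX⟩⟩
  -- two candidates differ by an element of the kernel that is orthogonal to the kernel
  have hdiag : diagPart H₀ A = D := by
    rw [diagPart, dif_pos hex]
    obtain ⟨g1, g2, g3⟩ := hex.choose_spec
    set D' := hex.choose
    have hl := g1.sub D.2
    have hk : ad H₀ (D' - D) = 0 := by rw [ad_sub_right hloc g1 D.2, g2, hD0, sub_zero]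
    have e : D' - (D : Op) = (A - D) - (A - D') := by abel
    have ho : OrthKer H₀ (D' - D) := by
      rw [e]
      refine OrthKer.sub ?_ ?_ ?_ g3
      · exact IsLocal.sub ⟨M, hA⟩ D.2
      · exact IsLocal.sub ⟨M, hA⟩ g1
      · exact hAD ▸ orthKer_ad hH hher ⟨M, hX⟩
    exact sub_eq_zero.1 (eq_zero_of_frobInner_self hl (ho _ hl hk))
  have hoff : offDiagPart H₀ A = ad H₀ (ad H₀ Y) := by rw [offDiagPart, hdiag, hAD]
  have hex' : ∃ X, IsLocal X ∧ OrthKer H₀ X ∧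
      ∀ Z, IsLocal Z → frobInner (ad H₀ Z) (offDiagPart H₀ A - ad H₀ X) = 0 := by
    refine ⟨ad H₀ Y, ⟨M, hX⟩, orthKer_ad hH hher ⟨M, hY⟩, fun Z hZ => ?_⟩
    rw [hoff, sub_self]
    exact inner_zero_right (𝕜 := ℂ) (⟨ad H₀ Z, hloc.ad hZ⟩ : LocOp)
  have hpinv : adPinv H₀ (offDiagPart H₀ A) = ad H₀ Y := by
    rw [adPinv, dif_pos hex']
    obtain ⟨g1, g2, g3⟩ := hex'.choose_spec
    set X' := hex'.choose
    have hl : IsLocal (ad H₀ Y - X') := IsLocal.sub ⟨M, hX⟩ g1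
    have h1 := g3 _ hl
    rw [hoff, ← ad_sub_right hloc ⟨M, hX⟩ g1] at h1
    have h2 := eq_zero_of_frobInner_self (hloc.ad hl) h1
    have h3 : OrthKer H₀ (ad H₀ Y - X') := OrthKer.sub ⟨M, hX⟩ g1 (orthKer_ad hH hher ⟨M, hY⟩) g2
    exact (sub_eq_zero.1 (eq_zero_of_frobInner_self hl (h3 _ hl h2))).symm
  rw [hpinv, hoff, hdiag]
  exact ⟨⟨hD, hD0, orthKer_ad hH hher ⟨M, hX⟩⟩, hX, orthKer_ad hH hher ⟨M, hY⟩, rfl⟩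

end SpinChain

namespace SpinChain

open scoped ENNReal

/-! ### A weighted norm adapted to commutators -/

/-- The strings with support exactly `S`. -/
def sector (S : Finset ℤ) : Finset PauliString := (box S).filter fun s => s.support = S

@[simp] theorem mem_sector {S : Finset ℤ} {s : PauliString} : s ∈ sector S ↔ s.support = S := by
  simp only [sector, Finset.mem_filter, mem_box, and_iff_right_iff_imp]
  exact fun h => h.le

/-- The coefficients of an operator on the strings with support `S`, as a Euclidean vector. -/
def sectorVec (S : Finset ℤ) : Op →ₗ[ℂ] EuclideanSpace ℂ (sector S) where
  toFun A := WithLp.toLp 2 fun s => A s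
  map_add' _ _ := rfl
  map_smul' _ _ := rfl

/-- The Frobenius norm of the part of an operator on the strings with support `S`. -/
def sectorNorm (A : Op) (S : Finset ℤ) : ℝ := ‖sectorVec S A‖

theorem sectorNorm_sq (A : Op) (S : Finset ℤ) :
    sectorNorm A S ^ 2 = ∑ s ∈ sector S, ‖A s‖ ^ 2 := by
  rw [sectorNorm, EuclideanSpace.norm_sq_eq]
  exact Finset.sum_coe_sort (sector S) fun s => ‖A s‖ ^ 2

theorem sectorNorm_nonneg (A : Op) (S : Finset ℤ) : 0 ≤ sectorNorm A S := norm_nonneg _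

theorem sectorNorm_congr {A B : Op} {S : Finset ℤ} (h : ∀ s ∈ sector S, A s = B s) :
    sectorNorm A S = sectorNorm B S := by
  rw [← sq_eq_sq₀ (sectorNorm_nonneg _ _) (sectorNorm_nonneg _ _), sectorNorm_sq, sectorNorm_sq]
  exact Finset.sum_congr rfl fun s hs => by rw [h s hs]

theorem sectorNorm_sum_le {ι : Type*} (F : Finset ι) (A : ι → Op) (S : Finset ℤ) :
    sectorNorm (∑ i ∈ F, A i) S ≤ ∑ i ∈ F, sectorNorm (A i) S := by
  rw [sectorNorm, map_sum]
  exact norm_sum_le _ _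

theorem exists_ne_zero_of_sectorNorm_ne_zero {A : Op} {S : Finset ℤ} (h : sectorNorm A S ≠ 0) :
    ∃ s ∈ sector S, A s ≠ 0 := by
  by_contra! H
  apply h
  rw [← pow_eq_zero_iff two_ne_zero, sectorNorm_sq]
  exact Finset.sum_eq_zero fun s hs => by simp [H s hs]

/-- The sector norm weighted by `4` per site.  The weight pays for the overlaps in a product: two
operators that overlap on `o` sites lose `o` sites of weight, which compensates the factor by which
the Frobenius norm fails to be submultiplicative, and the number of supports that can arise. -/
def weight (A : Op) (S : Finset ℤ) : ℝ≥0∞ := ENNReal.ofReal (4 ^ S.card * sectorNorm A S)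

/-- The weighted norm of an operator: the sum of the weighted sector norms over the supports
containing the site `0`. -/
def opNorm (A : Op) : ℝ≥0∞ := ∑' S : Finset ℤ, if (0 : ℤ) ∈ S then weight A S else 0

/-- Bounds that hold sector by sector pass to the weighted norm. -/
theorem opNorm_mono_of_sectorNorm {A B : Op} {c : ℝ} (hc : 0 ≤ c)
    (h : ∀ S : Finset ℤ, S.Nonempty → sectorNorm A S ≤ c * sectorNorm B S) :
    opNorm A ≤ ENNReal.ofReal c * opNorm B := by
  rw [opNorm, opNorm, ← ENNReal.tsum_mul_left]
  refine ENNReal.tsum_le_tsum fun S => ?_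
  split_ifs with h0
  · rw [weight, weight, ← ENNReal.ofReal_mul hc]
    refine ENNReal.ofReal_le_ofReal ?_
    have := h S ⟨0, h0⟩
    calc 4 ^ S.card * sectorNorm A S ≤ 4 ^ S.card * (c * sectorNorm B S) := by gcongr
      _ = _ := by ring
  · simp

theorem opNorm_sum_le {ι : Type*} (F : Finset ι) (A : ι → Op) :
    opNorm (∑ i ∈ F, A i) ≤ ∑ i ∈ F, opNorm (A i) := by
  simp only [opNorm]
  rw [← Summable.tsum_finsetSum fun _ _ => ENNReal.summable]
  refine ENNReal.tsum_le_tsum fun S => ?_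
  split_ifs with h0
  · simp only [weight]
    rw [← ENNReal.ofReal_sum_of_nonneg fun i _ =>
      mul_nonneg (by positivity) (sectorNorm_nonneg _ _), ← Finset.mul_sum]
    refine ENNReal.ofReal_le_ofReal ?_
    gcongr
    exact sectorNorm_sum_le F A S
  · simp

theorem opNorm_add_le (A B : Op) : opNorm (A + B) ≤ opNorm A + opNorm B := by
  have := opNorm_sum_le Finset.univ ![A, B]
  simpa using this

theorem opNorm_smul_le (c : ℂ) (A : Op) : opNorm (c • A) ≤ ENNReal.ofReal ‖c‖ * opNorm A := by
  refine opNorm_mono_of_sectorNorm (norm_nonneg c) fun S _ => ?_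
  rw [sectorNorm, map_smul, norm_smul, sectorNorm]

theorem opNorm_neg (A : Op) : opNorm (-A) = opNorm A := by
  simp only [opNorm, weight, sectorNorm, map_neg, norm_neg]

/-! ### Translates of supports -/

/-- The translate of a set of sites. -/
def shift (j : ℤ) (S : Finset ℤ) : Finset ℤ := S.map (Equiv.addRight j).toEmbedding

theorem mem_shift {j i : ℤ} {S : Finset ℤ} : i ∈ shift j S ↔ i - j ∈ S := by
  simp only [shift, Finset.mem_map_equiv]
  rfl

theorem shift_shift (i j : ℤ) (S : Finset ℤ) : shift i (shift j S) = shift (i + j) S := by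
  ext k; simp [mem_shift, sub_sub]

theorem shift_zero (S : Finset ℤ) : shift 0 S = S := by
  ext k; simp [mem_shift]

theorem sectorNorm_shift {A : Op} (hA : ∀ j s, A (translate j s) = A s) (j : ℤ) (S : Finset ℤ) :
    sectorNorm A (shift j S) = sectorNorm A S := by
  rw [← sq_eq_sq₀ (sectorNorm_nonneg _ _) (sectorNorm_nonneg _ _), sectorNorm_sq, sectorNorm_sq]
  refine Finset.sum_nbij' (translate (-j)) (translate j) ?_ ?_ ?_ ?_ ?_
  · intro s hs
    rw [mem_sector] at *
    rw [support_translate, hs]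
    change shift (-j) (shift j S) = S
    rw [shift_shift, neg_add_cancel, shift_zero]
  · intro s hs
    rw [mem_sector] at *
    rw [support_translate, hs, shift]
  · simp [translate_translate]
  · simp [translate_translate]
  · simp [hA]

/-- By translation invariance any site may take the place of the origin in the weighted norm. -/
theorem tsum_weight_mem {A : Op} (hA : ∀ j s, A (translate j s) = A s) (j : ℤ) :
    ∑' S : Finset ℤ, (if j ∈ S then weight A S else 0) = opNorm A := by
  rw [opNorm]
  let e : Finset ℤ ≃ Finset ℤ :=
    { toFun := shift j
      invFun := shift (-j)
      left_inv := fun S => by rw [shift_shift, neg_add_cancel, shift_zero]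
      right_inv := fun S => by rw [shift_shift, add_neg_cancel, shift_zero] }
  rw [← e.tsum_eq]
  refine tsum_congr fun S => ?_
  have h1 : j ∈ e S ↔ (0 : ℤ) ∈ S := by
    change j ∈ shift j S ↔ _
    rw [mem_shift, sub_self]
  have h2 : weight A (e S) = weight A S := by
    change weight A (shift j S) = _
    rw [weight, weight, sectorNorm_shift hA, shift, Finset.card_map]
  simp only [h1, h2]

/-! ### The commutator bound -/

/-- The contribution to a commutator of the strings with supports `S` and `S'`. -/
def adPiece (A B : Op) (S S' : Finset ℤ) : Op := fun s =>
  ∑ t ∈ (sector S).filter fun t => (s - t).support = S', A t * B (s - t) * commPhase t (s - t)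

/-- `R` can be the support of the product of two strings with supports `S`, `S'` that overlap. -/
def CanMerge (S S' R : Finset ℤ) : Prop :=
  (S ∩ S').Nonempty ∧ R ⊆ S ∪ S' ∧ ∀ j, j ∈ S ∪ S' → j ∉ S ∩ S' → j ∈ R

theorem canMerge_of_adPiece_ne_zero {A B : Op} {S S' : Finset ℤ} {s : PauliString}
    (h : adPiece A B S S' s ≠ 0) : CanMerge S S' s.support := by
  obtain ⟨t, ht, hne⟩ := Finset.exists_ne_zero_of_sum_ne_zero h
  rw [Finset.mem_filter, mem_sector] at ht
  obtain ⟨rfl, rfl⟩ := ht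
  have hc : commPhase t (s - t) ≠ 0 := fun h0 => hne (by simp [h0])
  obtain ⟨i, hi, hi'⟩ := exists_mem_of_commPhase_ne_zero hc
  refine ⟨⟨i, by simpa using ⟨hi, hi'⟩⟩, fun j hj => ?_, fun j hj hj' => ?_⟩
  · simp only [Finset.mem_union, Finsupp.mem_support_iff, Finsupp.sub_apply] at *
    by_contra! H
    rw [H.1, sub_zero] at H
    exact hj H.2
  · simp only [Finset.mem_union, Finset.mem_inter, Finsupp.mem_support_iff, Finsupp.sub_apply] at *
    intro h0
    rw [h0, zero_sub, neg_ne_zero] at hj hj'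
    tauto

/-- A product string and the supports of its factors determine the factors off the overlap; on the
overlap the first factor has at most four labels per site. -/
theorem card_filter_sector_le (S S' : Finset ℤ) (s : PauliString) :
    ((sector S).filter fun t => (s - t).support = S').card ≤ 4 ^ (S ∩ S').card := by
  have hcard : (Finset.univ : Finset ((S ∩ S' : Finset ℤ) → PauliLabel)).card =
      4 ^ (S ∩ S').card := by
    have h4 : Fintype.card PauliLabel = 4 := by decide
    rw [Finset.card_univ, Fintype.card_fun, h4, Fintype.card_coe]
  rw [← hcard]
  refine Finset.card_le_card_of_injOn (fun t j => t j)
    (fun _ _ => Finset.mem_coe.2 (Finset.mem_univ _)) ?_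
  intro t ht t' ht' h
  rw [Finset.mem_coe, Finset.mem_filter, mem_sector] at ht ht'
  ext j : 1
  by_cases hS : j ∈ S
  · by_cases hS' : j ∈ S'
    · exact congrFun h ⟨j, Finset.mem_inter.2 ⟨hS, hS'⟩⟩
    · have h1 : (s - t) j = 0 := Finsupp.notMem_support_iff.1 (by rwa [ht.2])
      have h2 : (s - t') j = 0 := Finsupp.notMem_support_iff.1 (by rwa [ht'.2])
      rw [Finsupp.sub_apply, sub_eq_zero] at h1 h2
      rw [← h1, ← h2]
  · have h1 : t j = 0 := Finsupp.notMem_support_iff.1 (by rwa [ht.1])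
    have h2 : t' j = 0 := Finsupp.notMem_support_iff.1 (by rwa [ht'.1])
    rw [h1, h2]

/-- Cauchy-Schwarz: given the product string, a factor is determined by its labels on the
overlap. -/
theorem sectorNorm_adPiece_le (A B : Op) (S S' R : Finset ℤ) :
    sectorNorm (adPiece A B S S') R ≤
      2 * 2 ^ (S ∩ S').card * (sectorNorm A S * sectorNorm B S') := by
  set o := (S ∩ S').card
  refine abs_le_of_sq_le_sq' ?_ (mul_nonneg (by positivity)
    (mul_nonneg (sectorNorm_nonneg _ _) (sectorNorm_nonneg _ _))) |>.2
  have h4 : ((2 : ℝ) ^ o) ^ 2 = 4 ^ o := by rw [← pow_mul, mul_comm, pow_mul]; norm_num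
  rw [sectorNorm_sq, mul_pow, mul_pow, mul_pow, h4, sectorNorm_sq, sectorNorm_sq]
  have hpt : ∀ s, ‖adPiece A B S S' s‖ ^ 2 ≤ 2 ^ 2 * 4 ^ o *
      ∑ t ∈ (sector S).filter fun t => (s - t).support = S', ‖A t‖ ^ 2 * ‖B (s - t)‖ ^ 2 := by
    intro s
    set Q := (sector S).filter fun t => (s - t).support = S'
    have h1 : ‖adPiece A B S S' s‖ ≤ ∑ t ∈ Q, 2 * (‖A t‖ * ‖B (s - t)‖) := by
      refine (norm_sum_le _ _).trans (Finset.sum_le_sum fun t _ => ?_)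
      rw [norm_mul, norm_mul, mul_comm 2]
      gcongr
      exact norm_commPhase_le _ _
    calc (‖adPiece A B S S' s‖ ^ 2 : ℝ) ≤ (∑ t ∈ Q, 2 * (‖A t‖ * ‖B (s - t)‖)) ^ 2 := by gcongr
      _ ≤ (Q.card : ℝ) * ∑ t ∈ Q, (2 * (‖A t‖ * ‖B (s - t)‖)) ^ 2 := sq_sum_le_card_mul_sum_sq
      _ ≤ 4 ^ o * ∑ t ∈ Q, (2 * (‖A t‖ * ‖B (s - t)‖)) ^ 2 := by
        gcongr
        exact_mod_cast card_filter_sector_le S S' s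
      _ = 2 ^ 2 * 4 ^ o * ∑ t ∈ Q, ‖A t‖ ^ 2 * ‖B (s - t)‖ ^ 2 := by
        rw [mul_comm (2 ^ 2 : ℝ), mul_assoc, Finset.mul_sum Q _ (2 ^ 2 : ℝ)]
        congr 1
        exact Finset.sum_congr rfl fun t _ => by ring
  calc ∑ s ∈ sector R, ‖adPiece A B S S' s‖ ^ 2
      ≤ ∑ s ∈ sector R, 2 ^ 2 * 4 ^ o *
        ∑ t ∈ (sector S).filter fun t => (s - t).support = S', ‖A t‖ ^ 2 * ‖B (s - t)‖ ^ 2 :=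
        Finset.sum_le_sum fun s _ => hpt s
    _ = 2 ^ 2 * 4 ^ o * ∑ t ∈ sector S, ‖A t‖ ^ 2 *
        ∑ s ∈ (sector R).filter fun s => (s - t).support = S', ‖B (s - t)‖ ^ 2 := by
        rw [← Finset.mul_sum]
        congr 1
        simp only [Finset.sum_filter, Finset.mul_sum, mul_ite, mul_zero]
        rw [Finset.sum_comm]
    _ ≤ 2 ^ 2 * 4 ^ o * ∑ t ∈ sector S, ‖A t‖ ^ 2 * ∑ u ∈ sector S', ‖B u‖ ^ 2 := by
        gcongr with t _
        rw [← Finset.sum_image (f := fun u => ‖B u‖ ^ 2) (g := fun s => s - t)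
          (fun _ _ _ _ h => sub_left_injective h)]
        refine Finset.sum_le_sum_of_subset_of_nonneg ?_ fun _ _ _ => by positivity
        intro u hu
        obtain ⟨s, hs, rfl⟩ := Finset.mem_image.1 hu
        rw [Finset.mem_filter] at hs
        exact mem_sector.2 hs.2
    _ = _ := by rw [Finset.sum_mul]

theorem ad_eq_sum_adPiece {a b : ℕ} {A B : Op} (hA : A ∈ 𝒯 a) (hB : B ∈ 𝒯 b) {s : PauliString}
    {W : Finset ℤ} (hW : thicken s.support (a + b) ⊆ W) :
    ad A B s = ∑ S ∈ W.powerset, ∑ S' ∈ W.powerset, adPiece A B S S' s := by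
  rw [ad_eq_sum hA hB hW, ← Finset.sum_fiberwise_of_maps_to (g := fun t => t.support)
    (t := W.powerset) (fun t ht => Finset.mem_powerset.2 (mem_box.1 ht))]
  refine Finset.sum_congr rfl fun S hS => ?_
  have hfil : (box W).filter (fun t => t.support = S) = sector S := by
    ext t
    simp only [Finset.mem_filter, mem_box, mem_sector, and_iff_right_iff_imp]
    rintro rfl
    exact Finset.mem_powerset.1 hS
  rw [hfil, ← Finset.sum_fiberwise_of_maps_to (g := fun t => (s - t).support) (t := W.powerset)]
  · rfl
  · intro t ht
    rw [Finset.mem_powerset, PauliString.sub_eq_add]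
    refine Finsupp.support_add.trans (Finset.union_subset ((subset_thicken _ _).trans hW) ?_)
    rw [mem_sector.1 ht]
    exact Finset.mem_powerset.1 hS

open Classical in
/-- A possible support of the product is determined by its trace on the overlap. -/
theorem card_filter_canMerge_le (S S' : Finset ℤ) :
    ((S ∪ S').powerset.filter (CanMerge S S')).card ≤ 2 ^ (S ∩ S').card := by
  rw [← Finset.card_powerset]
  refine Finset.card_le_card_of_injOn (fun R => R ∩ (S ∩ S'))
    (fun R _ => Finset.mem_coe.2 (Finset.mem_powerset.2 Finset.inter_subset_right)) ?_
  intro R hR R' hR' h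
  rw [Finset.mem_coe, Finset.mem_filter] at hR hR'
  ext j
  have hj : j ∈ R ∩ (S ∩ S') ↔ j ∈ R' ∩ (S ∩ S') := by
    change R ∩ (S ∩ S') = R' ∩ (S ∩ S') at h
    rw [h]
  by_cases ho : j ∈ S ∩ S'
  · simpa [ho, Finset.mem_inter.1 ho] using hj
  · exact ⟨fun h1 => hR'.2.2.2 j (hR.2.2.1 h1) ho, fun h1 => hR.2.2.2 j (hR'.2.2.1 h1) ho⟩

open Classical in
/-- The weight `4 ^ |R| ≤ 4 ^ |S| 4 ^ |S'| / 4 ^ o`, with `o` the overlap, absorbs the factor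
`2 ^ o` of `sectorNorm_adPiece_le` and leaves `2 ^ (-o)` for the sum over `R`. -/
theorem weight_ad_le {a b : ℕ} {A B : Op} (hA : A ∈ 𝒯 a) (hB : B ∈ 𝒯 b) (R : Finset ℤ) :
    weight (ad A B) R ≤ ∑' S, ∑' S', if CanMerge S S' R then
      2 * (weight A S * weight B S') * (2 ^ (S ∩ S').card)⁻¹ else 0 := by
  set W := thicken R (a + b)
  have h1 : sectorNorm (ad A B) R ≤
      ∑ S ∈ W.powerset, ∑ S' ∈ W.powerset, sectorNorm (adPiece A B S S') R := by
    rw [sectorNorm_congr (B := ∑ S ∈ W.powerset, ∑ S' ∈ W.powerset, adPiece A B S S')]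
    · refine (sectorNorm_sum_le _ _ _).trans (Finset.sum_le_sum fun S _ => ?_)
      exact sectorNorm_sum_le _ _ _
    · intro s hs
      rw [mem_sector] at hs
      rw [ad_eq_sum_adPiece hA hB (W := W) (by rw [hs])]
      simp only [Finset.sum_apply]
  have hterm : ∀ S S', ENNReal.ofReal (4 ^ R.card * sectorNorm (adPiece A B S S') R) ≤
      if CanMerge S S' R then
        2 * (weight A S * weight B S') * (2 ^ (S ∩ S').card)⁻¹ else 0 := by
    intro S S'
    by_cases h0 : sectorNorm (adPiece A B S S') R = 0
    · simp [h0]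
    obtain ⟨s, hs, hne⟩ := exists_ne_zero_of_sectorNorm_ne_zero h0
    rw [mem_sector] at hs
    have hm := canMerge_of_adPiece_ne_zero hne
    rw [hs] at hm
    rw [if_pos hm]
    set o := (S ∩ S').card with ho
    have h2 : (2 : ℝ≥0∞) ^ o = ENNReal.ofReal (2 ^ o) := by
      rw [ENNReal.ofReal_pow (by norm_num)]; norm_num
    have h3 : (2 : ℝ≥0∞) = ENNReal.ofReal 2 := by norm_num
    rw [h2, ← ENNReal.ofReal_inv_of_pos (by positivity), weight, weight,
      ← ENNReal.ofReal_mul (mul_nonneg (by positivity) (sectorNorm_nonneg _ _)), h3,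
      ← ENNReal.ofReal_mul (by norm_num), ← ENNReal.ofReal_mul (mul_nonneg (by norm_num)
        (mul_nonneg (mul_nonneg (by positivity) (sectorNorm_nonneg _ _))
          (mul_nonneg (by positivity) (sectorNorm_nonneg _ _))))]
    refine ENNReal.ofReal_le_ofReal ?_
    have hcard : R.card + o ≤ S.card + S'.card := by
      rw [ho, ← Finset.card_union_add_card_inter S S']
      exact Nat.add_le_add_right (Finset.card_le_card hm.2.1) _
    have hpow : (4 : ℝ) ^ R.card * 4 ^ o ≤ 4 ^ S.card * 4 ^ S'.card := by
      rw [← pow_add, ← pow_add]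
      exact pow_le_pow_right₀ (by norm_num) hcard
    have h4 : (4 : ℝ) ^ o = 2 ^ o * 2 ^ o := by rw [← mul_pow]; norm_num
    set x := sectorNorm A S
    set y := sectorNorm B S'
    have hxy : 0 ≤ x * y := mul_nonneg (sectorNorm_nonneg _ _) (sectorNorm_nonneg _ _)
    calc 4 ^ R.card * sectorNorm (adPiece A B S S') R
        ≤ 4 ^ R.card * (2 * 2 ^ o * (x * y)) := by
          gcongr
          exact sectorNorm_adPiece_le A B S S' R
      _ = (4 ^ R.card * 4 ^ o) * (2 * (x * y)) * (2 ^ o)⁻¹ := by rw [h4]; field_simp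
      _ ≤ (4 ^ S.card * 4 ^ S'.card) * (2 * (x * y)) * (2 ^ o)⁻¹ := by gcongr
      _ = _ := by ring
  calc weight (ad A B) R
      ≤ ENNReal.ofReal (4 ^ R.card *
        ∑ S ∈ W.powerset, ∑ S' ∈ W.powerset, sectorNorm (adPiece A B S S') R) := by
        refine ENNReal.ofReal_le_ofReal ?_
        gcongr
    _ = ∑ S ∈ W.powerset, ∑ S' ∈ W.powerset,
        ENNReal.ofReal (4 ^ R.card * sectorNorm (adPiece A B S S') R) := by
        have hnn : ∀ S S', 0 ≤ (4 : ℝ) ^ R.card * sectorNorm (adPiece A B S S') R := fun S S' =>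
          mul_nonneg (by positivity) (sectorNorm_nonneg _ _)
        simp only [Finset.mul_sum]
        rw [ENNReal.ofReal_sum_of_nonneg fun S _ => Finset.sum_nonneg fun S' _ => hnn S S']
        exact Finset.sum_congr rfl fun S _ => ENNReal.ofReal_sum_of_nonneg fun S' _ => hnn S S'
    _ ≤ ∑ S ∈ W.powerset, ∑ S' ∈ W.powerset, if CanMerge S S' R then
        2 * (weight A S * weight B S') * (2 ^ (S ∩ S').card)⁻¹ else 0 :=
        Finset.sum_le_sum fun S _ => Finset.sum_le_sum fun S' _ => hterm S S'
    _ ≤ _ := (Finset.sum_le_sum fun S _ => ENNReal.sum_le_tsum _).trans (ENNReal.sum_le_tsum _)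

theorem card_le_of_weight_ne_zero {a : ℕ} {A : Op} (hA : A ∈ 𝒯 a) {S : Finset ℤ}
    (h : weight A S ≠ 0) : S.card ≤ a := by
  have h0 : sectorNorm A S ≠ 0 := fun h0 => h (by simp [weight, h0])
  obtain ⟨s, hs, hne⟩ := exists_ne_zero_of_sectorNorm_ne_zero h0
  obtain ⟨j, hj⟩ := hA.2.2 s hne
  rw [mem_sector] at hs
  have : S ⊆ Finset.Ico j (j + a) := fun i hi => by
    rw [← hs, Finsupp.mem_support_iff] at hi
    exact Finset.mem_Ico.2 (hj i hi)
  simpa using Finset.card_le_card this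

/-- Counting overlapping supports: the first contains the origin and the second one of its sites. -/
theorem tsum_overlap_le {a : ℕ} {A B : Op} (hA : A ∈ 𝒯 a)
    (hB : ∀ j s, B (translate j s) = B s) :
    ∑' S : Finset ℤ, ∑' S' : Finset ℤ,
      (if (0 : ℤ) ∈ S ∧ (S ∩ S').Nonempty then weight A S * weight B S' else 0) ≤
      a * (opNorm A * opNorm B) := by
  have hS : ∀ S : Finset ℤ, ∑' S' : Finset ℤ,
      (if (0 : ℤ) ∈ S ∧ (S ∩ S').Nonempty then weight A S * weight B S' else 0) ≤
      (if (0 : ℤ) ∈ S then weight A S else 0) * (a * opNorm B) := by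
    intro S
    by_cases h0 : (0 : ℤ) ∈ S
    · by_cases hw : weight A S = 0
      · simp [hw]
      calc ∑' S' : Finset ℤ,
          (if (0 : ℤ) ∈ S ∧ (S ∩ S').Nonempty then weight A S * weight B S' else 0)
          ≤ ∑' S' : Finset ℤ, weight A S * ∑ j ∈ S, if j ∈ S' then weight B S' else 0 := by
            refine ENNReal.tsum_le_tsum fun S' => ?_
            split_ifs with h
            · obtain ⟨j, hj⟩ := h.2
              rw [Finset.mem_inter] at hj
              gcongr
              calc weight B S' = if j ∈ S' then weight B S' else 0 := by rw [if_pos hj.2]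
                _ ≤ _ := Finset.single_le_sum
                  (f := fun j => if j ∈ S' then weight B S' else 0) (fun _ _ => zero_le) hj.1
            · exact zero_le
        _ = weight A S * (S.card * opNorm B) := by
            rw [ENNReal.tsum_mul_left, Summable.tsum_finsetSum fun _ _ => ENNReal.summable]
            simp only [tsum_weight_mem hB, Finset.sum_const, nsmul_eq_mul]
        _ ≤ _ := by
            rw [if_pos h0]
            gcongr
            exact card_le_of_weight_ne_zero hA hw
    · simp [h0]
  refine (ENNReal.tsum_le_tsum hS).trans ?_
  rw [ENNReal.tsum_mul_right]
  exact le_of_eq (by rw [← opNorm]; ring)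

/-- The commutator of two local operators: besides the product of the norms, only the sum of the
ranges enters. -/
theorem opNorm_ad_le {a b : ℕ} {A B : Op} (hA : A ∈ 𝒯 a) (hB : B ∈ 𝒯 b) :
    opNorm (ad A B) ≤ 2 * (a + b) * (opNorm A * opNorm B) := by
  classical
  set P : Finset ℤ → Finset ℤ → ℝ≥0∞ := fun S S' => weight A S * weight B S'
  -- there are at most `2 ^ o` supports `R`; if `R` contains the origin, so does `S` or `S'`
  have hR : ∀ S S' : Finset ℤ, ∑' R : Finset ℤ, (if (0 : ℤ) ∈ R then (if CanMerge S S' R then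
      2 * P S S' * (2 ^ (S ∩ S').card)⁻¹ else 0) else 0) ≤
      2 * ((if (0 : ℤ) ∈ S ∧ (S ∩ S').Nonempty then P S S' else 0) +
        if (0 : ℤ) ∈ S' ∧ (S' ∩ S).Nonempty then P S S' else 0) := by
    intro S S'
    by_cases h : (0 : ℤ) ∈ S ∪ S' ∧ (S ∩ S').Nonempty
    · have hle : P S S' ≤ (if (0 : ℤ) ∈ S ∧ (S ∩ S').Nonempty then P S S' else 0) +
          if (0 : ℤ) ∈ S' ∧ (S' ∩ S).Nonempty then P S S' else 0 := by
        rcases Finset.mem_union.1 h.1 with h0 | h0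
        · rw [if_pos ⟨h0, h.2⟩]; exact le_self_add
        · rw [if_pos (c := (0 : ℤ) ∈ S' ∧ _) ⟨h0, by rw [Finset.inter_comm]; exact h.2⟩]
          exact le_add_self
      refine le_trans ?_ (mul_le_mul_right hle 2)
      have hsup : ∀ R : Finset ℤ, R ∉ (S ∪ S').powerset.filter (CanMerge S S') →
          (if (0 : ℤ) ∈ R then (if CanMerge S S' R then
            2 * P S S' * (2 ^ (S ∩ S').card)⁻¹ else 0) else 0) = 0 := by
        intro R hR
        rw [Finset.mem_filter, Finset.mem_powerset] at hR
        have : ¬CanMerge S S' R := fun hm => hR ⟨hm.2.1, hm⟩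
        simp [this]
      rw [tsum_eq_sum hsup]
      calc _ ≤ ∑ R ∈ (S ∪ S').powerset.filter (CanMerge S S'),
            2 * P S S' * (2 ^ (S ∩ S').card)⁻¹ := by
            refine Finset.sum_le_sum fun R _ => ?_
            split_ifs <;> simp
        _ = 2 * P S S' * ((((S ∪ S').powerset.filter (CanMerge S S')).card : ℝ≥0∞) *
            (2 ^ (S ∩ S').card)⁻¹) := by
            rw [Finset.sum_const, nsmul_eq_mul]; ring
        _ ≤ 2 * P S S' * 1 := by
            gcongr
            rw [← div_eq_mul_inv]
            refine ENNReal.div_le_of_le_mul ?_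
            rw [one_mul]
            exact_mod_cast card_filter_canMerge_le S S'
        _ = _ := mul_one _
    · have hz : ∀ R : Finset ℤ, (if (0 : ℤ) ∈ R then (if CanMerge S S' R then
            2 * P S S' * (2 ^ (S ∩ S').card)⁻¹ else 0) else 0) = 0 := by
        intro R
        split_ifs with h1 h2
        · exact absurd ⟨h2.2.1 h1, h2.1⟩ h
        all_goals rfl
      simp [hz]
  calc opNorm (ad A B)
      ≤ ∑' R : Finset ℤ, ∑' S, ∑' S', (if (0 : ℤ) ∈ R then (if CanMerge S S' R then
          2 * P S S' * (2 ^ (S ∩ S').card)⁻¹ else 0) else 0) := by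
        refine ENNReal.tsum_le_tsum fun R => ?_
        split_ifs with h
        · exact weight_ad_le hA hB R
        · exact zero_le
    _ = ∑' S, ∑' S', ∑' R : Finset ℤ, (if (0 : ℤ) ∈ R then (if CanMerge S S' R then
          2 * P S S' * (2 ^ (S ∩ S').card)⁻¹ else 0) else 0) := by
        rw [ENNReal.tsum_comm]
        exact tsum_congr fun S => ENNReal.tsum_comm
    _ ≤ ∑' S, ∑' S', 2 * ((if (0 : ℤ) ∈ S ∧ (S ∩ S').Nonempty then P S S' else 0) +
        if (0 : ℤ) ∈ S' ∧ (S' ∩ S).Nonempty then P S S' else 0) :=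
        ENNReal.tsum_le_tsum fun S => ENNReal.tsum_le_tsum fun S' => hR S S'
    _ = 2 * (∑' S : Finset ℤ, ∑' S' : Finset ℤ,
          (if (0 : ℤ) ∈ S ∧ (S ∩ S').Nonempty then weight A S * weight B S' else 0) +
        ∑' S' : Finset ℤ, ∑' S : Finset ℤ,
          (if (0 : ℤ) ∈ S' ∧ (S' ∩ S).Nonempty then weight B S' * weight A S else 0)) := by
        rw [ENNReal.tsum_comm (f := fun S' S : Finset ℤ =>
          if (0 : ℤ) ∈ S' ∧ (S' ∩ S).Nonempty then weight B S' * weight A S else 0)]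
        simp only [ENNReal.tsum_mul_left, ENNReal.tsum_add, P, mul_comm (weight A _)]
    _ ≤ 2 * (a * (opNorm A * opNorm B) + b * (opNorm B * opNorm A)) := by
        gcongr
        · exact tsum_overlap_le hA hB.1
        · exact tsum_overlap_le hB hA.1
    _ = _ := by ring

/-! ### Comparison with the Frobenius norm -/

theorem frobNorm_nonneg (A : Op) : 0 ≤ frobNorm A := Real.sqrt_nonneg _

theorem mem_sector_support_anchored {s : PauliString} (hs : s ∈ anchored) :
    (0 : ℤ) ∈ s.support := Finsupp.mem_support_iff.2 hs.1

/-- The Frobenius norm is the Euclidean sum of the sector norms over the supports with leftmost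
site `0`. -/
theorem frobNorm_le_opNorm {A : Op} (hA : IsLocal A) : ENNReal.ofReal (frobNorm A) ≤ opNorm A := by
  obtain ⟨M, hM⟩ := hA
  set F := (Finset.Ico 0 (M : ℤ)).powerset.filter fun S => (0 : ℤ) ∈ S with hF
  have h1 : frobNorm A ≤ ∑ S ∈ F, 4 ^ S.card * sectorNorm A S := by
    have hnn : ∀ S ∈ F, 0 ≤ sectorNorm A S := fun S _ => sectorNorm_nonneg A S
    have h2 : frobNorm A ^ 2 = ∑ S ∈ F, sectorNorm A S ^ 2 := by
      rw [frobNorm_sq_eq_sum hM,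
        ← Finset.sum_fiberwise_of_maps_to (g := fun s => s.support) (t := F)]
      · refine Finset.sum_congr rfl fun S hS => ?_
        rw [sectorNorm_sq]
        congr 1
        ext s
        rw [Finset.mem_filter, mem_anchoredBox, mem_sector, and_iff_right_iff_imp]
        rintro rfl
        rw [hF, Finset.mem_filter, Finset.mem_powerset] at hS
        exact ⟨hS.1, Finsupp.mem_support_iff.1 hS.2⟩
      · intro s hs
        rw [mem_anchoredBox] at hs
        exact Finset.mem_filter.2 ⟨Finset.mem_powerset.2 hs.1, Finsupp.mem_support_iff.2 hs.2⟩
    have h3 : frobNorm A ≤ ∑ S ∈ F, sectorNorm A S := by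
      refine abs_le_of_sq_le_sq' ?_ (Finset.sum_nonneg hnn) |>.2
      rw [h2]
      exact Finset.sum_sq_le_sq_sum_of_nonneg hnn
    refine h3.trans (Finset.sum_le_sum fun S hS => ?_)
    exact le_mul_of_one_le_left (hnn S hS) (one_le_pow₀ (by norm_num))
  calc ENNReal.ofReal (frobNorm A)
      ≤ ENNReal.ofReal (∑ S ∈ F, 4 ^ S.card * sectorNorm A S) := ENNReal.ofReal_le_ofReal h1
    _ = ∑ S ∈ F, if (0 : ℤ) ∈ S then weight A S else 0 := by
        rw [ENNReal.ofReal_sum_of_nonneg fun S _ => mul_nonneg (by positivity)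
          (sectorNorm_nonneg A S)]
        refine Finset.sum_congr rfl fun S hS => ?_
        rw [hF, Finset.mem_filter] at hS
        rw [if_pos hS.2, weight]
    _ ≤ _ := ENNReal.sum_le_tsum _

/-- Every nonempty set of sites has a translate whose leftmost site is the origin. -/
theorem exists_shift_anchored {S : Finset ℤ} (hS : S.Nonempty) :
    ∃ j, (0 : ℤ) ∈ shift j S ∧ ∀ i ∈ shift j S, 0 ≤ i := by
  refine ⟨-(S.min' hS), ?_, fun i hi => ?_⟩
  · rw [mem_shift, zero_sub, neg_neg]
    exact Finset.min'_mem _ _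
  · rw [mem_shift] at hi
    have := Finset.min'_le _ _ hi
    omega

theorem restr_mem {M : ℕ} {A : Op} (hA : A ∈ 𝒯 M) (p : Finset ℤ → Prop) [DecidablePred p]
    (hp : ∀ j S, p (shift j S) ↔ p S) : restr p A ∈ 𝒯 M := by
  refine ⟨fun j s => ?_, ?_, fun s hs => hA.2.2 s fun h0 => hs ?_⟩
  · rw [restr_apply, restr_apply, support_translate, hA.1]
    have : p (s.support.map (Equiv.addRight j).toEmbedding) ↔ p s.support := hp j s.support
    simp only [this]
  · rw [restr_apply, hA.2.1, ite_self]
  · rw [restr_apply, h0, ite_self]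

/-- `R` is a translate of `S`. -/
def IsShift (S R : Finset ℤ) : Prop := ∃ j, R = shift j S

theorem isShift_shift (S : Finset ℤ) (j : ℤ) (R : Finset ℤ) :
    IsShift S (shift j R) ↔ IsShift S R := by
  constructor
  · rintro ⟨k, hk⟩
    refine ⟨-j + k, ?_⟩
    rw [← shift_shift, ← hk, shift_shift, neg_add_cancel, shift_zero]
  · rintro ⟨k, rfl⟩
    exact ⟨j + k, shift_shift _ _ _⟩

open Classical in
/-- The sector norm is the Frobenius norm of the translationally invariant operator made of the
strings whose support is a translate of `S`. -/
theorem sectorNorm_eq_frobNorm {M : ℕ} {A : Op} (hA : A ∈ 𝒯 M) {S : Finset ℤ} (hS : S.Nonempty) :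
    sectorNorm A S = frobNorm (restr (IsShift S) A) := by
  obtain ⟨j, h0, hpos⟩ := exists_shift_anchored hS
  rw [← sectorNorm_shift hA.1 j S, ← sq_eq_sq₀ (sectorNorm_nonneg _ _) (frobNorm_nonneg _),
    frobNorm_sq_eq_sum (restr_mem hA _ (isShift_shift S)), sectorNorm_sq]
  set S₀ := shift j S with hS₀
  have hanch : ∀ s ∈ sector S₀, s ∈ anchored := fun s hs => by
    rw [mem_sector] at hs
    refine ⟨Finsupp.mem_support_iff.1 (hs ▸ h0), fun i hi => ?_⟩
    by_contra hne
    have := hpos i (hs ▸ Finsupp.mem_support_iff.2 hne)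
    omega
  -- an anchored translate of `S` is `S₀`
  have huniq : ∀ s ∈ anchored, IsShift S s.support → s.support = S₀ := by
    rintro s hs ⟨k, hk⟩
    have hsup : s.support = shift (k - j) S₀ := by
      rw [hk, hS₀, shift_shift, sub_add_cancel]
    have h1 : (0 : ℤ) - (k - j) ∈ S₀ := by
      rw [← mem_shift, ← hsup]
      exact mem_sector_support_anchored hs
    have h2 : k - j ∈ s.support := by
      rw [hsup, mem_shift, sub_self]
      exact h0
    have h3 := hpos _ h1
    have h4 : 0 ≤ k - j := by
      by_contra hneg
      exact Finsupp.mem_support_iff.1 h2 (hs.2 _ (not_le.1 hneg))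
    have h5 : k - j = 0 := by omega
    rw [hsup, h5, shift_zero]
  have hleft : ∑ s ∈ sector S₀, ‖A s‖ ^ 2 =
      ∑ s ∈ (anchoredBox M).filter fun s => s.support = S₀, ‖A s‖ ^ 2 := by
    symm
    refine Finset.sum_subset (fun s hs => mem_sector.2 (Finset.mem_filter.1 hs).2)
      fun s hs hs' => ?_
    by_contra hne
    refine hs' (Finset.mem_filter.2 ⟨mem_anchoredBox_of_ne_zero hA (hanch s hs) fun h => ?_,
      mem_sector.1 hs⟩)
    simp [h] at hne
  rw [hleft, Finset.sum_filter]
  refine Finset.sum_congr rfl fun s hs => ?_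
  rw [restr_apply]
  by_cases hsup : s.support = S₀
  · have hsh : IsShift S s.support := ⟨j, hsup⟩
    rw [if_pos hsup, if_pos hsh]
  · have hsh : ¬IsShift S s.support := fun h => hsup (huniq s (anchored_of_mem_anchoredBox hs) h)
    rw [if_neg hsup, if_neg hsh]
    simp

theorem frobInner_restr_right {A B : Op} (p : Finset ℤ → Prop) [DecidablePred p] :
    frobInner A (restr p B) = frobInner (restr p A) B := by
  refine finsum_congr fun s => finsum_congr fun _ => ?_
  rw [restr_apply, restr_apply]
  split_ifs <;> simp

theorem frobInner_restr_restr {A B : Op} (p : Finset ℤ → Prop) [DecidablePred p] :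
    frobInner (restr p A) (restr p B) = frobInner (restr p A) B := by
  refine finsum_congr fun s => finsum_congr fun _ => ?_
  rw [restr_apply, restr_apply]
  split_ifs <;> simp

theorem frobNorm_restr_le {M : ℕ} {A : Op} (hA : A ∈ 𝒯 M) (p : Finset ℤ → Prop) [DecidablePred p]
    (hp : ∀ j S, p (shift j S) ↔ p S) : frobNorm (restr p A) ≤ frobNorm A := by
  refine abs_le_of_sq_le_sq' ?_ (frobNorm_nonneg _) |>.2
  rw [frobNorm_sq_eq_sum hA, frobNorm_sq_eq_sum (restr_mem hA p hp)]
  refine Finset.sum_le_sum fun s _ => ?_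
  rw [restr_apply]
  split_ifs
  · exact le_rfl
  · simp

/-- A crude converse to `frobNorm_le_opNorm`, with a constant that depends on the range. -/
theorem opNorm_le_frobNorm {M : ℕ} {A : Op} (hA : A ∈ 𝒯 M) :
    opNorm A ≤ ENNReal.ofReal (8 ^ (2 * M + 1) * frobNorm A) := by
  classical
  set F := (Finset.Icc (-(M : ℤ)) M).powerset
  have hcard : (Finset.Icc (-(M : ℤ)) M).card = 2 * M + 1 := by
    rw [Int.card_Icc]; omega
  -- a support that contains the origin lies within distance `M` of it
  have hz : ∀ S ∉ F, (if (0 : ℤ) ∈ S then weight A S else 0) = 0 := by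
    intro S hS
    split_ifs with h0
    · by_contra hw
      have h1 : sectorNorm A S ≠ 0 := fun h0 => hw (by simp [weight, h0])
      obtain ⟨s, hs, hne⟩ := exists_ne_zero_of_sectorNorm_ne_zero h1
      obtain ⟨j, hj⟩ := hA.2.2 s hne
      rw [mem_sector] at hs
      refine hS (Finset.mem_powerset.2 fun i hi => ?_)
      have h2 := hj i (Finsupp.mem_support_iff.1 (hs ▸ hi))
      have h3 := hj 0 (Finsupp.mem_support_iff.1 (hs ▸ h0))
      rw [Finset.mem_Icc]
      omega
    · rfl
  rw [opNorm, tsum_eq_sum hz]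
  calc ∑ S ∈ F, (if (0 : ℤ) ∈ S then weight A S else 0)
      ≤ ∑ S ∈ F, ENNReal.ofReal (4 ^ (2 * M + 1) * frobNorm A) := by
        refine Finset.sum_le_sum fun S hS => ?_
        split_ifs with h0
        · refine ENNReal.ofReal_le_ofReal ?_
          have h1 : S.card ≤ 2 * M + 1 := hcard ▸ Finset.card_le_card (Finset.mem_powerset.1 hS)
          rw [sectorNorm_eq_frobNorm hA ⟨0, h0⟩]
          have := frobNorm_restr_le hA (IsShift S) (isShift_shift S)
          have h2 : (4 : ℝ) ^ S.card ≤ 4 ^ (2 * M + 1) := pow_le_pow_right₀ (by norm_num) h1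
          exact mul_le_mul h2 this (frobNorm_nonneg _) (by positivity)
        · exact zero_le
    _ = _ := by
        rw [Finset.sum_const, Finset.card_powerset, hcard, nsmul_eq_mul]
        have : ((2 ^ (2 * M + 1) : ℕ) : ℝ≥0∞) = ENNReal.ofReal (2 ^ (2 * M + 1)) := by
          rw [ENNReal.ofReal_pow (by norm_num)]; norm_num
        rw [this, ← ENNReal.ofReal_mul (by positivity), ← mul_assoc, ← mul_pow]
        norm_num

/-- Removing the diagonal part does not increase the weighted norm. -/
theorem opNorm_offDiagPart_le {H₀ : Op} (hH : H₀ ∈ 𝒯 1) (hher : IsHermitianOp H₀) {M : ℕ} {A : Op}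
    (hA : A ∈ 𝒯 M) : opNorm (offDiagPart H₀ A) ≤ opNorm A := by
  classical
  obtain ⟨⟨h1, h2, h3⟩, -⟩ := diagPart_adPinv_spec hH hher hA
  set D := diagPart H₀ A
  have hO : offDiagPart H₀ A ∈ 𝒯 M := sub_mem hA h1
  have hAD : A = D + offDiagPart H₀ A := by rw [offDiagPart]; abel
  have := opNorm_mono_of_sectorNorm (A := offDiagPart H₀ A) (B := A) zero_le_one fun S hS => ?_
  · simpa using this
  rw [one_mul, sectorNorm_eq_frobNorm hO hS, sectorNorm_eq_frobNorm hA hS]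
  set p := IsShift S
  have hDp : restr p D ∈ 𝒯 M := restr_mem h1 p (isShift_shift S)
  have hOp : restr p (offDiagPart H₀ A) ∈ 𝒯 M := restr_mem hO p (isShift_shift S)
  have hsum : restr p A = restr p D + restr p (offDiagPart H₀ A) := by
    rw [← map_add, ← hAD]
  have horth : inner ℂ (⟨_, M, hDp⟩ : LocOp) (⟨_, M, hOp⟩ : LocOp) = 0 := by
    change frobInner (restr p D) (restr p (offDiagPart H₀ A)) = 0
    rw [frobInner_restr_restr]
    exact h3 _ ⟨M, hDp⟩ (by rw [ad_restr hH, h2, map_zero])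
  have hpyth := norm_add_sq_eq_norm_sq_add_norm_sq_of_inner_eq_zero _ _ horth
  have hn : frobNorm (restr p A) = ‖(⟨_, M, hDp⟩ : LocOp) + (⟨_, M, hOp⟩ : LocOp)‖ := by
    rw [LocOp.norm_def, hsum]; rfl
  have hn' : frobNorm (restr p (offDiagPart H₀ A)) = ‖(⟨_, M, hOp⟩ : LocOp)‖ := by
    rw [LocOp.norm_def]
  rw [hn, hn']
  refine abs_le_of_sq_le_sq' ?_ (norm_nonneg _) |>.2
  nlinarith [norm_nonneg (⟨_, M, hDp⟩ : LocOp)]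

/-- The spectral gap bounds the pseudoinverse in the weighted norm, sector by sector. -/
theorem opNorm_adPinv_le {H₀ : Op} (hH : H₀ ∈ 𝒯 1) (hher : IsHermitianOp H₀)
    (hpos : 0 < frobNorm H₀) {M : ℕ} {A : Op} (hA : A ∈ 𝒯 M) :
    opNorm (adPinv H₀ (offDiagPart H₀ A)) ≤
      ENNReal.ofReal (2 * frobNorm H₀)⁻¹ * opNorm (offDiagPart H₀ A) := by
  classical
  obtain ⟨⟨h1, -, -⟩, h4, h5, h6⟩ := diagPart_adPinv_spec hH hher hA
  set X := adPinv H₀ (offDiagPart H₀ A)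
  have hO : offDiagPart H₀ A ∈ 𝒯 M := sub_mem hA h1
  refine opNorm_mono_of_sectorNorm (by positivity) fun S hS => ?_
  rw [sectorNorm_eq_frobNorm hO hS, sectorNorm_eq_frobNorm h4 hS, ← h6, ← ad_restr hH,
    ← div_eq_inv_mul, le_div_iff₀' (by positivity)]
  have hXp := restr_mem h4 (IsShift S) (isShift_shift S)
  refine gap_ad hH hher hpos ⟨M, hXp⟩ fun K ⟨N, hK⟩ hK0 => ?_
  rw [frobInner_restr_right]
  exact h5 _ ⟨N, restr_mem hK _ (isShift_shift S)⟩ (by rw [ad_restr hH, hK0, map_zero])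

end SpinChain

namespace SpinChain

open Finset.HasAntidiagonal (antidiagonal mem_antidiagonal)

/-! ### Sums over compositions -/

/-- The compositions of `m`, as lists of positive numbers. -/
def compLists (m : ℕ) : Finset (List ℕ) := Finset.univ.image (Composition.blocks (n := m))

theorem mem_compLists {m : ℕ} {k : List ℕ} :
    k ∈ compLists m ↔ (∀ x ∈ k, 0 < x) ∧ k.sum = m := by
  simp only [compLists, Finset.mem_image, Finset.mem_univ, true_and]
  constructor
  · rintro ⟨c, rfl⟩
    exact ⟨fun x hx => c.blocks_pos hx, c.blocks_sum⟩
  · rintro ⟨h1, h2⟩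
    exact ⟨⟨k, fun hi => h1 _ hi, h2⟩, rfl⟩

/-- Sums over `Composition m` with a condition on the length, as sums over lists. -/
theorem sum_composition {V : Type*} [AddCommMonoid V] {m : ℕ} (p : ℕ → Prop) [DecidablePred p]
    (F : List ℕ → V) :
    ∑ c : Composition m with p c.length, F c.blocks =
      ∑ k ∈ compLists m with p k.length, F k := by
  rw [Finset.sum_filter, Finset.sum_filter, compLists, Finset.sum_image]
  intro c _ c' _ h
  exact Composition.ext h

theorem compLists_zero : compLists 0 = {[]} := by
  ext k
  rw [mem_compLists, Finset.mem_singleton]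
  constructor
  · rintro ⟨h1, h2⟩
    by_contra hne
    obtain ⟨x, hx⟩ := List.exists_mem_of_ne_nil k hne
    have := List.le_sum_of_mem hx
    have := h1 x hx
    omega
  · rintro rfl
    simp

/-- Summing over compositions by their first part. -/
theorem sum_compLists_succ {V : Type*} [AddCommMonoid V] (m : ℕ) (F : List ℕ → V) :
    ∑ k ∈ compLists (m + 1), F k =
      ∑ p ∈ antidiagonal m, ∑ k ∈ compLists p.2, F ((p.1 + 1) :: k) := by
  rw [Finset.sum_sigma']
  refine Finset.sum_bij' (fun k _ => (⟨(k.headI - 1, k.tail.sum), k.tail⟩ : Σ _ : ℕ × ℕ, List ℕ))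
    (fun q _ => (q.1.1 + 1) :: q.2) ?_ ?_ ?_ ?_ ?_
  · intro k hk
    rw [mem_compLists] at hk
    rcases k with _ | ⟨x, k⟩
    · simp at hk
    · simp only [List.mem_cons, forall_eq_or_imp, List.sum_cons] at hk
      simp only [Finset.mem_sigma, mem_antidiagonal, List.headI_cons, List.tail_cons,
        mem_compLists, and_true]
      exact ⟨by omega, hk.1.2⟩
  · rintro ⟨⟨i, j⟩, k⟩ hq
    simp only [Finset.mem_sigma, mem_antidiagonal, mem_compLists] at hq
    rw [mem_compLists]
    simp only [List.mem_cons, forall_eq_or_imp, List.sum_cons]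
    exact ⟨⟨by omega, hq.2.1⟩, by omega⟩
  · intro k hk
    rw [mem_compLists] at hk
    rcases k with _ | ⟨x, k⟩
    · simp at hk
    · have := hk.1 x (by simp)
      simp only [List.headI_cons, List.tail_cons, List.cons.injEq, and_true]
      omega
  · rintro ⟨⟨i, j⟩, k⟩ hq
    simp only [Finset.mem_sigma, mem_antidiagonal, mem_compLists] at hq
    simp [hq.2.2]
  · intro k hk
    rw [mem_compLists] at hk
    rcases k with _ | ⟨x, k⟩
    · simp at hk
    · have := hk.1 x (by simp)
      simp only [List.headI_cons, List.tail_cons]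
      rw [Nat.sub_add_cancel this]

/-- The lists on which `swFactor l` does not vanish. -/
def Admissible (l : ℕ) (k : List ℕ) : Prop := k.Pairwise (· ≤ ·) ∧ ∀ x ∈ k, 1 ≤ x ∧ x ≤ l

theorem swFactor_of_admissible {l : ℕ} {k : List ℕ} (h : Admissible l k) :
    swFactor l k = (∏ i ∈ Finset.Icc 1 l, ((k.count i)! : ℂ))⁻¹ := if_pos h

theorem swFactor_of_not_admissible {l : ℕ} {k : List ℕ} (h : ¬Admissible l k) :
    swFactor l k = 0 := if_neg h

/-- Each weight is `0` or the inverse of a product of factorials. -/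
theorem norm_swFactor_le_one (l : ℕ) (k : List ℕ) : ‖swFactor l k‖ ≤ 1 := by
  by_cases h : Admissible l k
  · rw [swFactor_of_admissible h, norm_inv, norm_prod]
    refine inv_le_one_of_one_le₀ (Finset.one_le_prod fun i _ => ?_)
    rw [Complex.norm_natCast]
    exact_mod_cast Nat.factorial_pos _
  · rw [swFactor_of_not_admissible h, norm_zero]
    exact zero_le_one

theorem swFactor_singleton {l m : ℕ} (h1 : 1 ≤ m) (h2 : m ≤ l) : swFactor l [m] = 1 := by
  rw [swFactor_of_admissible ⟨by simp, by simpa using ⟨h1, h2⟩⟩, Finset.prod_eq_one, inv_one]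
  intro i _
  by_cases h : m = i <;> simp [h]

theorem swFactor_nil (l : ℕ) : swFactor l [] = 1 := by
  rw [swFactor_of_admissible ⟨by simp, by simp⟩]
  simp

theorem Admissible.append_replicate {l : ℕ} {k : List ℕ} (h : Admissible l k) (q : ℕ) :
    Admissible (l + 1) (k ++ List.replicate q (l + 1)) := by
  refine ⟨List.pairwise_append.2 ⟨h.1, List.pairwise_replicate.2 (Or.inr le_rfl), ?_⟩, ?_⟩
  · intro a ha b hb
    rw [List.eq_of_mem_replicate hb]
    exact (h.2 a ha).2.trans (Nat.le_succ l)
  · intro x hx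
    rcases List.mem_append.1 hx with hx | hx
    · exact ⟨(h.2 x hx).1, (h.2 x hx).2.trans (Nat.le_succ l)⟩
    · rw [List.eq_of_mem_replicate hx]
      exact ⟨by omega, le_rfl⟩

theorem Admissible.count_succ {l : ℕ} {k : List ℕ} (h : Admissible l k) : k.count (l + 1) = 0 :=
  List.count_eq_zero.2 fun hx => by have := (h.2 _ hx).2; omega

theorem Admissible.filter {l : ℕ} {k : List ℕ} (h : Admissible (l + 1) k) :
    Admissible l (k.filter (· ≤ l)) := by
  refine ⟨h.1.filter _, fun x hx => ?_⟩
  rw [List.mem_filter] at hx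
  exact ⟨(h.2 x hx.1).1, by simpa using hx.2⟩

/-- An admissible list ends with the copies of its largest possible entry. -/
theorem Admissible.eq_append {l : ℕ} {k : List ℕ} (h : Admissible (l + 1) k) :
    k.filter (· ≤ l) ++ List.replicate (k.count (l + 1)) (l + 1) = k := by
  induction k with
  | nil => simp
  | cons x k ih =>
    have hk : Admissible (l + 1) k :=
      ⟨(List.pairwise_cons.1 h.1).2, fun y hy => h.2 y (List.mem_cons_of_mem _ hy)⟩
    by_cases hx : x ≤ l
    · have hne : x ≠ l + 1 := by omega
      simp only [List.filter_cons, decide_eq_true_eq, hx, if_true, List.count_cons_of_ne hne,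
        List.cons_append, ih hk]
    · have hx1 : x = l + 1 := by have := (h.2 x (by simp)).2; omega
      have hall : ∀ y ∈ k, y = l + 1 := fun y hy => by
        have h1 := (List.pairwise_cons.1 h.1).1 y hy
        have h2 := (h.2 y (List.mem_cons_of_mem _ hy)).2
        omega
      have hrep : k = List.replicate k.length (l + 1) := List.eq_replicate_iff.2 ⟨rfl, hall⟩
      have hfil : k.filter (· ≤ l) = [] := by
        rw [List.filter_eq_nil_iff]
        intro y hy
        rw [hall y hy]
        simp
      simp only [List.filter_cons, decide_eq_true_eq, hx, if_false, hfil, List.nil_append]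
      rw [hx1, List.count_cons_self, hrep]
      simp [List.replicate_succ]

theorem Admissible.filter_append_replicate {l : ℕ} {k : List ℕ} (h : Admissible l k) (q : ℕ) :
    (k ++ List.replicate q (l + 1)).filter (· ≤ l) = k := by
  rw [List.filter_append, List.filter_eq_self.2 fun x hx => by simpa using (h.2 x hx).2]
  simp

theorem Admissible.swFactor_append {l : ℕ} {k : List ℕ} (h : Admissible l k) (q : ℕ) :
    swFactor (l + 1) (k ++ List.replicate q (l + 1)) = ((q ! : ℕ) : ℂ)⁻¹ * swFactor l k := by
  rw [swFactor_of_admissible h, swFactor_of_admissible (h.append_replicate q),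
    Finset.prod_Icc_succ_top (by omega), mul_inv, mul_comm]
  congr 2
  · rw [List.count_append, h.count_succ]
    simp
  · refine Finset.prod_congr rfl fun i hi => ?_
    have h0 : (List.replicate q (l + 1)).count i = 0 := by
      refine List.count_eq_zero.2 fun hx => ?_
      have := List.eq_of_mem_replicate hx
      rw [Finset.mem_Icc] at hi
      omega
    rw [List.count_append, h0, add_zero]

/-- The weights `swFactor` are the coefficients of a product of exponentials: the part of size
`l + 1` enters through the exponential series. -/
theorem sum_swFactor_succ {V : Type*} [AddCommGroup V] [Module ℂ V] (l m : ℕ) (F : List ℕ → V) :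
    ∑ k ∈ compLists m, swFactor (l + 1) k • F k =
      ∑ p ∈ antidiagonal m, if l + 1 ∣ p.1 then
        (((p.1 / (l + 1))! : ℕ) : ℂ)⁻¹ • ∑ k ∈ compLists p.2,
          swFactor l k • F (k ++ List.replicate (p.1 / (l + 1)) (l + 1)) else 0 := by
  classical
  have h1 : ∑ k ∈ compLists m, swFactor (l + 1) k • F k =
      ∑ k ∈ (compLists m).filter (Admissible (l + 1)), swFactor (l + 1) k • F k := by
    refine (Finset.sum_filter_of_ne fun k _ hk => ?_).symm
    by_contra hna
    exact hk (by rw [swFactor_of_not_admissible hna, zero_smul])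
  have h2 : ∀ j (f : List ℕ → V), ∑ k ∈ compLists j, swFactor l k • f k =
      ∑ k ∈ (compLists j).filter (Admissible l), swFactor l k • f k := by
    intro j f
    refine (Finset.sum_filter_of_ne fun k _ hk => ?_).symm
    by_contra hna
    exact hk (by rw [swFactor_of_not_admissible hna, zero_smul])
  have hsum : ∀ k, Admissible (l + 1) k →
      (l + 1) * k.count (l + 1) + (k.filter (· ≤ l)).sum = k.sum := fun k hk => by
    conv_rhs => rw [← hk.eq_append]
    rw [List.sum_append, List.sum_replicate, smul_eq_mul]
    ring
  rw [h1, ← Finset.sum_fiberwise_of_maps_to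
    (g := fun k => ((l + 1) * k.count (l + 1), (k.filter (· ≤ l)).sum))
    (t := antidiagonal m)]
  · refine Finset.sum_congr rfl fun p hp => ?_
    split_ifs with hdvd
    · obtain ⟨q, hq⟩ := hdvd
      have hdiv : p.1 / (l + 1) = q := by rw [hq]; exact Nat.mul_div_cancel_left q (by omega)
      rw [hdiv, h2, Finset.smul_sum]
      symm
      refine Finset.sum_bij' (fun k _ => k ++ List.replicate q (l + 1))
        (fun k _ => k.filter (· ≤ l)) ?_ ?_ ?_ ?_ ?_
      · intro k hk
        rw [Finset.mem_filter, mem_compLists] at hk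
        have had := hk.2.append_replicate q
        rw [mem_antidiagonal] at hp
        rw [Finset.mem_filter, Finset.mem_filter, mem_compLists]
        refine ⟨⟨⟨fun x hx => (had.2 x hx).1, ?_⟩, had⟩, ?_⟩
        · rw [List.sum_append, hk.1.2, List.sum_replicate, smul_eq_mul, ← hp, hq]
          ring
        · rw [hk.2.filter_append_replicate, List.count_append, hk.2.count_succ, hk.1.2,
            List.count_replicate_self, zero_add, ← hq]
      · intro k hk
        rw [Finset.mem_filter, Finset.mem_filter, mem_compLists] at hk
        rw [Finset.mem_filter, mem_compLists]
        exact ⟨⟨fun x hx => (hk.1.2.filter.2 x hx).1, by rw [← hk.2]⟩, hk.1.2.filter⟩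
      · intro k hk
        exact (Finset.mem_filter.1 hk).2.filter_append_replicate q
      · intro k hk
        rw [Finset.mem_filter, Finset.mem_filter] at hk
        have hcount : k.count (l + 1) = q := by
          have := congrArg Prod.fst hk.2
          simp only at this
          rw [hq] at this
          exact Nat.eq_of_mul_eq_mul_left (by omega) this
        have := hk.1.2.eq_append
        rwa [hcount] at this
      · intro k hk
        rw [(Finset.mem_filter.1 hk).2.swFactor_append, mul_smul]
    · refine Finset.sum_eq_zero fun k hk => ?_
      rw [Finset.mem_filter] at hk
      exact absurd ⟨_, (congrArg Prod.fst hk.2).symm⟩ hdvd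
  · intro k hk
    rw [Finset.mem_filter, mem_compLists] at hk
    rw [mem_antidiagonal, ← hk.1.2]
    exact hsum k hk.2

theorem sum_swFactor_zero {V : Type*} [AddCommGroup V] [Module ℂ V] (m : ℕ) (F : List ℕ → V) :
    ∑ k ∈ compLists m, swFactor 0 k • F k = if m = 0 then F [] else 0 := by
  split_ifs with h
  · rw [h, compLists_zero, Finset.sum_singleton, swFactor_nil, one_smul]
  · refine Finset.sum_eq_zero fun k hk => ?_
    rw [swFactor_of_not_admissible, zero_smul]
    intro hna
    rw [mem_compLists] at hk
    have : k = [] := List.eq_nil_iff_forall_not_mem.2 fun x hx => by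
      have := hna.2 x hx
      omega
    exact h (by rw [← hk.2, this, List.sum_nil])

/-! ### Products of exponentials as power series -/

open PowerSeries

theorem foldl_replicate_mul {R : Type*} [Ring R] (a : ℕ → R) (q i : ℕ) (P : R) :
    (List.replicate q i).foldl (fun P i => a i * P) P = a i ^ q * P := by
  induction q generalizing P with
  | zero => simp
  | succ q ih => rw [List.replicate_succ, List.foldl_cons, ih, pow_succ, mul_assoc]

theorem inv_factorial_mul_choose {i j q : ℕ} (h : i + j = q) :
    ((q ! : ℕ) : ℂ)⁻¹ * (q.choose i : ℕ) = ((i ! : ℕ) : ℂ)⁻¹ * ((j ! : ℕ) : ℂ)⁻¹ := by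
  have hc := Nat.choose_mul_factorial_mul_factorial (show i ≤ q by omega)
  rw [show q - i = j by omega] at hc
  have h0 : ((q ! : ℕ) : ℂ) ≠ 0 := by exact_mod_cast Nat.factorial_ne_zero q
  have h1 : ((i ! : ℕ) : ℂ) ≠ 0 := by exact_mod_cast Nat.factorial_ne_zero _
  have h2 : ((j ! : ℕ) : ℂ) ≠ 0 := by exact_mod_cast Nat.factorial_ne_zero _
  field_simp
  rw [← hc]
  push_cast
  ring

section Exponential

variable {R : Type*} [Ring R] [Algebra ℂ R]

/-- The divided power `x ^ q / q!`. -/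
def divPow (x : R) (q : ℕ) : R := ((q ! : ℕ) : ℂ)⁻¹ • x ^ q

/-- The power series `exp (X ^ k x)`. -/
def expSeries (k : ℕ) (x : R) : R⟦X⟧ :=
  PowerSeries.mk fun m => if k ∣ m then divPow x (m / k) else 0

theorem divPow_mul_divPow_neg (x : R) (q : ℕ) :
    ∑ p ∈ antidiagonal q, divPow x p.1 * divPow (-x) p.2 = if q = 0 then 1 else 0 := by
  have h := (Commute.neg_right (Commute.refl x)).add_pow' q
  rw [add_neg_cancel] at h
  have h2 : ∑ p ∈ antidiagonal q, divPow x p.1 * divPow (-x) p.2 =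
      ((q ! : ℕ) : ℂ)⁻¹ • (0 : R) ^ q := by
    rw [h, Finset.smul_sum]
    refine Finset.sum_congr rfl fun p hp => ?_
    rw [mem_antidiagonal] at hp
    rw [divPow, divPow, smul_mul_smul_comm, ← Nat.cast_smul_eq_nsmul ℂ, smul_smul]
    congr 1
    exact (inv_factorial_mul_choose hp).symm
  rw [h2]
  split_ifs with h0
  · simp [h0]
  · rw [zero_pow h0, smul_zero]

/-- An antidiagonal sum supported on multiples of `k` is an antidiagonal sum over the quotients. -/
theorem sum_antidiagonal_dvd {V : Type*} [AddCommMonoid V] {k : ℕ} (hk : 0 < k) (i : ℕ)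
    (F : ℕ → ℕ → V) :
    ∑ p ∈ antidiagonal i, (if k ∣ p.1 ∧ k ∣ p.2 then F (p.1 / k) (p.2 / k) else 0) =
      if k ∣ i then ∑ p ∈ antidiagonal (i / k), F p.1 p.2 else 0 := by
  rw [← Finset.sum_filter]
  split_ifs with h
  · obtain ⟨q, rfl⟩ := h
    rw [Nat.mul_div_cancel_left q hk]
    refine Finset.sum_bij' (fun p _ => (p.1 / k, p.2 / k)) (fun p _ => (k * p.1, k * p.2))
      ?_ ?_ ?_ ?_ ?_
    · rintro ⟨a, b⟩ hp
      simp only [Finset.mem_filter, mem_antidiagonal] at hp ⊢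
      obtain ⟨h1, ⟨a, rfl⟩, ⟨b, rfl⟩⟩ := hp
      rw [Nat.mul_div_cancel_left _ hk, Nat.mul_div_cancel_left _ hk]
      rw [← mul_add] at h1
      exact Nat.eq_of_mul_eq_mul_left hk h1
    · rintro ⟨a, b⟩ hp
      simp only [Finset.mem_filter, mem_antidiagonal] at hp ⊢
      exact ⟨by rw [← mul_add, hp], dvd_mul_right _ _, dvd_mul_right _ _⟩
    · rintro ⟨a, b⟩ hp
      simp only [Finset.mem_filter] at hp
      simp only [Nat.mul_div_cancel' hp.2.1, Nat.mul_div_cancel' hp.2.2]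
    · rintro ⟨a, b⟩ _
      simp only [Nat.mul_div_cancel_left _ hk]
    · intro p _
      rfl
  · refine Finset.sum_eq_zero fun p hp => ?_
    rw [Finset.mem_filter, mem_antidiagonal] at hp
    exact absurd (hp.1 ▸ dvd_add hp.2.1 hp.2.2) h

theorem expSeries_mul_expSeries_neg {k : ℕ} (hk : 0 < k) (x : R) :
    expSeries k x * expSeries k (-x) = 1 := by
  ext m
  rw [coeff_mul, coeff_one]
  have : ∀ p : ℕ × ℕ, coeff p.1 (expSeries k x) * coeff p.2 (expSeries k (-x)) =
      if k ∣ p.1 ∧ k ∣ p.2 then divPow x (p.1 / k) * divPow (-x) (p.2 / k) else 0 := by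
    intro p
    rw [expSeries, expSeries, coeff_mk, coeff_mk]
    split_ifs <;> simp_all
  rw [Finset.sum_congr rfl fun p _ => this p,
    sum_antidiagonal_dvd hk m fun i j => divPow x i * divPow (-x) j, divPow_mul_divPow_neg]
  by_cases h : k ∣ m
  · obtain ⟨q, rfl⟩ := h
    rw [if_pos (dvd_mul_right _ _), Nat.mul_div_cancel_left _ hk]
    simp [hk.ne']
  · rw [if_neg h, if_neg]
    rintro rfl
    exact h (dvd_zero k)

/-- The product `exp (X^l a_l) ⋯ exp (X a_1)`, with coefficients written as the construction has
them: along a list, the first entry acts first. -/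
def fwdSeries (a : ℕ → R) (l : ℕ) : R⟦X⟧ :=
  PowerSeries.mk fun m => ∑ k ∈ compLists m, swFactor l k • k.foldl (fun P i => a i * P) 1

/-- The product `exp (X a_1) ⋯ exp (X^l a_l)` in the opposite order, with coefficients written as in
the quasi-conserved operator: along a list, the last entry acts first. -/
def bwdSeries (a : ℕ → R) (l : ℕ) : R⟦X⟧ :=
  PowerSeries.mk fun m => ∑ k ∈ compLists m, swFactor l k • (k.map a).prod

theorem fwdSeries_zero (a : ℕ → R) : fwdSeries a 0 = 1 := by
  ext m
  rw [fwdSeries, coeff_mk, sum_swFactor_zero, coeff_one]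
  rfl

theorem bwdSeries_zero (a : ℕ → R) : bwdSeries a 0 = 1 := by
  ext m
  rw [bwdSeries, coeff_mk, sum_swFactor_zero, coeff_one]
  rfl

theorem fwdSeries_succ (a : ℕ → R) (l : ℕ) :
    fwdSeries a (l + 1) = expSeries (l + 1) (a (l + 1)) * fwdSeries a l := by
  ext m
  rw [coeff_mul, fwdSeries, coeff_mk, sum_swFactor_succ]
  refine Finset.sum_congr rfl fun p _ => ?_
  rw [expSeries, coeff_mk, fwdSeries, coeff_mk]
  split_ifs
  · rw [divPow, Finset.mul_sum, Finset.smul_sum]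
    refine Finset.sum_congr rfl fun k _ => ?_
    rw [List.foldl_append, foldl_replicate_mul, smul_mul_smul_comm, smul_smul]
  · rw [zero_mul]

theorem bwdSeries_succ (a : ℕ → R) (l : ℕ) :
    bwdSeries a (l + 1) = bwdSeries a l * expSeries (l + 1) (a (l + 1)) := by
  ext m
  rw [coeff_mul, bwdSeries, coeff_mk, sum_swFactor_succ, ← Finset.Nat.sum_antidiagonal_swap]
  refine Finset.sum_congr rfl fun p _ => ?_
  rw [expSeries, coeff_mk, bwdSeries, coeff_mk, Prod.fst_swap, Prod.snd_swap]
  split_ifs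
  · rw [divPow, Finset.sum_mul, Finset.smul_sum]
    refine Finset.sum_congr rfl fun k _ => ?_
    rw [List.map_append, List.prod_append, List.map_replicate, List.prod_replicate,
      smul_mul_smul_comm, smul_smul, mul_comm]
  · rw [mul_zero]

end Exponential

/-! ### Dressing a conserved quantity -/

section Dressing

variable {L : Type*} [LieRing L] [LieAlgebra ℂ L]

/-- The series of the adjoint representations of a sequence in a Lie algebra. -/
def adSeries (Y : ℕ → L) : (Module.End ℂ L)⟦X⟧ := PowerSeries.mk fun m => LieAlgebra.ad ℂ L (Y m)

/-- A series of endomorphisms acting on a sequence by convolution. -/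
def actSeq (P : (Module.End ℂ L)⟦X⟧) (Y : ℕ → L) (m : ℕ) : L :=
  ∑ p ∈ antidiagonal m, coeff p.1 P (Y p.2)

/-- The Leibniz rule for divided powers of a derivation. -/
theorem divPow_ad_mul_ad (g y : L) (q : ℕ) :
    divPow (LieAlgebra.ad ℂ L g) q * LieAlgebra.ad ℂ L y =
      ∑ p ∈ antidiagonal q, LieAlgebra.ad ℂ L (divPow (LieAlgebra.ad ℂ L g) p.1 y) *
        divPow (LieAlgebra.ad ℂ L g) p.2 := by
  ext z
  simp only [divPow, Module.End.mul_apply, LinearMap.smul_apply, LieAlgebra.ad_apply,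
    LinearMap.sum_apply, LieAlgebra.ad_pow_lie, Finset.smul_sum, smul_lie, lie_smul]
  refine Finset.sum_congr rfl fun p hp => ?_
  rw [mem_antidiagonal] at hp
  rw [← Nat.cast_smul_eq_nsmul ℂ, smul_smul, smul_smul]
  congr 1
  rw [inv_factorial_mul_choose hp, mul_comm]

theorem coeff_expSeries_mul_ad {k : ℕ} (hk : 0 < k) (g y : L) (i : ℕ) :
    coeff i (expSeries k (LieAlgebra.ad ℂ L g)) * LieAlgebra.ad ℂ L y =
      ∑ p ∈ antidiagonal i,
        LieAlgebra.ad ℂ L (coeff p.1 (expSeries k (LieAlgebra.ad ℂ L g)) y) *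
          coeff p.2 (expSeries k (LieAlgebra.ad ℂ L g)) := by
  set a := LieAlgebra.ad ℂ L g
  have : ∀ p : ℕ × ℕ, LieAlgebra.ad ℂ L (coeff p.1 (expSeries k a) y) * coeff p.2 (expSeries k a) =
      if k ∣ p.1 ∧ k ∣ p.2 then
        LieAlgebra.ad ℂ L (divPow a (p.1 / k) y) * divPow a (p.2 / k) else 0 := by
    intro p
    rw [expSeries, coeff_mk, coeff_mk]
    split_ifs <;> simp_all
  rw [Finset.sum_congr rfl fun p _ => this p,
    sum_antidiagonal_dvd hk i fun i j => LieAlgebra.ad ℂ L (divPow a i y) * divPow a j,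
    expSeries, coeff_mk]
  split_ifs
  · exact divPow_ad_mul_ad g y _
  · rw [zero_mul]

/-- The exponential of an inner derivation is an automorphism. -/
theorem expSeries_mul_adSeries {k : ℕ} (hk : 0 < k) (g : L) (Y : ℕ → L) :
    expSeries k (LieAlgebra.ad ℂ L g) * adSeries Y =
      adSeries (actSeq (expSeries k (LieAlgebra.ad ℂ L g)) Y) *
        expSeries k (LieAlgebra.ad ℂ L g) := by
  ext1 m
  set E := expSeries k (LieAlgebra.ad ℂ L g) with hE
  simp only [coeff_mul, adSeries, coeff_mk, actSeq, map_sum, Finset.sum_mul]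
  rw [Finset.sum_congr rfl fun p _ => coeff_expSeries_mul_ad hk g (Y p.2) p.1, ← hE,
    Finset.sum_sigma', Finset.sum_sigma']
  refine Finset.sum_bij' (fun x _ => ⟨(x.2.1 + x.1.2, x.2.2), (x.2.1, x.1.2)⟩)
    (fun x _ => ⟨(x.2.1 + x.1.2, x.2.2), (x.2.1, x.1.2)⟩) ?_ ?_ ?_ ?_ ?_
  · rintro ⟨⟨i, j⟩, ⟨p, q⟩⟩ h
    simp only [Finset.mem_sigma, mem_antidiagonal, and_true] at h ⊢
    omega
  · rintro ⟨⟨i, j⟩, ⟨p, q⟩⟩ h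
    simp only [Finset.mem_sigma, mem_antidiagonal, and_true] at h ⊢
    omega
  · rintro ⟨⟨i, j⟩, ⟨p, q⟩⟩ h
    simp only [Finset.mem_sigma, mem_antidiagonal] at h
    simp [h.2]
  · rintro ⟨⟨i, j⟩, ⟨p, q⟩⟩ h
    simp only [Finset.mem_sigma, mem_antidiagonal] at h
    simp [h.2]
  · rintro ⟨⟨i, j⟩, ⟨p, q⟩⟩ _
    rfl

theorem adSeries_mul_expSeries_neg {k : ℕ} (hk : 0 < k) (g : L) (Y : ℕ → L) :
    adSeries Y * expSeries k (-LieAlgebra.ad ℂ L g) =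
      expSeries k (-LieAlgebra.ad ℂ L g) *
        adSeries (actSeq (expSeries k (LieAlgebra.ad ℂ L g)) Y) := by
  set a := LieAlgebra.ad ℂ L g with ha
  have h1 : expSeries k (-a) * expSeries k a = 1 := by
    have := expSeries_mul_expSeries_neg hk (-a)
    rwa [neg_neg] at this
  calc adSeries Y * expSeries k (-a)
      = expSeries k (-a) * (expSeries k a * adSeries Y) * expSeries k (-a) := by
        rw [← mul_assoc (expSeries k (-a)), h1, one_mul]
    _ = expSeries k (-a) * adSeries (actSeq (expSeries k a) Y) *
        (expSeries k a * expSeries k (-a)) := by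
        rw [expSeries_mul_adSeries hk g Y]
        simp only [mul_assoc, ← ha]
    _ = _ := by rw [expSeries_mul_expSeries_neg hk a, mul_one]

/-- Conjugation by the product of exponentials `W`: `ad x W⁻¹ = W⁻¹ ad (W x)`. -/
theorem C_ad_mul_bwdSeries (G : ℕ → L) (x : L) (l : ℕ) :
    C (LieAlgebra.ad ℂ L x) * bwdSeries (fun i => -LieAlgebra.ad ℂ L (G i)) l =
      bwdSeries (fun i => -LieAlgebra.ad ℂ L (G i)) l *
        adSeries fun m => coeff m (fwdSeries (fun i => LieAlgebra.ad ℂ L (G i)) l) x := by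
  induction l with
  | zero =>
    rw [bwdSeries_zero, fwdSeries_zero, mul_one, one_mul]
    ext1 m
    rw [adSeries, coeff_mk, coeff_C, coeff_one]
    split_ifs <;> simp
  | succ l ih =>
    rw [bwdSeries_succ, ← mul_assoc, ih, mul_assoc, adSeries_mul_expSeries_neg (by omega),
      ← mul_assoc, fwdSeries_succ]
    congr 2
    ext1 m
    rw [actSeq, coeff_mul, LinearMap.sum_apply]
    rfl

/-- If the dressed Hamiltonian `W (h₀ + X t)` commutes with `h₀` up to order `n`, then `h₀ + X t`
commutes with `W⁻¹ h₀` up to order `n`. -/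
theorem lie_bwdSeries_eq_zero (G : ℕ → L) (h₀ t : L) (l n : ℕ)
    (hW : ∀ m, 1 ≤ m → m ≤ n →
      ⁅coeff m (fwdSeries (fun i => LieAlgebra.ad ℂ L (G i)) l) h₀ +
        coeff (m - 1) (fwdSeries (fun i => LieAlgebra.ad ℂ L (G i)) l) t, h₀⁆ = 0)
    {m : ℕ} (h1 : 1 ≤ m) (h2 : m ≤ n) :
    ⁅h₀, coeff m (bwdSeries (fun i => -LieAlgebra.ad ℂ L (G i)) l) h₀⁆ +
      ⁅t, coeff (m - 1) (bwdSeries (fun i => -LieAlgebra.ad ℂ L (G i)) l) h₀⁆ = 0 := by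
  set B := bwdSeries (fun i => -LieAlgebra.ad ℂ L (G i)) l with hB
  set W := fwdSeries (fun i => LieAlgebra.ad ℂ L (G i)) l with hW'
  have hcoef : ∀ (x : L) (j : ℕ), ⁅x, coeff j B h₀⁆ =
      ∑ p ∈ antidiagonal j, coeff p.1 B ⁅coeff p.2 W x, h₀⁆ := by
    intro x j
    have h := congrArg (coeff j) (C_ad_mul_bwdSeries G x l)
    rw [coeff_C_mul, coeff_mul, ← hB, ← hW'] at h
    have h' := LinearMap.congr_fun h h₀
    rw [LinearMap.sum_apply] at h'
    simpa [adSeries] using h'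
  have hW0 : coeff 0 W = 1 := by
    rw [hW', fwdSeries, coeff_mk, compLists_zero, Finset.sum_singleton, swFactor_nil, one_smul]
    rfl
  obtain ⟨j, rfl⟩ : ∃ j, m = j + 1 := ⟨m - 1, by omega⟩
  rw [hcoef, hcoef, Nat.add_sub_cancel, Finset.Nat.sum_antidiagonal_succ']
  simp only [hW0, Module.End.one_apply, lie_self, map_zero, zero_add]
  rw [← Finset.sum_add_distrib]
  refine Finset.sum_eq_zero fun p hp => ?_
  rw [mem_antidiagonal] at hp
  have := hW (p.2 + 1) (by omega) (by omega)
  rw [Nat.add_sub_cancel] at this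
  rw [← map_add, ← add_lie, this, map_zero]

end Dressing

end SpinChain

namespace SpinChain

open Finset.HasAntidiagonal (antidiagonal mem_antidiagonal)

/-! ### Majorants -/

/-- The truncation of a product of series with nonnegative terms is at most the product of the
truncations. -/
theorem sum_range_antidiagonal_le (f g : ℕ → ℝ) (hf : ∀ i, 0 ≤ f i) (hg : ∀ i, 0 ≤ g i) (M : ℕ) :
    ∑ m ∈ Finset.range M, ∑ p ∈ antidiagonal m, f p.1 * g p.2 ≤
      (∑ i ∈ Finset.range M, f i) * ∑ j ∈ Finset.range M, g j := by
  rw [Finset.sum_mul_sum, ← Finset.sum_product', Finset.sum_sigma']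
  rw [← Finset.sum_image (s := (Finset.range M).sigma fun m => antidiagonal m)
    (f := fun p : ℕ × ℕ => f p.1 * g p.2) (g := fun x => x.2)]
  · refine Finset.sum_le_sum_of_subset_of_nonneg ?_ fun p _ _ => mul_nonneg (hf _) (hg _)
    intro p hp
    obtain ⟨⟨m, q⟩, hx, rfl⟩ := Finset.mem_image.1 hp
    rw [Finset.mem_sigma, mem_antidiagonal, Finset.mem_range] at hx
    simp only at hx ⊢
    rw [Finset.mem_product, Finset.mem_range, Finset.mem_range]
    omega
  · rintro ⟨m, p⟩ hx ⟨m', p'⟩ hx' h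
    simp only [Finset.coe_sigma, Set.mem_sigma_iff, Finset.mem_coe, mem_antidiagonal] at hx hx' h
    subst h
    simp only [Sigma.mk.injEq, heq_eq_eq, and_true]
    omega

/-- A quadratic recursion of Catalan type, solved with a majorant: at `x = 1 / (8 b)` the partial
sums of the generating functions of `u` and `c` stay below `1 / 4` and `1 / 3`. -/
theorem le_pow_of_quadratic_recursion {u c : ℕ → ℝ} {b : ℝ} {N : ℕ} (hb : 0 < b)
    (hu : ∀ i, 0 ≤ u i) (hc : ∀ i, 0 ≤ c i) (hu0 : u 0 ≤ b) (hc0 : c 0 = u 0)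
    (hcs : ∀ m, c (m + 1) = u (m + 1) + ∑ p ∈ antidiagonal m, u p.1 * c p.2)
    (hus : ∀ m, m + 1 < N → u (m + 1) ≤ ∑ p ∈ antidiagonal m, u p.1 * c p.2 + b * c m)
    {m : ℕ} (hm : m < N) : c m ≤ (8 * b) ^ (m + 1) := by
  set x : ℝ := (8 * b)⁻¹ with hx
  have hx0 : 0 < x := by positivity
  have hbx : b * x = 1 / 8 := by rw [hx]; field_simp
  have key : ∀ M, M ≤ N → ∑ i ∈ Finset.range M, u i * x ^ (i + 1) ≤ 1 / 4 ∧
      ∑ i ∈ Finset.range M, c i * x ^ (i + 1) ≤ 1 / 3 := by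
    intro M
    induction M with
    | zero => intro _; norm_num
    | succ M ih =>
      intro hM
      obtain ⟨h1, h2⟩ := ih (by omega)
      set SU := ∑ i ∈ Finset.range M, u i * x ^ (i + 1)
      set SC := ∑ i ∈ Finset.range M, c i * x ^ (i + 1)
      have hSU : 0 ≤ SU := Finset.sum_nonneg fun i _ => mul_nonneg (hu i) (by positivity)
      have hSC : 0 ≤ SC := Finset.sum_nonneg fun i _ => mul_nonneg (hc i) (by positivity)
      set Q := ∑ m ∈ Finset.range M, ∑ p ∈ antidiagonal m,
        (u p.1 * x ^ (p.1 + 1)) * (c p.2 * x ^ (p.2 + 1)) with hQ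
      have hQle : Q ≤ 1 / 12 := by
        have h3 := sum_range_antidiagonal_le (fun i => u i * x ^ (i + 1))
          (fun i => c i * x ^ (i + 1)) (fun i => mul_nonneg (hu i) (by positivity))
          (fun i => mul_nonneg (hc i) (by positivity)) M
        calc Q ≤ SU * SC := h3
          _ ≤ 1 / 4 * (1 / 3) := mul_le_mul h1 h2 hSC (by norm_num)
          _ = 1 / 12 := by norm_num
      have hQm : ∀ m, (∑ p ∈ antidiagonal m, u p.1 * c p.2) * x ^ (m + 1 + 1) =
          ∑ p ∈ antidiagonal m, (u p.1 * x ^ (p.1 + 1)) * (c p.2 * x ^ (p.2 + 1)) := by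
        intro m
        rw [Finset.sum_mul]
        refine Finset.sum_congr rfl fun p hp => ?_
        rw [mem_antidiagonal] at hp
        rw [← hp]
        ring
      have hU : ∑ i ∈ Finset.range (M + 1), u i * x ^ (i + 1) ≤ 1 / 4 := by
        rw [Finset.sum_range_succ']
        have hstep : ∑ i ∈ Finset.range M, u (i + 1) * x ^ (i + 1 + 1) ≤ Q + 1 / 8 * SC := by
          rw [hQ, Finset.mul_sum, ← Finset.sum_add_distrib]
          refine Finset.sum_le_sum fun i hi => ?_
          rw [Finset.mem_range] at hi
          rw [← hQm, ← hbx]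
          calc u (i + 1) * x ^ (i + 1 + 1)
              ≤ (∑ p ∈ antidiagonal i, u p.1 * c p.2 + b * c i) * x ^ (i + 1 + 1) := by
                gcongr
                exact hus i (by omega)
            _ = _ := by ring
        have h0 : u 0 * x ^ (0 + 1) ≤ 1 / 8 := by
          rw [← hbx, zero_add, pow_one]
          gcongr
        linarith
      refine ⟨hU, ?_⟩
      have hC : ∑ i ∈ Finset.range (M + 1), c i * x ^ (i + 1) =
          ∑ i ∈ Finset.range (M + 1), u i * x ^ (i + 1) + Q := by
        rw [Finset.sum_range_succ', Finset.sum_range_succ' (fun i => u i * x ^ (i + 1)), hc0, hQ]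
        have : ∀ i, c (i + 1) * x ^ (i + 1 + 1) = u (i + 1) * x ^ (i + 1 + 1) +
            ∑ p ∈ antidiagonal i, (u p.1 * x ^ (p.1 + 1)) * (c p.2 * x ^ (p.2 + 1)) := by
          intro i
          rw [← hQm, hcs]
          ring
        rw [Finset.sum_congr rfl fun i _ => this i, Finset.sum_add_distrib]
        ring
      rw [hC]
      linarith
  have h1 : c m * x ^ (m + 1) ≤ 1 := by
    have h2 := (key N le_rfl).2
    have h3 := Finset.single_le_sum (f := fun i => c i * x ^ (i + 1))
      (fun i _ => mul_nonneg (hc i) (by positivity)) (Finset.mem_range.2 hm)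
    linarith
  rw [hx, inv_pow, ← div_eq_mul_inv, div_le_one (by positivity)] at h1
  exact h1

/-- The sum over compositions of the products of the values at the parts. -/
def compSum (u : ℕ → ℝ) (m : ℕ) : ℝ := ∑ k ∈ compLists m, (k.map u).prod

theorem compSum_nonneg {u : ℕ → ℝ} (hu : ∀ i, 0 ≤ u i) (m : ℕ) : 0 ≤ compSum u m :=
  Finset.sum_nonneg fun k _ => List.prod_nonneg fun x hx => by
    obtain ⟨i, -, rfl⟩ := List.mem_map.1 hx
    exact hu i

/-- The sum over the compositions with at least two parts. -/
theorem sum_two_le_length (u : ℕ → ℝ) (m : ℕ) :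
    ∑ k ∈ compLists (m + 2) with 2 ≤ k.length, (k.map u).prod =
      ∑ p ∈ antidiagonal m, u (p.1 + 1) * compSum u (p.2 + 1) := by
  rw [Finset.sum_filter, sum_compLists_succ, Finset.Nat.sum_antidiagonal_succ']
  have h0 : ∑ k ∈ compLists 0, (if 2 ≤ ((m + 1 + 1) :: k).length then
      (((m + 1 + 1) :: k).map u).prod else 0) = 0 := by
    rw [compLists_zero, Finset.sum_singleton, List.length_singleton, if_neg (by norm_num)]
  rw [h0, zero_add]
  refine Finset.sum_congr rfl fun p _ => ?_
  rw [compSum, Finset.mul_sum]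
  refine Finset.sum_congr rfl fun k hk => ?_
  have hne : k ≠ [] := by
    rintro rfl
    rw [mem_compLists] at hk
    simp at hk
  have : 1 ≤ k.length := List.length_pos_iff.2 hne
  rw [if_pos (by rw [List.length_cons]; omega), List.map_cons, List.prod_cons]

theorem compSum_succ_succ (u : ℕ → ℝ) (m : ℕ) :
    compSum u (m + 2) = u (m + 2) +
      ∑ p ∈ antidiagonal m, u (p.1 + 1) * compSum u (p.2 + 1) := by
  rw [compSum, sum_compLists_succ, Finset.Nat.sum_antidiagonal_succ', compLists_zero,
    Finset.sum_singleton]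
  simp only [List.map_cons, List.prod_cons, List.map_nil, List.prod_nil, mul_one]
  congr 1
  exact Finset.sum_congr rfl fun p _ => by rw [compSum, Finset.mul_sum]

theorem compSum_one (u : ℕ → ℝ) : compSum u 1 = u 1 := by
  rw [compSum, sum_compLists_succ]
  simp [compLists_zero]

/-! ### The weighted norm as a real number -/

/-- The weighted norm of a local operator as a real number; it is finite by `opNorm_ne_top`. -/
def opNormR (A : Op) : ℝ := (opNorm A).toReal

theorem opNorm_ne_top {A : Op} (hA : IsLocal A) : opNorm A ≠ ⊤ := by
  obtain ⟨M, hM⟩ := hA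
  exact ne_top_of_le_ne_top ENNReal.ofReal_ne_top (opNorm_le_frobNorm hM)

theorem opNormR_nonneg (A : Op) : 0 ≤ opNormR A := ENNReal.toReal_nonneg

theorem opNormR_neg (A : Op) : opNormR (-A) = opNormR A := by rw [opNormR, opNorm_neg, opNormR]

theorem opNormR_add_le {A B : Op} (hA : IsLocal A) (hB : IsLocal B) :
    opNormR (A + B) ≤ opNormR A + opNormR B := by
  rw [opNormR, opNormR, opNormR, ← ENNReal.toReal_add (opNorm_ne_top hA) (opNorm_ne_top hB)]
  exact ENNReal.toReal_mono (ENNReal.add_ne_top.2 ⟨opNorm_ne_top hA, opNorm_ne_top hB⟩)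
    (opNorm_add_le A B)

theorem opNormR_sum_le {ι : Type*} (F : Finset ι) (A : ι → Op) (hA : ∀ i ∈ F, IsLocal (A i)) :
    opNormR (∑ i ∈ F, A i) ≤ ∑ i ∈ F, opNormR (A i) := by
  have hfin : ∀ i ∈ F, opNorm (A i) ≠ ⊤ := fun i hi => opNorm_ne_top (hA i hi)
  simp only [opNormR]
  rw [← ENNReal.toReal_sum hfin]
  exact ENNReal.toReal_mono (ENNReal.sum_ne_top.2 hfin) (opNorm_sum_le F A)

theorem opNormR_smul_le (c : ℂ) {A : Op} (hA : IsLocal A) :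
    opNormR (c • A) ≤ ‖c‖ * opNormR A := by
  have := ENNReal.toReal_mono (ENNReal.mul_ne_top ENNReal.ofReal_ne_top (opNorm_ne_top hA))
    (opNorm_smul_le c A)
  rwa [ENNReal.toReal_mul, ENNReal.toReal_ofReal (norm_nonneg c)] at this

theorem opNormR_ad_le {a b : ℕ} {A B : Op} (hA : A ∈ 𝒯 a) (hB : B ∈ 𝒯 b) :
    opNormR (ad A B) ≤ 2 * (a + b) * (opNormR A * opNormR B) := by
  have hA' := opNorm_ne_top ⟨a, hA⟩
  have hB' := opNorm_ne_top ⟨b, hB⟩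
  have h1 : (2 * ((a : ENNReal) + b) * (opNorm A * opNorm B)) ≠ ⊤ := by
    have : (2 * ((a : ENNReal) + b)) = ((2 * (a + b) : ℕ) : ENNReal) := by push_cast; ring
    rw [this]
    exact ENNReal.mul_ne_top (ENNReal.natCast_ne_top _) (ENNReal.mul_ne_top hA' hB')
  have := ENNReal.toReal_mono h1 (opNorm_ad_le hA hB)
  have h2 : (2 * ((a : ENNReal) + b)) = ((2 * (a + b) : ℕ) : ENNReal) := by push_cast; ring
  rw [h2, ENNReal.toReal_mul, ENNReal.toReal_mul, ENNReal.toReal_natCast] at this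
  push_cast at this
  exact this

theorem frobNorm_le_opNormR {A : Op} (hA : IsLocal A) : frobNorm A ≤ opNormR A := by
  have := ENNReal.toReal_mono (opNorm_ne_top hA) (frobNorm_le_opNorm hA)
  rwa [ENNReal.toReal_ofReal (frobNorm_nonneg A)] at this

theorem opNormR_le_frobNorm {M : ℕ} {A : Op} (hA : A ∈ 𝒯 M) :
    opNormR A ≤ 8 ^ (2 * M + 1) * frobNorm A := by
  have := ENNReal.toReal_mono ENNReal.ofReal_ne_top (opNorm_le_frobNorm hA)
  rwa [ENNReal.toReal_ofReal (mul_nonneg (by positivity) (frobNorm_nonneg A))] at this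

/-! ### Nested commutators -/

theorem foldl_ad_mem {G : ℕ → Op} {a : ℕ} {A : Op} (hA : A ∈ 𝒯 a) (k : List ℕ)
    (hG : ∀ x ∈ k, G x ∈ 𝒯 (x + 1)) :
    k.foldl (fun X l => ad (G l) X) A ∈ 𝒯 (a + k.sum) := by
  induction k generalizing a A with
  | nil => simpa using hA
  | cons x k ih =>
    rw [List.foldl_cons, List.sum_cons, ← add_assoc]
    exact ih (ad_mem (hG x (by simp)) hA (by omega)) fun y hy => hG y (List.mem_cons_of_mem _ hy)

theorem foldr_ad_mem {G : ℕ → Op} {a : ℕ} {A : Op} (hA : A ∈ 𝒯 a) (k : List ℕ)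
    (hG : ∀ x ∈ k, G x ∈ 𝒯 (x + 1)) :
    k.foldr (fun l X => ad (G l) X) A ∈ 𝒯 (a + k.sum) := by
  induction k with
  | nil => simpa using hA
  | cons x k ih =>
    rw [List.foldr_cons, List.sum_cons]
    exact ad_mem (hG x (by simp)) (ih fun y hy => hG y (List.mem_cons_of_mem _ hy)) (by omega)

/-- In every commutator of the nest the two ranges add up to at most `r`, so each step costs at most
`2 r` times the norm of the generator. -/
theorem opNormR_foldl_ad_le {G : ℕ → Op} {a r : ℕ} {A : Op} (hA : A ∈ 𝒯 a) (k : List ℕ)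
    (hG : ∀ x ∈ k, G x ∈ 𝒯 (x + 1)) (hr : a + k.sum + 1 ≤ r) :
    opNormR (k.foldl (fun X l => ad (G l) X) A) ≤
      opNormR A * (k.map fun x => 2 * r * opNormR (G x)).prod := by
  induction k generalizing a A with
  | nil => simp
  | cons x k ih =>
    rw [List.sum_cons] at hr
    have hx := hG x (by simp)
    rw [List.foldl_cons, List.map_cons, List.prod_cons]
    refine (ih (a := a + x) (ad_mem hx hA (by omega))
      (fun y hy => hG y (List.mem_cons_of_mem _ hy)) (by omega)).trans ?_
    rw [← mul_assoc]
    refine mul_le_mul_of_nonneg_right ?_ (List.prod_nonneg fun y hy => ?_)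
    · refine (opNormR_ad_le hx hA).trans ?_
      have h1 : (((x + 1 : ℕ) : ℝ) + a) ≤ r := by exact_mod_cast (by omega : x + 1 + a ≤ r)
      have h2 := mul_nonneg (opNormR_nonneg (G x)) (opNormR_nonneg A)
      calc _ ≤ 2 * (r : ℝ) * (opNormR (G x) * opNormR A) := by gcongr
        _ = _ := by ring
    · obtain ⟨z, -, rfl⟩ := List.mem_map.1 hy
      exact mul_nonneg (by positivity) (opNormR_nonneg _)

theorem opNormR_foldr_ad_le {G : ℕ → Op} {a r : ℕ} {A : Op} (hA : A ∈ 𝒯 a) (k : List ℕ)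
    (hG : ∀ x ∈ k, G x ∈ 𝒯 (x + 1)) (hr : a + k.sum + 1 ≤ r) :
    opNormR (k.foldr (fun l X => ad (G l) X) A) ≤
      opNormR A * (k.map fun x => 2 * r * opNormR (G x)).prod := by
  induction k with
  | nil => simp
  | cons x k ih =>
    rw [List.sum_cons] at hr
    have hx := hG x (by simp)
    have hk : ∀ y ∈ k, G y ∈ 𝒯 (y + 1) := fun y hy => hG y (List.mem_cons_of_mem _ hy)
    have h0 := ih hk (by omega)
    rw [List.foldr_cons, List.map_cons, List.prod_cons]
    refine (opNormR_ad_le hx (foldr_ad_mem hA k hk)).trans ?_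
    have h1 : (((x + 1 : ℕ) : ℝ) + (a + k.sum : ℕ)) ≤ r := by
      exact_mod_cast (by omega : x + 1 + (a + k.sum) ≤ r)
    have h2 := opNormR_nonneg (G x)
    have h3 := opNormR_nonneg (k.foldr (fun l X => ad (G l) X) A)
    calc _ ≤ 2 * (r : ℝ) * (opNormR (G x) * opNormR (k.foldr (fun l X => ad (G l) X) A)) := by
          gcongr
      _ ≤ 2 * (r : ℝ) * (opNormR (G x) *
          (opNormR A * (k.map fun x => 2 * r * opNormR (G x)).prod)) := by gcongr
      _ = _ := by ring

/-! ### The generators -/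

/-- The potential `V_m` of the Schrieffer-Wolff construction. -/
def swPot (n : ℕ) (H₀ T : Op) (m : ℕ) : Op := potentialOf n H₀ T (swGen n H₀ T) m

theorem lt_of_mem_compLists {m x : ℕ} {k : List ℕ} (hk : k ∈ compLists m) (h2 : 2 ≤ k.length)
    (hx : x ∈ k) : x < m := by
  rw [mem_compLists] at hk
  obtain ⟨s, t, rfl⟩ := List.append_of_mem hx
  have hne : s ++ t ≠ [] := by
    intro h
    rw [List.append_eq_nil_iff] at h
    simp [h.1, h.2] at h2
  obtain ⟨y, hy⟩ := List.exists_mem_of_ne_nil _ hne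
  have hy0 : 0 < y := hk.1 y (by
    simp only [List.mem_append, List.mem_cons] at hy ⊢
    tauto)
  have hy1 := List.le_sum_of_mem hy
  rw [List.sum_append] at hy1
  have := hk.2
  rw [List.sum_append, List.sum_cons] at this
  omega

theorem le_of_mem_compLists {m x : ℕ} {k : List ℕ} (hk : k ∈ compLists m) (hx : x ∈ k) : x ≤ m :=
  (mem_compLists.1 hk).2 ▸ List.le_sum_of_mem hx

theorem potentialOf_eq (n : ℕ) (H₀ T : Op) (G : ℕ → Op) {m : ℕ} (hm : m ≠ 1) :
    potentialOf n H₀ T G m =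
      ∑ k ∈ compLists m with 2 ≤ k.length,
        swFactor n k • k.foldl (fun X l => ad (G l) X) H₀ +
      ∑ k ∈ compLists (m - 1) with 1 ≤ k.length,
        swFactor n k • k.foldl (fun X l => ad (G l) X) T := by
  rw [potentialOf, if_neg hm, ← sum_composition (2 ≤ ·), ← sum_composition (1 ≤ ·)]

/-- The recursive definition sets the generators of order at least `m` to zero in the potential of
order `m`; none of them occurs there. -/
theorem swGen_eq (n : ℕ) (H₀ T : Op) (m : ℕ) :
    swGen n H₀ T m = adPinv H₀ (offDiagPart H₀ (swPot n H₀ T m)) := by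
  rw [swGen, swPot]
  congr 2
  by_cases hm : m = 1
  · rw [potentialOf, potentialOf, if_pos hm, if_pos hm]
  rw [potentialOf_eq n H₀ T _ hm, potentialOf_eq n H₀ T _ hm]
  congr 1
  · refine Finset.sum_congr rfl fun k hk => ?_
    rw [Finset.mem_filter] at hk
    congr 1
    refine List.foldl_ext _ _ _ fun X x hx => ?_
    rw [dif_pos (lt_of_mem_compLists hk.1 hk.2 hx)]
  · refine Finset.sum_congr rfl fun k hk => ?_
    rw [Finset.mem_filter] at hk
    congr 1
    refine List.foldl_ext _ _ _ fun X x hx => ?_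
    have h1 := le_of_mem_compLists hk.1 hx
    have h2 := (mem_compLists.1 hk.1).1 x hx
    rw [dif_pos (by omega)]

theorem swPot_one (n : ℕ) (H₀ T : Op) : swPot n H₀ T 1 = T := by rw [swPot, potentialOf, if_pos rfl]

theorem swPot_swGen_mem {H₀ T : Op} (hH : H₀ ∈ 𝒯 1) (hher : IsHermitianOp H₀) (hT : T ∈ 𝒯 2)
    (n m : ℕ) : swPot n H₀ T m ∈ 𝒯 (m + 1) ∧ swGen n H₀ T m ∈ 𝒯 (m + 1) := by
  induction m using Nat.strong_induction_on with
  | _ m ih =>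
    have hV : swPot n H₀ T m ∈ 𝒯 (m + 1) := by
      by_cases hm : m = 1
      · subst hm
        rw [swPot_one]
        exact hT
      rw [swPot, potentialOf_eq n H₀ T _ hm]
      refine add_mem (sum_mem fun k hk => ?_) (sum_mem fun k hk => ?_)
      · rw [Finset.mem_filter] at hk
        refine Submodule.smul_mem _ _ ?_
        have := foldl_ad_mem hH k (G := swGen n H₀ T)
          fun x hx => (ih x (lt_of_mem_compLists hk.1 hk.2 hx)).2
        rwa [(mem_compLists.1 hk.1).2, add_comm] at this
      · rw [Finset.mem_filter] at hk
        refine Submodule.smul_mem _ _ ?_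
        have hk' := mem_compLists.1 hk.1
        have hpos : 0 < m := by
          by_contra h0
          have h0 : m = 0 := by omega
          subst h0
          have h1 := hk.1
          simp only [zero_tsub, compLists_zero, Finset.mem_singleton] at h1
          rw [h1] at hk
          simp at hk
        have := foldl_ad_mem hT k (G := swGen n H₀ T) fun x hx => (ih x (by
          have h1 := le_of_mem_compLists hk.1 hx
          omega)).2
        rwa [hk'.2, show 2 + (m - 1) = m + 1 by omega] at this
    refine ⟨hV, ?_⟩
    rw [swGen_eq]
    exact (diagPart_adPinv_spec hH hher hV).2.1

theorem swPot_mem {H₀ T : Op} (hH : H₀ ∈ 𝒯 1) (hher : IsHermitianOp H₀) (hT : T ∈ 𝒯 2)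
    (n m : ℕ) : swPot n H₀ T m ∈ 𝒯 (m + 1) := (swPot_swGen_mem hH hher hT n m).1

theorem swGen_mem {H₀ T : Op} (hH : H₀ ∈ 𝒯 1) (hher : IsHermitianOp H₀) (hT : T ∈ 𝒯 2)
    (n m : ℕ) : swGen n H₀ T m ∈ 𝒯 (m + 1) := (swPot_swGen_mem hH hher hT n m).2

/-- The defining property of the generators: they remove the off-diagonal part of the potential. -/
theorem ad_swGen {H₀ T : Op} (hH : H₀ ∈ 𝒯 1) (hher : IsHermitianOp H₀) (hT : T ∈ 𝒯 2) (n m : ℕ) :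
    ad (swGen n H₀ T m) H₀ = -offDiagPart H₀ (swPot n H₀ T m) := by
  rw [ad_swap, swGen_eq, (diagPart_adPinv_spec hH hher (swPot_mem hH hher hT n m)).2.2.2]

theorem offDiagPart_mem {H₀ : Op} (hH : H₀ ∈ 𝒯 1) (hher : IsHermitianOp H₀) {M : ℕ} {A : Op}
    (hA : A ∈ 𝒯 M) : offDiagPart H₀ A ∈ 𝒯 M := sub_mem hA (diagPart_adPinv_spec hH hher hA).1.1

theorem opNormR_swGen_le {H₀ T : Op} (hH : H₀ ∈ 𝒯 1) (hher : IsHermitianOp H₀) (hT : T ∈ 𝒯 2)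
    (hpos : 0 < frobNorm H₀) (n m : ℕ) :
    opNormR (swGen n H₀ T m) ≤
      (2 * frobNorm H₀)⁻¹ * opNormR (offDiagPart H₀ (swPot n H₀ T m)) := by
  have hV := swPot_mem hH hher hT n m
  have := ENNReal.toReal_mono (ENNReal.mul_ne_top ENNReal.ofReal_ne_top
    (opNorm_ne_top ⟨_, offDiagPart_mem hH hher hV⟩)) (opNorm_adPinv_le hH hher hpos hV)
  rw [ENNReal.toReal_mul, ENNReal.toReal_ofReal (by positivity), ← swGen_eq] at this
  exact this

theorem opNormR_offDiagPart_le {H₀ : Op} (hH : H₀ ∈ 𝒯 1) (hher : IsHermitianOp H₀) {M : ℕ} {A : Op}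
    (hA : A ∈ 𝒯 M) : opNormR (offDiagPart H₀ A) ≤ opNormR A :=
  ENNReal.toReal_mono (opNorm_ne_top ⟨M, hA⟩) (opNorm_offDiagPart_le hH hher hA)

/-! ### Growth of the perturbation series -/

section Growth

variable {H₀ T : Op} (hH : H₀ ∈ 𝒯 1) (hher : IsHermitianOp H₀) (hT : T ∈ 𝒯 2) {Γ : ℝ} (hΓ : 0 < Γ)
  (hH₀ : frobNorm H₀ = Γ) (hTΓ : frobNorm T = Γ)

/-- The norm of the off-diagonal potential at order `m`, rescaled by the cost `2 r` of a commutator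
over the gap `2 Γ`, so that it bounds the norm of the commutator with the generator. -/
def rescaled (n : ℕ) (H₀ T : Op) (r : ℕ) (m : ℕ) : ℝ :=
  r / frobNorm H₀ * opNormR (offDiagPart H₀ (swPot n H₀ T m))

theorem rescaled_nonneg (n : ℕ) (H₀ T : Op) (r m : ℕ) : 0 ≤ rescaled n H₀ T r m :=
  mul_nonneg (div_nonneg (Nat.cast_nonneg r) (frobNorm_nonneg _)) (opNormR_nonneg _)

theorem prod_rescaled_nonneg (n : ℕ) (H₀ T : Op) (r : ℕ) (k : List ℕ) :
    0 ≤ (k.map (rescaled n H₀ T r)).prod :=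
  List.prod_nonneg fun x hx => by
    obtain ⟨i, -, rfl⟩ := List.mem_map.1 hx
    exact rescaled_nonneg n H₀ T r i

include hH hher hT hΓ hH₀

theorem prod_opNormR_swGen_le (n r : ℕ) (k : List ℕ) :
    (k.map fun x => 2 * r * opNormR (swGen n H₀ T x)).prod ≤ (k.map (rescaled n H₀ T r)).prod := by
  refine List.prod_map_le_prod_map₀ _ _
    (fun x _ => mul_nonneg (by positivity) (opNormR_nonneg _)) fun x _ => ?_
  have h := opNormR_swGen_le hH hher hT (hH₀ ▸ hΓ) n x
  calc 2 * r * opNormR (swGen n H₀ T x)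
      ≤ 2 * r * ((2 * frobNorm H₀)⁻¹ * opNormR (offDiagPart H₀ (swPot n H₀ T x))) := by gcongr
    _ = _ := by rw [rescaled, hH₀]; field_simp

/-- Nested commutators on `H₀`: the innermost one is, up to sign, the off-diagonal part of a
potential, so that each entry of the list contributes one rescaled factor. -/
theorem opNormR_foldl_H₀_le (n : ℕ) {r m : ℕ} (hr : m + 2 ≤ r) {k : List ℕ} (hk : k ∈ compLists m)
    (hne : k ≠ []) :
    r / Γ * opNormR (k.foldl (fun X l => ad (swGen n H₀ T l) X) H₀) ≤
      (k.map (rescaled n H₀ T r)).prod := by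
  rcases k with _ | ⟨x, k⟩
  · exact absurd rfl hne
  have hsum := (mem_compLists.1 hk).2
  rw [List.sum_cons] at hsum
  have hmem : ad (swGen n H₀ T x) H₀ ∈ 𝒯 (x + 1) :=
    ad_mem (swGen_mem hH hher hT n x) hH (by omega)
  have h1 := opNormR_foldl_ad_le hmem k (G := swGen n H₀ T) (r := r)
    (fun y _ => swGen_mem hH hher hT n y) (by omega)
  rw [List.foldl_cons, List.map_cons, List.prod_cons, rescaled, hH₀, mul_assoc]
  refine mul_le_mul_of_nonneg_left (h1.trans ?_) (by positivity)
  rw [ad_swGen hH hher hT, opNormR_neg]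
  exact mul_le_mul_of_nonneg_left (prod_opNormR_swGen_le hH hher hT hΓ hH₀ n r k)
    (opNormR_nonneg _)

theorem opNormR_foldr_H₀_le (n : ℕ) {r m : ℕ} (hr : m + 2 ≤ r) {k : List ℕ} (hk : k ∈ compLists m)
    (hne : k ≠ []) :
    r / Γ * opNormR (k.foldr (fun l X => ad (swGen n H₀ T l) X) H₀) ≤
      (k.map (rescaled n H₀ T r)).prod := by
  obtain ⟨k, x, rfl⟩ := List.eq_nil_or_concat' k |>.resolve_left hne
  have hsum := (mem_compLists.1 hk).2
  rw [List.sum_append, List.sum_singleton] at hsum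
  have hmem : ad (swGen n H₀ T x) H₀ ∈ 𝒯 (x + 1) :=
    ad_mem (swGen_mem hH hher hT n x) hH (by omega)
  have h1 := opNormR_foldr_ad_le hmem k (G := swGen n H₀ T) (r := r)
    (fun y _ => swGen_mem hH hher hT n y) (by omega)
  rw [List.foldr_append, List.foldr_cons, List.foldr_nil, List.map_append, List.prod_append,
    List.map_singleton, List.prod_singleton, mul_comm (List.prod _), rescaled, hH₀, mul_assoc]
  refine mul_le_mul_of_nonneg_left (h1.trans ?_) (by positivity)
  rw [ad_swGen hH hher hT, opNormR_neg]
  exact mul_le_mul_of_nonneg_left (prod_opNormR_swGen_le hH hher hT hΓ hH₀ n r k)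
    (opNormR_nonneg _)

include hTΓ

theorem opNormR_foldl_T_le (n : ℕ) {r m : ℕ} (hr : m + 3 ≤ r) {k : List ℕ} (hk : k ∈ compLists m) :
    r / Γ * opNormR (k.foldl (fun X l => ad (swGen n H₀ T l) X) T) ≤
      r * 8 ^ 5 * (k.map (rescaled n H₀ T r)).prod := by
  have hsum := (mem_compLists.1 hk).2
  have h1 := opNormR_foldl_ad_le hT k (G := swGen n H₀ T) (r := r)
    (fun y _ => swGen_mem hH hher hT n y) (by omega)
  have h2 := opNormR_le_frobNorm hT
  rw [hTΓ] at h2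
  have h3 := prod_opNormR_swGen_le hH hher hT hΓ hH₀ n r k
  have h4 := prod_rescaled_nonneg n H₀ T r k
  have h5 := opNormR_nonneg T
  calc r / Γ * opNormR (k.foldl (fun X l => ad (swGen n H₀ T l) X) T)
      ≤ r / Γ * (opNormR T * (k.map (rescaled n H₀ T r)).prod) := by
        refine mul_le_mul_of_nonneg_left (h1.trans ?_) (by positivity)
        exact mul_le_mul_of_nonneg_left h3 h5
    _ ≤ r / Γ * ((8 ^ (2 * 2 + 1) * Γ) * (k.map (rescaled n H₀ T r)).prod) := by gcongr
    _ = _ := by field_simp; ring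

theorem rescaled_one_le (n r : ℕ) : rescaled n H₀ T r 1 ≤ r * 8 ^ 5 := by
  have h1 := opNormR_offDiagPart_le hH hher hT
  have h2 := opNormR_le_frobNorm hT
  rw [hTΓ] at h2
  rw [rescaled, swPot_one, hH₀]
  calc r / Γ * opNormR (offDiagPart H₀ T) ≤ r / Γ * (8 ^ (2 * 2 + 1) * Γ) := by
        gcongr
        exact h1.trans h2
    _ = _ := by field_simp

/-- The potential at order `m + 2`, bounded by the lower orders with absolute values. -/
theorem rescaled_succ_le (n : ℕ) {r m : ℕ} (hr : m + 4 ≤ r) :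
    rescaled n H₀ T r (m + 2) ≤
      ∑ p ∈ antidiagonal m, rescaled n H₀ T r (p.1 + 1) * compSum (rescaled n H₀ T r) (p.2 + 1) +
        r * 8 ^ 5 * compSum (rescaled n H₀ T r) (m + 1) := by
  set u := rescaled n H₀ T r with hu
  set G := swGen n H₀ T with hG
  have hGm : ∀ x, G x ∈ 𝒯 (x + 1) := fun x => swGen_mem hH hher hT n x
  have hsf : ∀ (k : List ℕ) (A : Op), IsLocal A → opNormR (swFactor n k • A) ≤ opNormR A := by
    intro k A hA
    refine (opNormR_smul_le _ hA).trans ?_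
    exact mul_le_of_le_one_left (opNormR_nonneg A) (norm_swFactor_le_one n k)
  have hl1 : ∀ k : List ℕ, IsLocal (k.foldl (fun X l => ad (G l) X) H₀) := fun k =>
    ⟨_, foldl_ad_mem hH k fun x _ => hGm x⟩
  have hl2 : ∀ k : List ℕ, IsLocal (k.foldl (fun X l => ad (G l) X) T) := fun k =>
    ⟨_, foldl_ad_mem hT k fun x _ => hGm x⟩
  have hs : ∀ (c : ℂ) (A : Op), IsLocal A → IsLocal (c • A) := fun c A hA => LocOp.smul_mem c hA
  have hV : opNormR (swPot n H₀ T (m + 2)) ≤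
      ∑ k ∈ compLists (m + 2) with 2 ≤ k.length, opNormR (k.foldl (fun X l => ad (G l) X) H₀) +
      ∑ k ∈ compLists (m + 1) with 1 ≤ k.length, opNormR (k.foldl (fun X l => ad (G l) X) T) := by
    rw [swPot, potentialOf_eq n H₀ T _ (by omega : m + 2 ≠ 1), show m + 2 - 1 = m + 1 by omega]
    refine (opNormR_add_le ?_ ?_).trans (add_le_add ?_ ?_)
    · exact LocOp.sum_mem fun k _ => hs _ _ (hl1 k)
    · exact LocOp.sum_mem fun k _ => hs _ _ (hl2 k)
    · refine (opNormR_sum_le _ _ fun k _ => hs _ _ (hl1 k)).trans ?_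
      exact Finset.sum_le_sum fun k _ => hsf k _ (hl1 k)
    · refine (opNormR_sum_le _ _ fun k _ => hs _ _ (hl2 k)).trans ?_
      exact Finset.sum_le_sum fun k _ => hsf k _ (hl2 k)
  have hoff := opNormR_offDiagPart_le hH hher (swPot_mem hH hher hT n (m + 2))
  rw [hu, rescaled, hH₀, ← hu]
  calc r / Γ * opNormR (offDiagPart H₀ (swPot n H₀ T (m + 2)))
      ≤ r / Γ * (∑ k ∈ compLists (m + 2) with 2 ≤ k.length,
          opNormR (k.foldl (fun X l => ad (G l) X) H₀) +
        ∑ k ∈ compLists (m + 1) with 1 ≤ k.length,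
          opNormR (k.foldl (fun X l => ad (G l) X) T)) := by
        gcongr
        exact hoff.trans hV
    _ ≤ ∑ k ∈ compLists (m + 2) with 2 ≤ k.length, (k.map u).prod +
        ∑ k ∈ compLists (m + 1) with 1 ≤ k.length, r * 8 ^ 5 * (k.map u).prod := by
        rw [mul_add, Finset.mul_sum, Finset.mul_sum]
        refine add_le_add (Finset.sum_le_sum fun k hk => ?_) (Finset.sum_le_sum fun k hk => ?_)
        · rw [Finset.mem_filter] at hk
          refine opNormR_foldl_H₀_le hH hher hT hΓ hH₀ n (by omega) hk.1 ?_
          rintro rfl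
          simp at hk
        · rw [Finset.mem_filter] at hk
          exact opNormR_foldl_T_le hH hher hT hΓ hH₀ hTΓ n (by omega) hk.1
    _ ≤ _ := by
        rw [sum_two_le_length, compSum, Finset.mul_sum]
        refine add_le_add_right ?_ _
        refine Finset.sum_le_sum_of_subset_of_nonneg (Finset.filter_subset _ _) fun k _ _ => ?_
        exact mul_nonneg (by positivity) (prod_rescaled_nonneg n H₀ T r k)

/-- The order-`m` term of the quasi-conserved operator grows at most like `(C m) ^ m`: at fixed
range the rescaled potentials obey a recursion of Catalan type with step proportional to the
range. -/
theorem opNormR_swI_le (n : ℕ) {m : ℕ} (hm : 1 ≤ m) :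
    opNormR (swI n H₀ T m) ≤ Γ * (8 ^ 6 * (m + 2)) ^ m := by
  -- no range up to order `m` exceeds this, so it may serve as the cost of every commutator
  set r := m + 2 with hr
  set u := rescaled n H₀ T r with hu
  set G := swGen n H₀ T with hG
  have hGm : ∀ x, G x ∈ 𝒯 (x + 1) := fun x => swGen_mem hH hher hT n x
  have hr0 : (0 : ℝ) < r := by rw [hr]; positivity
  have hl : ∀ k : List ℕ, IsLocal (k.foldr (fun l X => ad (G l) X) H₀) := fun k =>
    ⟨_, foldr_ad_mem hH k fun x _ => hGm x⟩
  have hs : ∀ (c : ℂ) (A : Op), IsLocal A → IsLocal (c • A) := fun c A hA => LocOp.smul_mem c hA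
  have h1 : r / Γ * opNormR (swI n H₀ T m) ≤ compSum u m := by
    have e : swI n H₀ T m = ∑ k ∈ compLists m with 1 ≤ k.length,
        ((-1) ^ k.length * swFactor n k) • k.foldr (fun l X => ad (G l) X) H₀ :=
      sum_composition (1 ≤ ·) fun k => ((-1) ^ k.length * swFactor n k) •
        k.foldr (fun l X => ad (G l) X) H₀
    calc r / Γ * opNormR (swI n H₀ T m)
        ≤ r / Γ * ∑ k ∈ compLists m with 1 ≤ k.length,
          opNormR (k.foldr (fun l X => ad (G l) X) H₀) := by
          gcongr
          rw [e]
          refine (opNormR_sum_le _ _ fun k _ => hs _ _ (hl k)).trans ?_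
          refine Finset.sum_le_sum fun k _ => (opNormR_smul_le _ (hl k)).trans ?_
          refine mul_le_of_le_one_left (opNormR_nonneg _) ?_
          rw [norm_mul, norm_pow, norm_neg, norm_one, one_pow, one_mul]
          exact norm_swFactor_le_one n k
      _ ≤ ∑ k ∈ compLists m with 1 ≤ k.length, (k.map u).prod := by
          rw [Finset.mul_sum]
          refine Finset.sum_le_sum fun k hk => ?_
          rw [Finset.mem_filter] at hk
          refine opNormR_foldr_H₀_le hH hher hT hΓ hH₀ n hr.ge hk.1 ?_
          rintro rfl
          simp at hk
      _ ≤ _ := Finset.sum_le_sum_of_subset_of_nonneg (Finset.filter_subset _ _) fun k _ _ =>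
          prod_rescaled_nonneg n H₀ T r k
  have h2 : compSum u m ≤ (8 * (r * 8 ^ 5)) ^ m := by
    obtain ⟨j, rfl⟩ : ∃ j, m = j + 1 := ⟨m - 1, by omega⟩
    refine le_pow_of_quadratic_recursion (u := fun i => u (i + 1)) (c := fun i => compSum u (i + 1))
      (N := j + 1) (by positivity) (fun i => rescaled_nonneg n H₀ T r _)
      (fun i => compSum_nonneg (rescaled_nonneg n H₀ T r) _)
      (rescaled_one_le hH hher hT hΓ hH₀ hTΓ n r) (compSum_one u) (fun i => compSum_succ_succ u i)
      (fun i hi => rescaled_succ_le hH hher hT hΓ hH₀ hTΓ n (by omega)) (by omega)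
  have h3 : (8 * ((r : ℝ) * 8 ^ 5)) ^ m = (8 ^ 6 * (m + 2)) ^ m := by
    rw [hr]; push_cast; ring
  rw [← h3]
  have h4 : (1 : ℝ) ≤ r := by exact_mod_cast (by omega : 1 ≤ r)
  have h5 := h1.trans h2
  rw [div_mul_eq_mul_div, div_le_iff₀ hΓ] at h5
  calc opNormR (swI n H₀ T m) ≤ r * opNormR (swI n H₀ T m) :=
        le_mul_of_one_le_left (opNormR_nonneg _) h4
    _ ≤ _ := by rw [mul_comm Γ]; exact h5

end Growth

/-! ### The quasi-conserved operator -/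

open PowerSeries (coeff coeff_mk)

theorem coe_foldl_ad (G : ℕ → LocOp) (A : LocOp) (k : List ℕ) (P : Module.End ℂ LocOp) :
    ((k.foldl (fun P i => LieAlgebra.ad ℂ LocOp (G i) * P) P A : LocOp) : Op) =
      k.foldl (fun X l => ad (G l) X) (P A : LocOp) := by
  induction k generalizing P with
  | nil => rfl
  | cons x k ih =>
    rw [List.foldl_cons, List.foldl_cons, ih]
    rfl

/-- The signs `(-1) ^ p` of the quasi-conserved operator come from inverting the exponentials. -/
theorem coe_prod_neg_ad (G : ℕ → LocOp) (A : LocOp) (k : List ℕ) :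
    (((k.map fun i => -LieAlgebra.ad ℂ LocOp (G i)).prod A : LocOp) : Op) =
      (-1 : ℂ) ^ k.length • k.foldr (fun l X => ad (G l) X) (A : Op) := by
  induction k with
  | nil => simp
  | cons x k ih =>
    rw [List.map_cons, List.prod_cons, List.foldr_cons, List.length_cons, Module.End.mul_apply,
      LinearMap.neg_apply, LieAlgebra.ad_apply, Submodule.coe_neg, LocOp.coe_bracket, ih,
      ad_smul_right, pow_succ, mul_neg_one, neg_smul]

theorem coe_coeff_fwdSeries (G : ℕ → LocOp) (A : LocOp) (n m : ℕ) :
    ((coeff m (fwdSeries (fun i => LieAlgebra.ad ℂ LocOp (G i)) n) A : LocOp) : Op) =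
      ∑ k ∈ compLists m, swFactor n k • k.foldl (fun X l => ad (G l) X) (A : Op) := by
  rw [fwdSeries, coeff_mk, LinearMap.sum_apply, AddSubmonoidClass.coe_finsetSum]
  refine Finset.sum_congr rfl fun k _ => ?_
  rw [LinearMap.smul_apply, Submodule.coe_smul, coe_foldl_ad, Module.End.one_apply]

theorem coe_coeff_bwdSeries (G : ℕ → LocOp) (A : LocOp) (n m : ℕ) :
    ((coeff m (bwdSeries (fun i => -LieAlgebra.ad ℂ LocOp (G i)) n) A : LocOp) : Op) =
      ∑ k ∈ compLists m, ((-1) ^ k.length * swFactor n k) •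
        k.foldr (fun l X => ad (G l) X) (A : Op) := by
  rw [bwdSeries, coeff_mk, LinearMap.sum_apply, AddSubmonoidClass.coe_finsetSum]
  refine Finset.sum_congr rfl fun k _ => ?_
  rw [LinearMap.smul_apply, Submodule.coe_smul, coe_prod_neg_ad, smul_smul, mul_comm]

theorem length_pos_of_mem_compLists {m : ℕ} (hm : 1 ≤ m) {k : List ℕ} (hk : k ∈ compLists m) :
    1 ≤ k.length := by
  refine List.length_pos_iff.2 ?_
  rintro rfl
  have := (mem_compLists.1 hk).2
  simp at this
  omega

theorem sum_compLists_eq {V : Type*} [AddCommMonoid V] {m : ℕ} (hm : 1 ≤ m) (F : List ℕ → V) :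
    ∑ k ∈ compLists m, F k = ∑ k ∈ compLists m with 2 ≤ k.length, F k + F [m] := by
  rw [← Finset.sum_filter_add_sum_filter_not _ (fun k : List ℕ => 2 ≤ k.length)]
  congr 1
  have : (compLists m).filter (fun k => ¬2 ≤ k.length) = {[m]} := by
    ext k
    rw [Finset.mem_filter, Finset.mem_singleton]
    constructor
    · rintro ⟨hk, hk2⟩
      have h1 := length_pos_of_mem_compLists hm hk
      obtain ⟨x, rfl⟩ := List.length_eq_one_iff.1 (by omega : k.length = 1)
      have := (mem_compLists.1 hk).2
      rw [List.sum_singleton] at this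
      rw [this]
    · rintro rfl
      refine ⟨mem_compLists.2 ⟨fun i hi => ?_, List.sum_singleton⟩, by simp⟩
      rw [List.mem_singleton] at hi
      omega
  rw [this, Finset.sum_singleton]

theorem swI_eq {n : ℕ} {H₀ T : Op} {m : ℕ} (hm : 1 ≤ m) :
    swI n H₀ T m = ∑ k ∈ compLists m, ((-1) ^ k.length * swFactor n k) •
        k.foldr (fun l X => ad (swGen n H₀ T l) X) H₀ := by
  rw [swI, sum_composition (1 ≤ ·) fun k => ((-1) ^ k.length * swFactor n k) •
    k.foldr (fun l X => ad (swGen n H₀ T l) X) H₀]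
  congr 1
  exact Finset.filter_true_of_mem fun k hk => length_pos_of_mem_compLists hm hk

/-- Up to order `n` the dressed Hamiltonian consists of the diagonal parts of the potentials. -/
theorem dressed_eq_diagPart {H₀ T : Op} (hH : H₀ ∈ 𝒯 1) (hher : IsHermitianOp H₀) (hT : T ∈ 𝒯 2)
    {n m : ℕ} (h1 : 1 ≤ m) (h2 : m ≤ n) :
    ∑ k ∈ compLists m, swFactor n k • k.foldl (fun X l => ad (swGen n H₀ T l) X) H₀ +
      ∑ k ∈ compLists (m - 1), swFactor n k • k.foldl (fun X l => ad (swGen n H₀ T l) X) T =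
      diagPart H₀ (swPot n H₀ T m) := by
  have hd : diagPart H₀ (swPot n H₀ T m) =
      swPot n H₀ T m + ad (swGen n H₀ T m) H₀ := by
    rw [ad_swGen hH hher hT, offDiagPart]
    abel
  rw [hd, sum_compLists_eq h1, swFactor_singleton h1 h2, one_smul, List.foldl_cons, List.foldl_nil,
    add_right_comm]
  congr 1
  by_cases hm : m = 1
  · subst hm
    rw [swPot_one, Nat.sub_self, compLists_zero, Finset.sum_singleton, swFactor_nil, one_smul,
      List.foldl_nil, Finset.filter_false_of_mem, Finset.sum_empty, zero_add]
    intro k hk hk2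
    obtain ⟨x, hx⟩ := List.exists_mem_of_length_pos (by omega : 0 < k.length)
    have hx1 := lt_of_mem_compLists hk hk2 hx
    have hx2 := (mem_compLists.1 hk).1 x hx
    omega
  · rw [swPot, potentialOf_eq n H₀ T _ hm,
      Finset.filter_true_of_mem fun k hk => length_pos_of_mem_compLists (by omega) hk]

/-- The coefficients of the quasi-conserved operator solve the conservation law order by order. The
coefficient of order zero is `H₀`; `swI` at `0` is the empty sum and does not stand for it. -/
theorem ad_swI_succ {H₀ T : Op} (hH : H₀ ∈ 𝒯 1) (hher : IsHermitianOp H₀) (hT : T ∈ 𝒯 2)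
    {n m : ℕ} (h1 : 1 ≤ m) (h2 : m ≤ n) :
    ad H₀ (swI n H₀ T m) + ad T (if m = 1 then H₀ else swI n H₀ T (m - 1)) = 0 := by
  set G : ℕ → LocOp := fun l => ⟨swGen n H₀ T l, _, swGen_mem hH hher hT n l⟩ with hG
  set h₀ : LocOp := ⟨H₀, 1, hH⟩ with hh₀
  set t : LocOp := ⟨T, 2, hT⟩ with ht
  have key := lie_bwdSeries_eq_zero G h₀ t n n (fun m h1 h2 => by
    refine Subtype.ext ?_
    have e := dressed_eq_diagPart hH hher hT h1 h2
    rw [LocOp.coe_bracket, Submodule.coe_add, coe_coeff_fwdSeries, coe_coeff_fwdSeries]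
    change ad (∑ k ∈ compLists m, swFactor n k • k.foldl (fun X l => ad (swGen n H₀ T l) X) H₀ +
      ∑ k ∈ compLists (m - 1), swFactor n k • k.foldl (fun X l => ad (swGen n H₀ T l) X) T) H₀ = 0
    rw [e, ad_swap, (diagPart_adPinv_spec hH hher (swPot_mem hH hher hT n m)).1.2.1, neg_zero])
    h1 h2
  have key' := congrArg (Subtype.val) key
  rw [Submodule.coe_add, LocOp.coe_bracket, LocOp.coe_bracket, coe_coeff_bwdSeries,
    coe_coeff_bwdSeries] at key'
  rw [swI_eq h1]
  by_cases hm : m = 1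
  · subst hm
    rw [if_pos rfl]
    rw [Nat.sub_self, compLists_zero, Finset.sum_singleton, swFactor_nil] at key'
    simpa using key'
  · rw [if_neg hm, swI_eq (by omega)]
    exact key'

theorem swI_mem {H₀ T : Op} (hH : H₀ ∈ 𝒯 1) (hher : IsHermitianOp H₀) (hT : T ∈ 𝒯 2) (n m : ℕ) :
    swI n H₀ T m ∈ 𝒯 (m + 1) := by
  rw [swI, sum_composition (1 ≤ ·) fun k => ((-1) ^ k.length * swFactor n k) •
    k.foldr (fun l X => ad (swGen n H₀ T l) X) H₀]
  refine sum_mem fun k hk => Submodule.smul_mem _ _ ?_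
  have := foldr_ad_mem hH k fun x _ => swGen_mem hH hher hT n x
  rwa [(mem_compLists.1 (Finset.mem_filter.1 hk).1).2, add_comm] at this

/-- At first order the quasi-conserved operator has only the off-diagonal part of the
perturbation. -/
theorem swI_one {H₀ T : Op} (hH : H₀ ∈ 𝒯 1) (hher : IsHermitianOp H₀) (hT : T ∈ 𝒯 2) {n : ℕ}
    (hn : 1 ≤ n) : swI n H₀ T 1 = offDiagPart H₀ T := by
  rw [swI_eq le_rfl, sum_compLists_succ]
  simp [compLists_zero, swFactor_singleton le_rfl hn, ad_swGen hH hher hT, swPot_one]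

theorem hamiltonian_mem {H₀ T : Op} (hH : H₀ ∈ 𝒯 1) (hT : T ∈ 𝒯 2) (ε : ℝ) :
    hamiltonian H₀ T ε ∈ 𝒯 2 :=
  add_mem (𝒯_mono (by norm_num) hH) (Submodule.smul_mem _ _ hT)

theorem quasiI_mem {H₀ T : Op} (hH : H₀ ∈ 𝒯 1) (hher : IsHermitianOp H₀) (hT : T ∈ 𝒯 2) (n : ℕ)
    (ε : ℝ) : quasiI n H₀ T ε ∈ 𝒯 (n + 1) := by
  refine add_mem (𝒯_mono (by omega) hH) (sum_mem fun m hm => Submodule.smul_mem _ _ ?_)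
  rw [Finset.mem_Icc] at hm
  exact 𝒯_mono (by omega) (swI_mem hH hher hT n m)

/-- Truncating at order `n` leaves only the top-order commutator with the perturbation. -/
theorem ad_hamiltonian_quasiI {H₀ T : Op} (hH : H₀ ∈ 𝒯 1) (hher : IsHermitianOp H₀) (hT : T ∈ 𝒯 2)
    {n : ℕ} (hn : 1 ≤ n) (ε : ℝ) :
    ad (hamiltonian H₀ T ε) (quasiI n H₀ T ε) = (ε : ℂ) ^ (n + 1) • ad T (swI n H₀ T n) := by
  have hHl : IsLocal H₀ := ⟨1, hH⟩
  have hTl : IsLocal T := ⟨2, hT⟩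
  have hIl : ∀ m, IsLocal (swI n H₀ T m) := fun m => ⟨_, swI_mem hH hher hT n m⟩
  have key : ∀ j, 1 ≤ j → j ≤ n →
      ad (hamiltonian H₀ T ε) (H₀ + ∑ m ∈ Finset.Icc 1 j, (ε : ℂ) ^ m • swI n H₀ T m) =
        (ε : ℂ) ^ (j + 1) • ad T (swI n H₀ T j) := by
    have hstep : ∀ m, ad (hamiltonian H₀ T ε) ((ε : ℂ) ^ m • swI n H₀ T m) =
        (ε : ℂ) ^ m • ad H₀ (swI n H₀ T m) + (ε : ℂ) ^ (m + 1) • ad T (swI n H₀ T m) := by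
      intro m
      rw [hamiltonian, ad_smul_right, ad_add_left hHl (LocOp.smul_mem _ hTl) (hIl m),
        ad_smul_left, smul_add, smul_smul, pow_succ]
    have hHam : IsLocal (hamiltonian H₀ T ε) := ⟨2, hamiltonian_mem hH hT ε⟩
    intro j h1 h2
    induction j, h1 using Nat.le_induction with
    | base =>
      have e := ad_swI_succ hH hher hT (n := n) le_rfl h2
      rw [if_pos rfl] at e
      rw [Finset.Icc_self, Finset.sum_singleton,
        ad_add_right hHam hHl (LocOp.smul_mem _ (hIl 1)), hstep, pow_one]
      have e2 : ad (hamiltonian H₀ T ε) H₀ = (ε : ℂ) • ad T H₀ := by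
        rw [hamiltonian, ad_add_left hHl (LocOp.smul_mem _ hTl) hHl, ad_self, zero_add,
          ad_smul_left]
      rw [e2, ← add_assoc, ← smul_add, add_comm (ad T H₀), e, smul_zero, zero_add]
    | succ j hj ih =>
      have e := ad_swI_succ hH hher hT (n := n) (m := j + 1) (by omega) h2
      rw [if_neg (by omega), Nat.add_sub_cancel] at e
      have hloc : IsLocal (H₀ + ∑ m ∈ Finset.Icc 1 j, (ε : ℂ) ^ m • swI n H₀ T m) :=
        LocOp.add_mem hHl (LocOp.sum_mem fun m _ => LocOp.smul_mem _ (hIl m))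
      rw [Finset.sum_Icc_succ_top (by omega), ← add_assoc,
        ad_add_right hHam hloc (LocOp.smul_mem _ (hIl _)), ih (by omega), hstep, ← add_assoc,
        ← smul_add, add_comm (ad T _), e, smul_zero, zero_add]
  exact key n hn le_rfl

end SpinChain

namespace SpinChain

/-! ### Removing the component along the Hamiltonian -/

section Perp

variable {E : Type*} [NormedAddCommGroup E] [InnerProductSpace ℂ E]

/-- The component of `x` orthogonal to `h`; it is `x` itself if `h = 0`. -/
def perp (h x : E) : E := x - (inner ℂ h x / ((‖h‖ ^ 2 : ℝ) : ℂ)) • h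

theorem perp_add (h x y : E) : perp h (x + y) = perp h x + perp h y := by
  simp only [perp, inner_add_right, add_div, add_smul]
  abel

theorem perp_smul (h x : E) (c : ℂ) : perp h (c • x) = c • perp h x := by
  simp only [perp, inner_smul_right, smul_sub, smul_smul, mul_div_assoc]

theorem perp_self {h : E} (hh : h ≠ 0) : perp h h = 0 := by
  have h1 : ((‖h‖ ^ 2 : ℝ) : ℂ) ≠ 0 := by
    have := norm_ne_zero_iff.2 hh
    exact_mod_cast pow_ne_zero 2 this
  have h2 : inner ℂ h h = ((‖h‖ ^ 2 : ℝ) : ℂ) := by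
    rw [inner_self_eq_norm_sq_to_K]
    push_cast
    rfl
  rw [perp, h2, div_self h1, one_smul, sub_self]

theorem norm_inner_div_smul_le (h x : E) :
    ‖(inner ℂ h x / ((‖h‖ ^ 2 : ℝ) : ℂ)) • h‖ ≤ ‖inner ℂ h x‖ / ‖h‖ := by
  rw [norm_smul, norm_div, Complex.norm_real, Real.norm_of_nonneg (sq_nonneg _)]
  rcases eq_or_ne ‖h‖ 0 with h0 | h0
  · simp [h0]
  · refine le_of_eq ?_
    field_simp

theorem norm_perp_le (h x : E) : ‖perp h x‖ ≤ 2 * ‖x‖ := by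
  have h1 : ‖inner ℂ h x‖ / ‖h‖ ≤ ‖x‖ :=
    div_le_of_le_mul₀ (norm_nonneg h) (norm_nonneg x) (by
      rw [mul_comm]
      exact norm_inner_le_norm h x)
  have h2 := norm_sub_le x ((inner ℂ h x / ((‖h‖ ^ 2 : ℝ) : ℂ)) • h)
  have h3 := norm_inner_div_smul_le h x
  rw [perp]
  linarith

/-- A vector `h - ε d + r` with `d` nearly orthogonal to `h` keeps a distance of order `ε ‖d‖` from
the line through `h`. -/
theorem le_norm_perp {h d r : E} {ε : ℝ} (hh : h ≠ 0) (hε : 0 ≤ ε) (hε1 : ε ≤ 1 / 2)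
    (hd : ‖inner ℂ h d‖ ≤ ε * ‖d‖ ^ 2) (hle : ‖d‖ ≤ ‖h‖) :
    ε * ‖d‖ / 2 - 2 * ‖r‖ ≤ ‖perp h (h + (-ε : ℂ) • d + r)‖ := by
  have hpos : 0 < ‖h‖ := norm_pos_iff.2 hh
  have h1 : ‖d‖ / 2 ≤ ‖perp h d‖ := by
    have h2 := norm_sub_norm_le d ((inner ℂ h d / ((‖h‖ ^ 2 : ℝ) : ℂ)) • h)
    have h3 := norm_inner_div_smul_le h d
    have h4 : ‖inner ℂ h d‖ / ‖h‖ ≤ ‖d‖ / 2 := by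
      rw [div_le_iff₀ hpos]
      calc ‖inner ℂ h d‖ ≤ ε * ‖d‖ ^ 2 := hd
        _ ≤ 1 / 2 * ‖d‖ ^ 2 := by gcongr
        _ = ‖d‖ / 2 * ‖d‖ := by ring
        _ ≤ ‖d‖ / 2 * ‖h‖ := by gcongr
    rw [perp]
    linarith
  rw [perp_add, perp_add, perp_self hh, zero_add, perp_smul]
  have h2 : ‖(-ε : ℂ) • perp h d‖ = ε * ‖perp h d‖ := by
    rw [norm_smul, norm_neg, Complex.norm_real, Real.norm_of_nonneg hε]
  have h3 := norm_perp_le h r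
  have h4 := norm_sub_le ((-ε : ℂ) • perp h d + perp h r) (perp h r)
  rw [add_sub_cancel_right, h2] at h4
  have h5 := mul_le_mul_of_nonneg_left h1 hε
  linarith

end Perp

/-! ### The intensive norm on local operators -/

theorem frobNorm_smul (c : ℂ) {A : Op} (hA : IsLocal A) : frobNorm (c • A) = ‖c‖ * frobNorm A :=
  norm_smul c (⟨A, hA⟩ : LocOp)

theorem frobNorm_sum_le {ι : Type*} (F : Finset ι) (A : ι → Op) (hA : ∀ i ∈ F, IsLocal (A i)) :
    frobNorm (∑ i ∈ F, A i) ≤ ∑ i ∈ F, frobNorm (A i) := by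
  have h := norm_sum_le F.attach fun i => (⟨A i, hA i i.2⟩ : LocOp)
  rw [LocOp.norm_def, AddSubmonoidClass.coe_finsetSum] at h
  rw [← Finset.sum_attach F, ← Finset.sum_attach F fun i => frobNorm (A i)]
  exact h

theorem frobNorm_hamiltonian_le {H₀ T : Op} (hH : H₀ ∈ 𝒯 1) (hT : T ∈ 𝒯 2) {Γ ε : ℝ}
    (hΓ : 0 < Γ) (hH₀ : frobNorm H₀ = Γ) (hTΓ : frobNorm T = Γ) (hε : 0 ≤ ε) (hε1 : ε ≤ 1) :
    frobNorm (hamiltonian H₀ T ε) ≤ 2 * Γ := by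
  have h := norm_add_le (⟨H₀, 1, hH⟩ : LocOp) ((ε : ℂ) • (⟨T, 2, hT⟩ : LocOp))
  rw [norm_smul, Complex.norm_real, Real.norm_of_nonneg hε] at h
  simp only [LocOp.norm_def, hH₀, hTΓ] at h
  calc frobNorm (hamiltonian H₀ T ε) ≤ Γ + ε * Γ := h
    _ ≤ 2 * Γ := by nlinarith

/-- The Hamiltonian is not small, and the diagonal part of the perturbation is almost orthogonal
to it: `⟨H₀, T⟩ = 0` passes to the diagonal part because `H₀` lies in the kernel of `ad H₀`. -/
theorem hamiltonian_diagPart_bounds {H₀ T : Op} (hH : H₀ ∈ 𝒯 1) (hher : IsHermitianOp H₀)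
    (hT : T ∈ 𝒯 2) {Γ ε : ℝ} (hΓ : 0 < Γ) (hH₀ : frobNorm H₀ = Γ) (hTΓ : frobNorm T = Γ)
    (horth : frobInner H₀ T = 0) (hε : 0 ≤ ε) :
    Γ ≤ frobNorm (hamiltonian H₀ T ε) ∧ frobNorm (diagPart H₀ T) ≤ Γ ∧
      ‖frobInner (hamiltonian H₀ T ε) (diagPart H₀ T)‖ ≤ ε * frobNorm (diagPart H₀ T) ^ 2 := by
  obtain ⟨⟨hD, hcomm, horthD⟩, -⟩ := diagPart_adPinv_spec hH hher hT
  set h : LocOp := ⟨H₀, 1, hH⟩ with hh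
  set t : LocOp := ⟨T, 2, hT⟩ with ht
  set d : LocOp := ⟨diagPart H₀ T, 2, hD⟩ with hd
  have hhn : ‖h‖ = Γ := hH₀
  have htn : ‖t‖ = Γ := hTΓ
  have e1 : inner ℂ h t = 0 := horth
  have e2 : inner ℂ h (t - d) = 0 := horthD H₀ ⟨1, hH⟩ (ad_self H₀)
  have e3 : inner ℂ d (t - d) = 0 := horthD _ ⟨2, hD⟩ hcomm
  rw [inner_sub_right, e1, zero_sub, neg_eq_zero] at e2
  rw [inner_sub_right, sub_eq_zero, inner_self_eq_norm_sq_to_K] at e3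
  refine ⟨?_, ?_, ?_⟩
  · have h1 : inner ℂ h (h + (ε : ℂ) • t) = ((Γ : ℂ)) ^ 2 := by
      rw [inner_add_right, inner_smul_right, e1, mul_zero, add_zero, inner_self_eq_norm_sq_to_K,
        hhn]
      rfl
    have h2 := norm_inner_le_norm (𝕜 := ℂ) h (h + (ε : ℂ) • t)
    rw [h1, norm_pow, Complex.norm_real, Real.norm_of_nonneg hΓ.le, hhn, sq] at h2
    exact le_of_mul_le_mul_left h2 hΓ
  · change ‖d‖ ≤ Γ
    have h2 := norm_inner_le_norm (𝕜 := ℂ) d t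
    rw [e3, norm_pow, htn] at h2
    have h3 : ‖((‖d‖ : ℝ) : ℂ)‖ = ‖d‖ := by
      rw [Complex.norm_real, norm_norm]
    replace h2 : ‖d‖ ^ 2 ≤ ‖d‖ * Γ := by
      have h4 := h2
      erw [h3] at h4
      exact h4
    rcases (norm_nonneg d).eq_or_lt with h0 | h0
    · rw [← h0]; exact hΓ.le
    · rw [sq] at h2
      exact le_of_mul_le_mul_left h2 h0
  · change ‖inner ℂ (h + (ε : ℂ) • t) d‖ ≤ ε * ‖d‖ ^ 2
    rw [inner_add_left, e2, zero_add, inner_smul_left, norm_mul, norm_inner_symm, e3,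
      RCLike.norm_conj, Complex.norm_real, Real.norm_of_nonneg hε]
    refine le_of_eq ?_
    congr 1
    rw [norm_pow]
    congr 1
    exact (Complex.norm_real _).trans (norm_norm d)

theorem frobNorm_diagPart_pos {H₀ T : Op} (hH : H₀ ∈ 𝒯 1) (hher : IsHermitianOp H₀)
    (hT : T ∈ 𝒯 2) (hne : diagPart H₀ T ≠ 0) : 0 < frobNorm (diagPart H₀ T) := by
  have hD := (diagPart_adPinv_spec hH hher hT).1.1
  have : (⟨diagPart H₀ T, 2, hD⟩ : LocOp) ≠ 0 := fun h => hne (congrArg Subtype.val h)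
  exact norm_pos_iff.2 this

/-! ### Error bounds -/

/-- This trades the growth `(C n) ^ n` for `n ^ (2 n)` up to a constant:
`(C n) ^ n = n ^ (2 n) (C / n) ^ n`. -/
theorem pow_div_pow_self_le_exp {x : ℝ} (hx : 0 ≤ x) (m : ℕ) :
    x ^ m / (m : ℝ) ^ m ≤ Real.exp x := by
  refine le_trans ?_ (Real.pow_div_factorial_le_exp x hx m)
  have h : (m ! : ℝ) ≤ (m : ℝ) ^ m := by exact_mod_cast Nat.factorial_le_pow m
  gcongr

theorem mul_sq_le_of_div_rho_le {n : ℕ} {ε : ℝ} (hn : 1 ≤ n) (hρ : ε / rho n ≤ 1 / 2) :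
    ε * (n : ℝ) ^ 2 ≤ 1 / 526 := by
  have hn0 : (0 : ℝ) < n := by exact_mod_cast hn
  rw [rho, div_div_eq_mul_div, div_one] at hρ
  linarith

theorem quasiIPerp_mem {H₀ T : Op} (hH : H₀ ∈ 𝒯 1) (hher : IsHermitianOp H₀)
    (hT : T ∈ 𝒯 2) {n : ℕ} (hn : 1 ≤ n) (ε : ℝ) : quasiIPerp n H₀ T ε ∈ 𝒯 (n + 1) :=
  sub_mem (quasiI_mem hH hher hT n ε)
    (Submodule.smul_mem _ _ (𝒯_mono (by omega) (hamiltonian_mem hH hT ε)))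

theorem ad_hamiltonian_quasiIPerp {H₀ T : Op} (hH : H₀ ∈ 𝒯 1) (hher : IsHermitianOp H₀)
    (hT : T ∈ 𝒯 2) {n : ℕ} (hn : 1 ≤ n) (ε : ℝ) :
    ad (hamiltonian H₀ T ε) (quasiIPerp n H₀ T ε) = (ε : ℂ) ^ (n + 1) • ad T (swI n H₀ T n) := by
  have hl : IsLocal (hamiltonian H₀ T ε) := ⟨2, hamiltonian_mem hH hT ε⟩
  rw [quasiIPerp, ad_sub_right hl ⟨_, quasiI_mem hH hher hT n ε⟩ (LocOp.smul_mem _ hl),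
    ad_smul_right, ad_self, smul_zero, sub_zero, ad_hamiltonian_quasiI hH hher hT hn]

/-- If the orthogonal part vanishes, both sides are zero. -/
theorem frobNorm_ad_quasiITilde {H₀ T : Op} (hH : H₀ ∈ 𝒯 1) (hher : IsHermitianOp H₀)
    (hT : T ∈ 𝒯 2) {n : ℕ} (hn : 1 ≤ n) (ε : ℝ) :
    frobNorm (ad (hamiltonian H₀ T ε) (quasiITilde n H₀ T ε)) =
      frobNorm (ad (hamiltonian H₀ T ε) (quasiIPerp n H₀ T ε)) /
        frobNorm (quasiIPerp n H₀ T ε) := by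
  have hl : IsLocal (hamiltonian H₀ T ε) := ⟨2, hamiltonian_mem hH hT ε⟩
  rw [quasiITilde, ad_smul_right, frobNorm_smul _ (hl.ad ⟨_, quasiIPerp_mem hH hher hT hn ε⟩),
    Complex.norm_real, Real.norm_of_nonneg (inv_nonneg.2 (frobNorm_nonneg _)), inv_mul_eq_div]

section Bounds

variable {H₀ T : Op} (hH : H₀ ∈ 𝒯 1) (hher : IsHermitianOp H₀) (hT : T ∈ 𝒯 2) {Γ : ℝ} (hΓ : 0 < Γ)
  (hH₀ : frobNorm H₀ = Γ) (hTΓ : frobNorm T = Γ)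

include hH hher hT hΓ hH₀ hTΓ

/-- The remainder of the construction: one commutator of `T` with a term of order `n`. -/
theorem frobNorm_ad_swI_le {n : ℕ} (hn : 1 ≤ n) :
    frobNorm (ad T (swI n H₀ T n)) ≤
      8 ^ 6 * Real.exp (3 * 8 ^ 6) * Γ ^ 2 * (n : ℝ) ^ (2 * n + 1) := by
  have hI := swI_mem hH hher hT n n
  have h1 := opNormR_ad_le hT hI
  have h2 := opNormR_swI_le hH hher hT hΓ hH₀ hTΓ n hn
  have h3 := opNormR_le_frobNorm hT
  rw [hTΓ] at h3
  have hn0 : (0 : ℝ) < n := by exact_mod_cast hn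
  have hn1 : (1 : ℝ) ≤ n := by exact_mod_cast hn
  have h4 : (8 ^ 6 * ((n : ℝ) + 2)) ^ n ≤ Real.exp (3 * 8 ^ 6) * (n : ℝ) ^ (2 * n) := by
    have h5 := pow_div_pow_self_le_exp (x := 3 * 8 ^ 6) (by norm_num) n
    rw [div_le_iff₀ (by positivity)] at h5
    calc (8 ^ 6 * ((n : ℝ) + 2)) ^ n ≤ (3 * 8 ^ 6 * (n : ℝ)) ^ n := by
          refine pow_le_pow_left₀ (by positivity) ?_ n
          linarith
      _ = (3 * 8 ^ 6) ^ n * (n : ℝ) ^ n := mul_pow _ _ _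
      _ ≤ Real.exp (3 * 8 ^ 6) * (n : ℝ) ^ n * (n : ℝ) ^ n := by gcongr
      _ = _ := by rw [mul_assoc, ← pow_add, ← two_mul]
  have hl := opNormR_nonneg (swI n H₀ T n)
  calc frobNorm (ad T (swI n H₀ T n)) ≤ opNormR (ad T (swI n H₀ T n)) :=
        frobNorm_le_opNormR ⟨_, ad_mem hT hI (c := n + 2) (by omega)⟩
    _ ≤ 2 * ((2 : ℕ) + (n + 1 : ℕ)) * (opNormR T * opNormR (swI n H₀ T n)) := h1
    _ ≤ (8 * n) * ((8 ^ (2 * 2 + 1) * Γ) * (Γ * (Real.exp (3 * 8 ^ 6) * (n : ℝ) ^ (2 * n)))) := by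
        have e1 : 2 * (((2 : ℕ) : ℝ) + (n + 1 : ℕ)) ≤ 8 * n := by
          push_cast
          linarith
        have e2 : opNormR (swI n H₀ T n) ≤ Γ * (Real.exp (3 * 8 ^ 6) * (n : ℝ) ^ (2 * n)) :=
          h2.trans (mul_le_mul_of_nonneg_left h4 hΓ.le)
        exact mul_le_mul e1 (mul_le_mul h3 e2 hl (by positivity))
          (mul_nonneg (opNormR_nonneg _) hl) (by positivity)
    _ = _ := by ring

/-- The sum of the orders from two on is of second order, uniformly in the truncation order. -/
theorem frobNorm_tail_le {n : ℕ} {ε : ℝ} (hε : 0 < ε)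
    (hεn : ε * (n : ℝ) ^ 2 ≤ 1 / 526) :
    frobNorm (∑ m ∈ Finset.Icc 2 n, (ε : ℂ) ^ m • swI n H₀ T m) ≤
      Real.exp (48 * 8 ^ 6) * Γ * ε ^ 2 := by
  have hIl : ∀ m, IsLocal (swI n H₀ T m) := fun m => ⟨_, swI_mem hH hher hT n m⟩
  have hterm : ∀ m ∈ Finset.Icc 2 n, frobNorm ((ε : ℂ) ^ m • swI n H₀ T m) ≤
      Γ * ε ^ 2 * ((48 * 8 ^ 6) ^ m / m !) := by
    intro m hm
    rw [Finset.mem_Icc] at hm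
    obtain ⟨j, rfl⟩ : ∃ j, m = j + 2 := ⟨m - 2, by omega⟩
    set M : ℝ := ((j + 2 : ℕ) : ℝ) with hM
    have hM1 : (1 : ℝ) ≤ M := Nat.one_le_cast.2 (by omega)
    have hMn : M ≤ n := Nat.cast_le.2 hm.2
    have h1 : ε * M ^ 2 ≤ 1 := by
      have : ε * M ^ 2 ≤ ε * (n : ℝ) ^ 2 := by gcongr
      linarith
    have h2 := opNormR_swI_le hH hher hT hΓ hH₀ hTΓ n (m := j + 2) (by omega)
    have h3 : frobNorm (swI n H₀ T (j + 2)) ≤ Γ * (3 * 8 ^ 6 * M) ^ (j + 2) := by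
      refine ((frobNorm_le_opNormR (hIl _)).trans h2).trans ?_
      rw [← hM]
      have h5 : 8 ^ 6 * (M + 2) ≤ 3 * 8 ^ 6 * M := by linarith
      gcongr
    have h4 : M ^ 4 ≤ 16 ^ (j + 2) := by
      have h5 : M ≤ 2 ^ (j + 2) := by
        rw [hM]
        exact_mod_cast (Nat.lt_two_pow_self (n := j + 2)).le
      calc M ^ 4 ≤ (2 ^ (j + 2)) ^ 4 := by gcongr
        _ = 16 ^ (j + 2) := by rw [← pow_mul, mul_comm, pow_mul]; norm_num
    have h6 : ((j + 2)! : ℝ) ≤ M ^ (j + 2) := by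
      rw [hM]
      exact_mod_cast Nat.factorial_le_pow (j + 2)
    -- `ε ^ j ≤ M ^ (-2 j)` beats the growth `M ^ (j + 2)` up to `M ^ 4 / M ^ (j + 2)`
    have h7 : ε ^ j * M ^ (j + 2) ≤ 16 ^ (j + 2) / (j + 2)! := by
      rw [le_div_iff₀ (by positivity)]
      calc ε ^ j * M ^ (j + 2) * (j + 2)! ≤ ε ^ j * M ^ (j + 2) * M ^ (j + 2) := by gcongr
        _ = (ε * M ^ 2) ^ j * M ^ 4 := by ring
        _ ≤ 1 ^ j * 16 ^ (j + 2) := by gcongr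
        _ = _ := by rw [one_pow, one_mul]
    rw [frobNorm_smul _ (hIl _), norm_pow, Complex.norm_real, Real.norm_of_nonneg hε.le]
    calc ε ^ (j + 2) * frobNorm (swI n H₀ T (j + 2))
        ≤ ε ^ (j + 2) * (Γ * (3 * 8 ^ 6 * M) ^ (j + 2)) := by gcongr
      _ = Γ * ε ^ 2 * ((3 * 8 ^ 6) ^ (j + 2) * (ε ^ j * M ^ (j + 2))) := by
          rw [mul_pow _ M]; ring
      _ ≤ Γ * ε ^ 2 * ((3 * 8 ^ 6) ^ (j + 2) * (16 ^ (j + 2) / (j + 2)!)) := by gcongr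
      _ = _ := by
          rw [← mul_div_assoc, ← mul_pow]
          norm_num
  have hs : ∀ m, IsLocal ((ε : ℂ) ^ m • swI n H₀ T m) := fun m => LocOp.smul_mem _ (hIl m)
  calc _ ≤ ∑ m ∈ Finset.Icc 2 n, frobNorm ((ε : ℂ) ^ m • swI n H₀ T m) :=
        frobNorm_sum_le _ _ fun m _ => hs m
    _ ≤ ∑ m ∈ Finset.Icc 2 n, Γ * ε ^ 2 * ((48 * 8 ^ 6) ^ m / m !) := Finset.sum_le_sum hterm
    _ ≤ ∑ m ∈ Finset.range (n + 1), Γ * ε ^ 2 * ((48 * 8 ^ 6) ^ m / m !) := by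
        refine Finset.sum_le_sum_of_subset_of_nonneg ?_ fun m _ _ => by positivity
        intro m hm
        rw [Finset.mem_Icc] at hm
        rw [Finset.mem_range]
        omega
    _ = Γ * ε ^ 2 * ∑ m ∈ Finset.range (n + 1), (48 * 8 ^ 6) ^ m / (m ! : ℝ) := by
        rw [Finset.mul_sum]
    _ ≤ Γ * ε ^ 2 * Real.exp (48 * 8 ^ 6) := by
        gcongr
        exact Real.sum_le_exp_of_nonneg (by norm_num) _
    _ = _ := by ring

/-- The first-order term `-ε T^diag` of the quasi-conserved operator, taken relative to the
Hamiltonian, keeps it away from the multiples of the Hamiltonian. -/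
theorem le_frobNorm_quasiIPerp (horth : frobInner H₀ T = 0) {n : ℕ} {ε : ℝ} (hε : 0 < ε)
    (hn : 1 ≤ n) (hεn : ε * (n : ℝ) ^ 2 ≤ 1 / 526) :
    ε * frobNorm (diagPart H₀ T) / 2 - 2 * (Real.exp (48 * 8 ^ 6) * Γ * ε ^ 2) ≤
      frobNorm (quasiIPerp n H₀ T ε) := by
  obtain ⟨hb1, hb2, hb3⟩ := hamiltonian_diagPart_bounds hH hher hT hΓ hH₀ hTΓ horth hε.le
  have htail := frobNorm_tail_le hH hher hT hΓ hH₀ hTΓ hε hεn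
  have hIl : ∀ m, IsLocal (swI n H₀ T m) := fun m => ⟨_, swI_mem hH hher hT n m⟩
  have hε1 : ε ≤ 1 / 2 := by
    have hn1 : (1 : ℝ) ≤ (n : ℝ) ^ 2 := one_le_pow₀ (by exact_mod_cast hn)
    have : ε * 1 ≤ ε * (n : ℝ) ^ 2 := by gcongr
    linarith
  set h : LocOp := ⟨hamiltonian H₀ T ε, 2, hamiltonian_mem hH hT ε⟩ with hh
  set d : LocOp := ⟨diagPart H₀ T, 2, (diagPart_adPinv_spec hH hher hT).1.1⟩ with hd
  set r : LocOp := ⟨∑ m ∈ Finset.Icc 2 n, (ε : ℂ) ^ m • swI n H₀ T m,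
    LocOp.sum_mem fun m _ => LocOp.smul_mem _ (hIl m)⟩ with hr
  have hI : quasiI n H₀ T ε = ((h + (-ε : ℂ) • d + r : LocOp) : Op) := by
    change _ = H₀ + (ε : ℂ) • T + (-ε : ℂ) • diagPart H₀ T +
      ∑ m ∈ Finset.Icc 2 n, (ε : ℂ) ^ m • swI n H₀ T m
    rw [quasiI, ← Finset.add_sum_Ioc_eq_sum_Icc hn, swI_one hH hher hT hn, pow_one, offDiagPart,
      smul_sub, neg_smul]
    have : Finset.Ioc 1 n = Finset.Icc 2 n := rfl
    rw [this]
    abel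
  have hp : quasiIPerp n H₀ T ε = ((perp h (h + (-ε : ℂ) • d + r) : LocOp) : Op) := by
    rw [quasiIPerp, hI]
    rfl
  have hne : h ≠ 0 := norm_pos_iff.1 (hΓ.trans_le hb1)
  have key := le_norm_perp (d := d) (r := r) hne hε.le hε1 hb3 (hb2.trans hb1)
  rw [hp]
  refine le_trans ?_ key
  have h1 : ‖r‖ ≤ Real.exp (48 * 8 ^ 6) * Γ * ε ^ 2 := htail
  have h2 : ‖d‖ = frobNorm (diagPart H₀ T) := rfl
  rw [h2]
  exact sub_le_sub_left (mul_le_mul_of_nonneg_left h1 zero_le_two) _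

/-- A bound at fixed order with no smallness: a commutator of local operators of norms at most
`2 Γ` and `1`. -/
theorem frobNorm_ad_quasiITilde_le {n : ℕ} (hn : 1 ≤ n) {ε : ℝ} (hε : 0 ≤ ε) (hε1 : ε ≤ 1) :
    frobNorm (ad (hamiltonian H₀ T ε) (quasiITilde n H₀ T ε)) ≤
      Γ * (4 * 8 ^ 5 * ((n + 3) * 8 ^ (2 * n + 3))) := by
  have hP := quasiIPerp_mem hH hher hT hn ε
  have hHm := hamiltonian_mem hH hT ε
  have hI : quasiITilde n H₀ T ε ∈ 𝒯 (n + 1) := Submodule.smul_mem _ _ hP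
  have h1 := opNormR_ad_le hHm hI
  have h2 := opNormR_le_frobNorm hHm
  have h3 := opNormR_le_frobNorm hI
  have h4 := frobNorm_hamiltonian_le hH hT hΓ hH₀ hTΓ hε hε1
  have h5 : frobNorm (quasiITilde n H₀ T ε) ≤ 1 := by
    rw [quasiITilde, frobNorm_smul _ ⟨_, hP⟩, Complex.norm_real,
      Real.norm_of_nonneg (inv_nonneg.2 (frobNorm_nonneg _))]
    exact inv_mul_le_one
  calc _ ≤ opNormR (ad (hamiltonian H₀ T ε) (quasiITilde n H₀ T ε)) :=
        frobNorm_le_opNormR ⟨_, ad_mem hHm hI (c := n + 2) (by omega)⟩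
    _ ≤ 2 * ((2 : ℕ) + (n + 1 : ℕ)) *
        (opNormR (hamiltonian H₀ T ε) * opNormR (quasiITilde n H₀ T ε)) := h1
    _ ≤ 2 * ((2 : ℕ) + (n + 1 : ℕ)) *
        ((8 ^ (2 * 2 + 1) * (2 * Γ)) * (8 ^ (2 * (n + 1) + 1) * 1)) := by
        have := opNormR_nonneg (quasiITilde n H₀ T ε)
        gcongr
        · exact h2.trans (by gcongr)
        · exact h3.trans (by gcongr)
    _ = _ := by push_cast; ring

end Bounds

/-! ### The constants -/

/-- For `ε` below this threshold the first order of the quasi-conserved operator dominates. -/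
def smallness (α : ℝ) : ℝ := min 1 (√α / (8 * Real.exp (48 * 8 ^ 6)))

theorem smallness_pos {α : ℝ} (hα : 0 < α) : 0 < smallness α :=
  lt_min one_pos (by positivity)

/-- The bound of `frobNorm_ad_quasiITilde_le` relative to `c ^ n`. -/
def crudeConstant (n : ℕ) (c : ℝ) : ℝ := 4 * 8 ^ 5 * ((n + 3) * 8 ^ (2 * n + 3)) / c ^ n

theorem crudeConstant_mono {n N : ℕ} (h : n ≤ N) {c : ℝ} (hc : 0 < c) (hc1 : c ≤ 1) :
    crudeConstant n c ≤ crudeConstant N c := by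
  have h1 : (n : ℝ) ≤ N := by exact_mod_cast h
  have h2 : c ^ N ≤ c ^ n := pow_le_pow_of_le_one hc.le hc1 h
  unfold crudeConstant
  gcongr
  norm_num

/-- The constant in front of the rate: a contribution of the small `ε`, and one of the finitely
many orders that admit larger ones. -/
def rateConstant (α : ℝ) : ℝ :=
  16 * (8 ^ 6 * Real.exp (3 * 8 ^ 6)) ^ 2 / α + crudeConstant ⌈1 / smallness α⌉₊ (smallness α) ^ 2

end SpinChain

end

theorem mainTheorem1 :
    ∃ C c : ℝ → ℝ, (∀ α, 0 < α → 0 < c α) ∧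
      ∀ (Γ : ℝ) (H₀ T : SpinChain.Op), 0 < Γ →
        H₀ ∈ SpinChain.𝒯 1 → T ∈ SpinChain.𝒯 2 →
        SpinChain.IsHermitianOp H₀ → SpinChain.IsHermitianOp T →
        SpinChain.frobNorm H₀ = Γ → SpinChain.frobNorm T = Γ →
        SpinChain.frobInner H₀ T = 0 → SpinChain.diagPart H₀ T ≠ 0 →
        ∀ α : ℝ, α = SpinChain.frobNorm (SpinChain.diagPart H₀ T) ^ 2 / Γ ^ 2 →
        ∀ (n : ℕ) (ε : ℝ), 1 ≤ n → 0 < ε → ε / SpinChain.rho n ≤ 1 / 2 →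
          (ε ≤ c α → SpinChain.quasiIPerp n H₀ T ε ≠ 0) ∧
          SpinChain.frobNorm (SpinChain.ad (SpinChain.hamiltonian H₀ T ε)
              (SpinChain.quasiITilde n H₀ T ε)) ^ 2 =
            SpinChain.frobNorm (SpinChain.ad (SpinChain.hamiltonian H₀ T ε)
                (SpinChain.quasiIPerp n H₀ T ε)) ^ 2 /
              SpinChain.frobNorm (SpinChain.quasiIPerp n H₀ T ε) ^ 2 ∧
          SpinChain.frobNorm (SpinChain.ad (SpinChain.hamiltonian H₀ T ε)
              (SpinChain.quasiITilde n H₀ T ε)) ^ 2 ≤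
            C α * Γ ^ 2 * (n : ℝ) ^ (4 * n + 6) * ε ^ (2 * n) := by
  refine ⟨SpinChain.rateConstant, SpinChain.smallness, fun α => SpinChain.smallness_pos, ?_⟩
  intro Γ H₀ T hΓ hH hT hher _ hH₀ hTΓ horth hne α hα n ε hn hε hρ
  have hεn := SpinChain.mul_sq_le_of_div_rho_le hn hρ
  have hn1 : (1 : ℝ) ≤ n := by exact_mod_cast hn
  have hD := SpinChain.frobNorm_diagPart_pos hH hher hT hne
  have hα0 : 0 < α := by rw [hα]; positivity
  have hDα : SpinChain.frobNorm (SpinChain.diagPart H₀ T) = √α * Γ := by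
    rw [hα, Real.sqrt_div (sq_nonneg _), Real.sqrt_sq hD.le, Real.sqrt_sq hΓ.le]
    field_simp
  have hs0 := SpinChain.smallness_pos hα0
  have hs1 : SpinChain.smallness α ≤ 1 := min_le_left _ _
  have hε1 : ε ≤ 1 := by
    have : ε * 1 ≤ ε * (n : ℝ) ^ 2 := by
      gcongr
      exact one_le_pow₀ hn1
    linarith
  have hlower : ε ≤ SpinChain.smallness α →
      ε * (√α * Γ) / 4 ≤ SpinChain.frobNorm (SpinChain.quasiIPerp n H₀ T ε) := by
    intro hsm
    have h1 := SpinChain.le_frobNorm_quasiIPerp hH hher hT hΓ hH₀ hTΓ horth hε hn hεn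
    rw [hDα] at h1
    have h2 := hsm.trans (min_le_right _ _)
    rw [le_div_iff₀ (by positivity)] at h2
    have h3 := mul_le_mul_of_nonneg_left h2 (by positivity : 0 ≤ ε * Γ / 4)
    linarith
  have hratio := SpinChain.frobNorm_ad_quasiITilde hH hher hT hn ε
  refine ⟨fun hsm h0 => ?_, ?_, ?_⟩
  · have h1 := hlower hsm
    rw [h0] at h1
    have h2 : SpinChain.frobNorm 0 = 0 := norm_zero (E := SpinChain.LocOp)
    rw [h2] at h1
    have : 0 < ε * (√α * Γ) / 4 := by positivity
    linarith
  · rw [hratio, div_pow]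
  · have hC1 : 0 ≤ 16 * (8 ^ 6 * Real.exp (3 * 8 ^ 6)) ^ 2 / α := by positivity
    have hpow : (n : ℝ) ^ (4 * n + 2) ≤ (n : ℝ) ^ (4 * n + 6) :=
      pow_le_pow_right₀ hn1 (by omega)
    have hnn := SpinChain.frobNorm_nonneg
      (SpinChain.ad (SpinChain.hamiltonian H₀ T ε) (SpinChain.quasiITilde n H₀ T ε))
    by_cases hsm : ε ≤ SpinChain.smallness α
    -- one power of `ε` in the commutator is lost to the norm of the orthogonal part
    · have h1 := hlower hsm
      have h2 := SpinChain.frobNorm_ad_swI_le hH hher hT hΓ hH₀ hTΓ hn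
      have h3 : SpinChain.frobNorm (SpinChain.ad (SpinChain.hamiltonian H₀ T ε)
          (SpinChain.quasiITilde n H₀ T ε)) ≤
          4 * (8 ^ 6 * Real.exp (3 * 8 ^ 6)) / √α * Γ * (n : ℝ) ^ (2 * n + 1) * ε ^ n := by
        rw [hratio, SpinChain.ad_hamiltonian_quasiIPerp hH hher hT hn, SpinChain.frobNorm_smul _
          (SpinChain.IsLocal.ad ⟨2, hT⟩ ⟨_, SpinChain.swI_mem hH hher hT n n⟩), norm_pow,
          Complex.norm_real, Real.norm_of_nonneg hε.le,
          div_le_iff₀ (lt_of_lt_of_le (by positivity) h1)]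
        calc _ ≤ ε ^ (n + 1) *
              (8 ^ 6 * Real.exp (3 * 8 ^ 6) * Γ ^ 2 * (n : ℝ) ^ (2 * n + 1)) := by gcongr
          _ = 4 * (8 ^ 6 * Real.exp (3 * 8 ^ 6)) / √α * Γ * (n : ℝ) ^ (2 * n + 1) * ε ^ n *
              (ε * (√α * Γ) / 4) := by
              have : √α ≠ 0 := (Real.sqrt_pos.2 hα0).ne'
              field_simp
              ring
          _ ≤ _ := by gcongr
      calc _ ≤ (4 * (8 ^ 6 * Real.exp (3 * 8 ^ 6)) / √α * Γ * (n : ℝ) ^ (2 * n + 1) * ε ^ n) ^ 2 :=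
            pow_le_pow_left₀ hnn h3 2
        _ = 16 * (8 ^ 6 * Real.exp (3 * 8 ^ 6)) ^ 2 / α * Γ ^ 2 * (n : ℝ) ^ (4 * n + 2) *
            ε ^ (2 * n) := by
            rw [mul_pow, mul_pow, mul_pow, div_pow, Real.sq_sqrt hα0.le, ← pow_mul, ← pow_mul,
              show (2 * n + 1) * 2 = 4 * n + 2 by ring, mul_comm n 2]
            ring
        _ ≤ SpinChain.rateConstant α * Γ ^ 2 * (n : ℝ) ^ (4 * n + 6) * ε ^ (2 * n) := by
            have : 16 * (8 ^ 6 * Real.exp (3 * 8 ^ 6)) ^ 2 / α ≤ SpinChain.rateConstant α :=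
              le_add_of_nonneg_right (sq_nonneg _)
            have h4 := hC1.trans this
            gcongr
    · push Not at hsm
      have hnN : n ≤ ⌈1 / SpinChain.smallness α⌉₊ := by
        have h1 : (n : ℝ) ≤ 1 / SpinChain.smallness α := by
          rw [le_div_iff₀ hs0]
          have h2 : (n : ℝ) ≤ (n : ℝ) ^ 2 := by nlinarith
          calc (n : ℝ) * SpinChain.smallness α ≤ (n : ℝ) ^ 2 * ε := by gcongr
            _ ≤ 1 := by linarith
        exact_mod_cast h1.trans (Nat.le_ceil _)
      -- the order is bounded in terms of `α`, and `ε` is bounded below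
      have h1 := SpinChain.frobNorm_ad_quasiITilde_le hH hher hT hΓ hH₀ hTΓ hn hε.le hε1
      have h2 := SpinChain.crudeConstant_mono hnN hs0 hs1
      have h3 : SpinChain.frobNorm (SpinChain.ad (SpinChain.hamiltonian H₀ T ε)
          (SpinChain.quasiITilde n H₀ T ε)) ≤
          SpinChain.crudeConstant ⌈1 / SpinChain.smallness α⌉₊ (SpinChain.smallness α) * Γ *
            ε ^ n := by
        calc _ ≤ Γ * (4 * 8 ^ 5 * ((n + 3) * 8 ^ (2 * n + 3))) := h1
          _ = SpinChain.crudeConstant n (SpinChain.smallness α) * Γ *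
              SpinChain.smallness α ^ n := by
              rw [SpinChain.crudeConstant]
              field_simp
          _ ≤ _ := by
              have : 0 ≤ SpinChain.crudeConstant n (SpinChain.smallness α) := by
                unfold SpinChain.crudeConstant
                positivity
              have h3 := this.trans h2
              gcongr
      calc _ ≤ (SpinChain.crudeConstant ⌈1 / SpinChain.smallness α⌉₊ (SpinChain.smallness α) * Γ *
            ε ^ n) ^ 2 := pow_le_pow_left₀ hnn h3 2
        _ = SpinChain.crudeConstant ⌈1 / SpinChain.smallness α⌉₊ (SpinChain.smallness α) ^ 2 *
            Γ ^ 2 * 1 * ε ^ (2 * n) := by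
            rw [mul_pow, mul_pow, ← pow_mul, mul_comm n 2]
            ring
        _ ≤ SpinChain.rateConstant α * Γ ^ 2 * (n : ℝ) ^ (4 * n + 6) * ε ^ (2 * n) := by
            have h4 : SpinChain.crudeConstant ⌈1 / SpinChain.smallness α⌉₊
                (SpinChain.smallness α) ^ 2 ≤ SpinChain.rateConstant α :=
              le_add_of_nonneg_left hC1
            have h5 : (1 : ℝ) ≤ (n : ℝ) ^ (4 * n + 6) := one_le_pow₀ hn1
            have h6 : 0 ≤ SpinChain.rateConstant α := (sq_nonneg _).trans h4
            gcongr
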